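/- Let $F=F(x,y,z,p)$ be a real $C^\infty$ function on an open set $U\subseteq\mathbb R^4=J_4$, write $D=\partial_x+p\,\partial_z$, $\Delta=\partial_y+F\,\partial_z$, $\Delta F_{p\cdots p}:=\Delta(F_{p\cdots p})$, and assume $DF\equiv0$ and $F_{pp}\neq0$ everywhere on $U$. To the PDE $z_y=F(x,y,z,z_x)$, $p=z_x$, associate $\omega_0^1=dz-p\,dx-F\,dy$, $\omega_0^2=dp$, $\omega_0^3=dx$, $\omega_0^4=dy$, considered up to smooth functions with values in the group $G$ of invertible matrices $$\begin{pmatrix}u_1&0&0&0\\u_2&u_3&0&0\\u_4&0&u_5&u_6\\u_7&0&u_8&u_9\end{pmatrix}.$$ Two such PDEs, for $F$ on $U$ and $\overline F$ on $\overline U$, are called locally point equivalent at $j_0\in U$, $\overline j_0\in\overline U$ if there are a local diffeomorphism $(x,y,z)\mapsto(\overline x,\overline y,\overline z)$ and a local diffeomorphism $\varphi$ of $(x,y,z,p)$-space lying over it, defined near $j_0$, with $\varphi(j_0)=\overline j_0$, such that $\varphi^*\overline\omega_0=g\,\omega_0$ with $g$ pointwise in $G$ (that is, a point transformation whose prolongation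 carries the system $z_y=F$, $z_{xx}=0$ into the corresponding system for $\overline F$). Put $$\omega^1=\omega_0^1,\qquad \omega^2=\omega_0^2-\frac{\Delta F_{ppp}F_{pp}-\Delta F_{pp}F_{ppp}+3F_pF_{pp}F_{zpp}-3F_{pp}^2F_{zp}-2F_pF_{ppp}F_{zp}}{6F_{pp}^3}\,\omega_0^1,$$ $$\omega^3=\omega_0^3+F_p\,\omega_0^4-\frac{F_{ppp}}{3F_{pp}}\,\omega_0^1,\qquad \omega^4=F_{pp}\,\omega_0^4+\frac{4F_{ppp}^2-3F_{pp}F_{pppp}}{18F_{pp}^2}\,\omega_0^1 .$$ Let $H_3$ be the group of matrices $$h=\begin{pmatrix}u_3u_5&0&0&0\\0&u_3&0&0\\-u_3u_8&0&u_5&0\\-\frac{u_3u_8^2}{2u_5}&0&u_8&\frac{u_5}{u_3}\end{pmatrix},\qquad u_3,u_5\in\mathbb R^*,\ u_8\in\mathbb R,$$ let $P_7=U\times H_3\to U$ be the principal $H_3$-bundle with action $a\cdot(j,h)=(j,ah)$, and let $(\theta^1,\theta^2,\theta^3,\theta^4)^T:=h\,(\omega^1,\omega^2,\omega^3,\omega^4)^T$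 on $P_7$. Then: (1) There are unique smooth $1$-forms $\Omega_1,\Omega_2,\Omega_3$ on $P_7$ such that $\{\theta^1,\theta^2,\theta^3,\theta^4,\Omega_1,\Omega_2,\Omega_3\}$ is a coframe satisfying, for some functions $A_1,A_2,A_3,B_1,\dots,B_4,C_1,E_1,E_2$ on $P_7$ (which are then also unique), the structure equations $$\begin{aligned} d\theta^1&=\Omega_1\wedge\theta^1-\theta^2\wedge\theta^3,\\ d\theta^2&=(\Omega_1-\Omega_3)\wedge\theta^2+B_1\,\theta^1\wedge\theta^3-B_2\,\theta^1\wedge\theta^4,\\ d\theta^3&=\Omega_2\wedge\theta^1+\Omega_3\wedge\theta^3+\theta^2\wedge\theta^4,\\ d\theta^4&=(2\Omega_3-\Omega_1)\wedge\theta^4-\Omega_2\wedge\theta^3-A_1\,\theta^1\wedge\theta^2,\\ d\Omega_1&=\Omega_2\wedge\theta^2+(A_2-2C_1)\theta^1\wedge\theta^2+(3B_3+E_1)\theta^1\wedge\theta^3+(2B_1-3B_4)\theta^1\wedge\theta^4+B_2\,\theta^3\wedge\theta^4,\\ d\Omega_2&=\Omega_2\wedge(\Omega_1-\Omega_3)-A_3\,\theta^1\wedge\theta^2+E_2\,\theta^1\wedge\theta^3-(B_3+E_1)\theta^1\wedge\theta^4+C_1\,\theta^2\wedge\theta^3+(B_1-2B_4)\theta^3\wedge\theta^4,\\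 d\Omega_3&=-C_1\,\theta^1\wedge\theta^2+(2B_3+E_1)\theta^1\wedge\theta^3+2(B_1-B_4)\theta^1\wedge\theta^4+2B_2\,\theta^3\wedge\theta^4, \end{aligned}$$ which are those of the Cartan connection of third-order ODEs modulo point transformations. (2) The bundle is unique: $\omega=g_0\,\omega_0$ for some smooth $g_0:U\to G$; and if $V\subseteq U$ is open, $g:V\to G$ is smooth and the forms $h\,g\,\omega_0$ on $V\times H_3$ can be completed by three $1$-forms to a coframe satisfying structure equations of this shape, then $g\,\omega_0=k\,\omega$ on $V$ with $k$ pointwise in $H_3$. (3) One has $$A_1=-\frac1{54}\,\frac1{u_3^3}\,\frac{M}{F_{pp}^3},\qquad C_1=\frac13\,\frac1{u_3^2u_5}\,\frac{K}{F_{pp}^5},$$ where $M=9F_{ppppp}F_{pp}^2-45F_{pppp}F_{ppp}F_{pp}+40F_{ppp}^3$ is the Monge invariant and $$\begin{aligned} K={}&\Delta F_{ppppp}F_{pp}^3-5\Delta F_{pppp}F_{pp}^2F_{ppp}+12\Delta F_{ppp}F_{pp}F_{ppp}^2-12\Delta F_{pp}F_{ppp}^3-4\Delta F_{ppp}F_{pp}^2F_{pppp}\\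 &+9\Delta F_{pp}F_{pp}F_{ppp}F_{pppp}-\Delta F_{pp}F_{pp}^2F_{ppppp}+5F_pF_{pp}^3F_{ppppz}+6F_{pp}^4F_{pppz}-20F_pF_{pp}^2F_{ppp}F_{pppz}\\ &-12F_{pp}^3F_{ppp}F_{ppz}+36F_pF_{pp}F_{ppp}^2F_{ppz}-12F_pF_{pp}^2F_{pppp}F_{ppz}+8F_{pp}^2F_{ppp}^2F_{pz}-24F_pF_{ppp}^3F_{pz}\\ &-3F_{pp}^3F_{pppp}F_{pz}+18F_pF_{pp}F_{ppp}F_{pppp}F_{pz}-2F_pF_{pp}^2F_{ppppp}F_{pz}. \end{aligned}$$ (4) All the functions $A_1,\dots,E_2$ depend only on $u_3,u_5,u_8$ and on $F$ and its partial derivatives of order at most $6$: if $F$ and $\overline F$ (both as above) have the same derivatives of orders $0,\dots,6$ at $j\in U$ and $\overline j\in\overline U$ respectively, then their invariants at $(j,u_3,u_5,u_8)$ and $(\overline j,u_3,u_5,u_8)$ agree. (5) For $F$ on $U$ and $\overline F$ on $\overline U$ as above and $j_0\in U$, $\overline j_0\in\overline U$, the two PDEs are locally point equivalent at $j_0,\overline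 j_0$ if and only if there is an isomorphism of principal $H_3$-bundles $\Phi$ from $P_7$ over a neighbourhood of $j_0$ onto $\overline P_7$ over a neighbourhood of $\overline j_0$, covering a diffeomorphism that maps $j_0$ to $\overline j_0$, with $\Phi^*\overline\theta^\mu=\theta^\mu$ ($\mu=1,\dots,4$) and $\Phi^*\overline\Omega_i=\Omega_i$ ($i=1,2,3$). -/

import Mathlib

open scoped ContDiff

noncomputable section

namespace CartanPDE

/-! ### Exterior calculus of 1-forms on a normed space -/

/-- Differential 1-forms (fields of covectors) on `E`. -/
abbrev OneForm (E : Type) [NormedAddCommGroup E] [NormedSpace ℝ E] : Type := E → (E →L[ℝ] ℝ)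

section Forms

variable {E : Type} [NormedAddCommGroup E] [NormedSpace ℝ E]

/-- The exterior derivative of a 1-form, as a bilinear function of two tangent vectors. -/
def extD (α : OneForm E) (q : E) : E → E → ℝ := fun v w =>
  extDeriv (fun x => ContinuousAlternatingMap.ofSubsingleton ℝ E ℝ (0 : Fin 1) (α x)) q ![v, w]

/-- The wedge product of two covectors: `α ∧ β = α ⊗ β - β ⊗ α`. -/
def wedge (α β : E →L[ℝ] ℝ) : E → E → ℝ := fun v w => α v * β w - α w * β v

theorem extD_apply (α : OneForm E) (q : E) (h : DifferentiableAt ℝ α q) (v w : E) :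
    extD α q v w = fderiv ℝ α q v w - fderiv ℝ α q w v := by
  have h' : DifferentiableAt ℝ
      (fun x => ContinuousAlternatingMap.ofSubsingleton ℝ E ℝ (0 : Fin 1) (α x)) q :=
    ((ContinuousAlternatingMap.ofSubsingletonLIE (𝕜 := ℝ) (E := E) (F := ℝ) (0 : Fin 1)).differentiable.differentiableAt
      (x := α q)).comp q h
  unfold extD
  rw [extDeriv_apply h', Fin.sum_univ_two]
  have key : ∀ u : E, ∀ i : Fin 1 → E, i 0 = u →
      (fun x => ContinuousAlternatingMap.ofSubsingleton ℝ E ℝ (0 : Fin 1) (α x) i)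
        = fun x => α x u := by
    intro u i hi; funext x; simp [hi]
  rw [key w (Fin.removeNth 0 ![v, w]) (by simp [Fin.removeNth]),
    key v (Fin.removeNth 1 ![v, w]) (by simp [Fin.removeNth])]
  simp [fderiv_clm_apply h (differentiableAt_const _), sub_eq_add_neg]

end Forms

local infixl:70 " ⋏ " => wedge

/-! ### The space of first jets, with coordinates `(x, y, z, p)` -/

/-- Points `(x, y, z)`. -/
abbrev J3 : Type := Fin 3 → ℝ

/-- First jets `(x, y, z, p)`, where `p = z_x`. -/
abbrev J4 : Type := Fin 4 → ℝ

/-- The projection `(x, y, z, p) ↦ (x, y, z)`. -/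
def toBase (j : J4) : J3 := ![j 0, j 1, j 2]

/-- The partial derivative in the direction of the `i`-th coordinate. -/
def pd (i : Fin 4) (f : J4 → ℝ) : J4 → ℝ := fun j => fderiv ℝ f j (Pi.single i 1)

/-- The coordinate differentials `dx, dy, dz, dp`. -/
def dcoord (i : Fin 4) : J4 →L[ℝ] ℝ := ContinuousLinearMap.proj i

/-- `D = ∂_x + p ∂_z`. -/
def opD (f : J4 → ℝ) : J4 → ℝ := fun j => pd 0 f j + j 3 * pd 2 f j

/-- `Δ = ∂_y + F ∂_z`. -/
def opDelta (F f : J4 → ℝ) : J4 → ℝ := fun j => pd 1 f j + F j * pd 2 f j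

/-- The `n`-th partial derivative with respect to `p`. -/
def dp (n : ℕ) (f : J4 → ℝ) : J4 → ℝ := (pd 3)^[n] f

/-- `∂_z ∂_p^n f`. -/
def dzp (n : ℕ) (f : J4 → ℝ) : J4 → ℝ := pd 2 (dp n f)

/-- `Δ (∂_p^n F)`. -/
def deltaP (n : ℕ) (F : J4 → ℝ) : J4 → ℝ := opDelta F (dp n F)

/-- The PDEs `z_y = F(x, y, z, z_x)` under consideration: `F` is smooth on the open set `U`,
`D F ≡ 0` and `F_pp` vanishes nowhere. -/
structure IsAdmissible (U : Set J4) (F : J4 → ℝ) : Prop where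
  isOpen : IsOpen U
  smooth : ContDiffOn ℝ ∞ F U
  opD_eq_zero : ∀ j ∈ U, opD F j = 0
  Fpp_ne_zero : ∀ j ∈ U, dp 2 F j ≠ 0

/-- The Monge invariant. -/
def monge (F : J4 → ℝ) (j : J4) : ℝ :=
  9 * dp 5 F j * dp 2 F j ^ 2 - 45 * dp 4 F j * dp 3 F j * dp 2 F j + 40 * dp 3 F j ^ 3

/-- The invariant `K`. -/
def invK (F : J4 → ℝ) (j : J4) : ℝ :=
  deltaP 5 F j * dp 2 F j ^ 3 - 5 * deltaP 4 F j * dp 2 F j ^ 2 * dp 3 F j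
  + 12 * deltaP 3 F j * dp 2 F j * dp 3 F j ^ 2
  - 12 * deltaP 2 F j * dp 3 F j ^ 3
  - 4 * deltaP 3 F j * dp 2 F j ^ 2 * dp 4 F j
  + 9 * deltaP 2 F j * dp 2 F j * dp 3 F j * dp 4 F j
  - deltaP 2 F j * dp 2 F j ^ 2 * dp 5 F j
  + 5 * dp 1 F j * dp 2 F j ^ 3 * dzp 4 F j
  + 6 * dp 2 F j ^ 4 * dzp 3 F j
  - 20 * dp 1 F j * dp 2 F j ^ 2 * dp 3 F j * dzp 3 F j
  - 12 * dp 2 F j ^ 3 * dp 3 F j * dzp 2 F j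
  + 36 * dp 1 F j * dp 2 F j * dp 3 F j ^ 2 * dzp 2 F j
  - 12 * dp 1 F j * dp 2 F j ^ 2 * dp 4 F j * dzp 2 F j
  + 8 * dp 2 F j ^ 2 * dp 3 F j ^ 2 * dzp 1 F j
  - 24 * dp 1 F j * dp 3 F j ^ 3 * dzp 1 F j
  - 3 * dp 2 F j ^ 3 * dp 4 F j * dzp 1 F j
  + 18 * dp 1 F j * dp 2 F j * dp 3 F j * dp 4 F j * dzp 1 F j
  - 2 * dp 1 F j * dp 2 F j ^ 2 * dp 5 F j * dzp 1 F j

/-! ### Coframes on the jet space -/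

/-- The initial coframe `dz - p dx - F dy, dp, dx, dy`. -/
def omega0 (F : J4 → ℝ) : Fin 4 → OneForm J4 :=
  ![fun j => dcoord 2 - j 3 • dcoord 0 - F j • dcoord 1,
    fun _ => dcoord 3,
    fun _ => dcoord 0,
    fun _ => dcoord 1]

/-- The adapted coframe `ω¹, ω², ω³, ω⁴`. -/
def omega (F : J4 → ℝ) : Fin 4 → OneForm J4 :=
  ![omega0 F 0,
    fun j => omega0 F 1 j
      - ((deltaP 3 F j * dp 2 F j - deltaP 2 F j * dp 3 F j + 3 * dp 1 F j * dp 2 F j * dzp 2 F j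
          - 3 * dp 2 F j ^ 2 * dzp 1 F j - 2 * dp 1 F j * dp 3 F j * dzp 1 F j)
        / (6 * dp 2 F j ^ 3)) • omega0 F 0 j,
    fun j => omega0 F 2 j + dp 1 F j • omega0 F 3 j
      - (1 / 3 * (dp 3 F j / dp 2 F j)) • omega0 F 0 j,
    fun j => dp 2 F j • omega0 F 3 j
      + ((4 * dp 3 F j ^ 2 - 3 * dp 2 F j * dp 4 F j) / (18 * dp 2 F j ^ 2)) • omega0 F 0 j]

/-- The invertible matrices
`[[u₁,0,0,0],[u₂,u₃,0,0],[u₄,0,u₅,u₆],[u₇,0,u₈,u₉]]`, up to which `omega0 F` is given. -/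
def IsParaCRMatrix (g : Matrix (Fin 4) (Fin 4) ℝ) : Prop :=
  g.det ≠ 0 ∧ g 0 1 = 0 ∧ g 0 2 = 0 ∧ g 0 3 = 0 ∧ g 1 2 = 0 ∧ g 1 3 = 0 ∧ g 2 1 = 0 ∧ g 3 1 = 0

/-- A matrix acting on a quadruple of covectors. -/
def matAct {E : Type} [NormedAddCommGroup E] [NormedSpace ℝ E] (g : Matrix (Fin 4) (Fin 4) ℝ)
    (α : Fin 4 → (E →L[ℝ] ℝ)) : Fin 4 → (E →L[ℝ] ℝ) := fun i => ∑ k, g i k • α k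

/-- A coframe modified by a field of matrices. -/
def modify (g : J4 → Matrix (Fin 4) (Fin 4) ℝ) (α : Fin 4 → OneForm J4) : Fin 4 → OneForm J4 :=
  fun i j => matAct (g j) (fun k => α k j) i

/-! ### The reduced structure group -/

/-- The matrix with parameters `u = (u₃, u₅, u₈)`. -/
def hMat (u : Fin 3 → ℝ) : Matrix (Fin 4) (Fin 4) ℝ :=
  !![u 0 * u 1, 0, 0, 0;
     0, u 0, 0, 0;
     -(u 0 * u 2), 0, u 1, 0;
     -(u 0 * u 2 ^ 2 / (2 * u 1)), 0, u 2, u 1 / u 0]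

/-- The admissible parameters: `u₃ ≠ 0`, `u₅ ≠ 0`. -/
def params : Set (Fin 3 → ℝ) := {u | u 0 ≠ 0 ∧ u 1 ≠ 0}

/-- The group law of `H₃` in the parameters. -/
def hMul (a b : Fin 3 → ℝ) : Fin 3 → ℝ :=
  ![a 0 * b 0, a 1 * b 1, a 2 * b 1 + a 1 / a 0 * b 2]

/-- Inversion in `H₃` in the parameters. -/
def hInv (a : Fin 3 → ℝ) : Fin 3 → ℝ :=
  ![(a 0)⁻¹, (a 1)⁻¹, -(a 0 * a 2 / a 1 ^ 2)]

theorem hMul_mem {a b : Fin 3 → ℝ} (ha : a ∈ params) (hb : b ∈ params) : hMul a b ∈ params :=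
  ⟨mul_ne_zero ha.1 hb.1, mul_ne_zero ha.2 hb.2⟩

theorem hInv_mem {a : Fin 3 → ℝ} (ha : a ∈ params) : hInv a ∈ params :=
  ⟨inv_ne_zero ha.1, inv_ne_zero ha.2⟩

theorem hMat_hMul {a b : Fin 3 → ℝ} (ha : a ∈ params) (hb : b ∈ params) :
    hMat (hMul a b) = hMat a * hMat b := by
  obtain ⟨ha0, ha1⟩ := ha
  obtain ⟨hb0, hb1⟩ := hb
  ext i j
  fin_cases i <;> fin_cases j <;>
    simp [hMat, hMul, Matrix.mul_apply, Fin.sum_univ_four] <;> field_simp <;> ring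

theorem hMat_one : hMat ![1, 1, 0] = 1 := by
  ext i j
  fin_cases i <;> fin_cases j <;> simp [hMat]

theorem hMat_hInv {a : Fin 3 → ℝ} (ha : a ∈ params) : hMat (hInv a) * hMat a = 1 := by
  rw [← hMat_hMul (hInv_mem ha) ha, ← hMat_one]
  obtain ⟨ha0, ha1⟩ := ha
  congr 1
  ext i
  fin_cases i <;> simp [hMul, hInv, ha0, ha1]
  field_simp
  ring

theorem hMat_injOn : Set.InjOn hMat params := by
  intro a _ b _ h
  have e (i j) : hMat a i j = hMat b i j := by rw [h]
  ext i
  fin_cases i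
  · simpa [hMat] using e 1 1
  · simpa [hMat] using e 2 2
  · simpa [hMat] using e 3 2

/-- The structure group `H₃`, a subgroup of `GL(4, ℝ)`. -/
def H3 : Subgroup (GL (Fin 4) ℝ) where
  carrier := {g | ∃ u ∈ params, (g : Matrix (Fin 4) (Fin 4) ℝ) = hMat u}
  mul_mem' := by
    rintro g g' ⟨u, hu, e⟩ ⟨u', hu', e'⟩
    exact ⟨hMul u u', hMul_mem hu hu', by rw [hMat_hMul hu hu', ← e, ← e']; rfl⟩
  one_mem' := ⟨![1, 1, 0], ⟨by simp, by simp⟩, hMat_one.symm⟩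
  inv_mem' := by
    rintro g ⟨u, hu, e⟩
    refine ⟨hInv u, hInv_mem hu, ?_⟩
    have h1 : hMat (hInv u) * (g : Matrix (Fin 4) (Fin 4) ℝ) = 1 := by rw [e]; exact hMat_hInv hu
    calc ((g⁻¹ : GL (Fin 4) ℝ) : Matrix (Fin 4) (Fin 4) ℝ)
        = (hMat (hInv u) * (g : Matrix (Fin 4) (Fin 4) ℝ)) *
            ((g⁻¹ : GL (Fin 4) ℝ) : Matrix (Fin 4) (Fin 4) ℝ) := by rw [h1, one_mul]
      _ = hMat (hInv u) := by
        rw [mul_assoc, ← Units.val_mul, mul_inv_cancel, Units.val_one, mul_one]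

/-! ### The 7-dimensional bundle -/

/-- Coordinates `((x, y, z, p), (u₃, u₅, u₈))`. -/
abbrev P7 : Type := J4 × (Fin 3 → ℝ)

/-- The part over `U` of the bundle `J₄ × H₃ → J₄`; the group element with parameters `u`
is `hMat u`. -/
def bundle (U : Set J4) : Set P7 := U ×ˢ params

/-- The action of `H₃` (in the parameters) on the bundle. -/
def act (a : Fin 3 → ℝ) (q : P7) : P7 := (q.1, hMul a q.2)

/-- `H₃` acts simply transitively on the fibres. -/
theorem existsUnique_act {U : Set J4} {q q' : P7} (hq : q ∈ bundle U) (hq' : q' ∈ bundle U)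
    (h : q.1 = q'.1) : ∃! a, a ∈ params ∧ act a q = q' := by
  obtain ⟨-, h0, h1⟩ := hq
  obtain ⟨-, h0', h1'⟩ := hq'
  refine ⟨![q'.2 0 / q.2 0, q'.2 1 / q.2 1,
    (q'.2 2 - (q'.2 1 / q.2 1) / (q'.2 0 / q.2 0) * q.2 2) / q.2 1],
    ⟨⟨div_ne_zero h0' h0, div_ne_zero h1' h1⟩, ?_⟩, ?_⟩
  · refine Prod.ext h ?_
    ext i
    fin_cases i <;> simp [act, hMul] <;> field_simp
    ring
  · rintro a ⟨-, e⟩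
    have e0 := congrFun (congrArg Prod.snd e) 0
    have e1 := congrFun (congrArg Prod.snd e) 1
    have e2 := congrFun (congrArg Prod.snd e) 2
    simp only [act, hMul, Matrix.cons_val] at e0 e1 e2
    have a0 : a 0 = q'.2 0 / q.2 0 := by rw [eq_div_iff h0, e0]
    have a1 : a 1 = q'.2 1 / q.2 1 := by rw [eq_div_iff h1, e1]
    ext i
    fin_cases i
    · simpa using a0
    · simpa using a1
    · simp only [Matrix.cons_val, Fin.reduceFinMk]
      rw [eq_div_iff h1, ← e2, ← a0, ← a1]
      ring

/-- The forms `θ = h α` on the bundle, where `α` is a coframe on the jet space and `h` is the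
variable element of `H₃`. -/
def lift (α : Fin 4 → OneForm J4) : Fin 4 → OneForm P7 := fun i q =>
  matAct (hMat q.2) (fun k => (α k q.1).comp (ContinuousLinearMap.fst ℝ J4 (Fin 3 → ℝ))) i

/-- The values of the curvature invariants at a point. -/
structure Curvature where
  (A1 A2 A3 B1 B2 B3 B4 C1 E1 E2 : ℝ)

/-- The structure equations, over the set `W`. -/
def StructureEquations (W : Set P7) (θ : Fin 4 → OneForm P7) (Ω : Fin 3 → OneForm P7)
    (I : P7 → Curvature) : Prop :=
  ∀ q ∈ W,
    let t1 := θ 0 q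
    let t2 := θ 1 q
    let t3 := θ 2 q
    let t4 := θ 3 q
    let o1 := Ω 0 q
    let o2 := Ω 1 q
    let o3 := Ω 2 q
    let c := I q
    extD (θ 0) q = o1 ⋏ t1 - t2 ⋏ t3 ∧
    extD (θ 1) q = (o1 - o3) ⋏ t2 + c.B1 • (t1 ⋏ t3) - c.B2 • (t1 ⋏ t4) ∧
    extD (θ 2) q = o2 ⋏ t1 + o3 ⋏ t3 + t2 ⋏ t4 ∧
    extD (θ 3) q = ((2 : ℝ) • o3 - o1) ⋏ t4 - o2 ⋏ t3 - c.A1 • (t1 ⋏ t2) ∧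
    extD (Ω 0) q = o2 ⋏ t2 + (c.A2 - 2 * c.C1) • (t1 ⋏ t2) + (3 * c.B3 + c.E1) • (t1 ⋏ t3)
      + (2 * c.B1 - 3 * c.B4) • (t1 ⋏ t4) + c.B2 • (t3 ⋏ t4) ∧
    extD (Ω 1) q = o2 ⋏ (o1 - o3) - c.A3 • (t1 ⋏ t2) + c.E2 • (t1 ⋏ t3)
      - (c.B3 + c.E1) • (t1 ⋏ t4) + c.C1 • (t2 ⋏ t3) + (c.B1 - 2 * c.B4) • (t3 ⋏ t4) ∧
    extD (Ω 2) q = -(c.C1 • (t1 ⋏ t2)) + (2 * c.B3 + c.E1) • (t1 ⋏ t3)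
      + (2 * (c.B1 - c.B4)) • (t1 ⋏ t4) + (2 * c.B2) • (t3 ⋏ t4)

/-- `θ¹, …, θ⁴, Ω₁, Ω₂, Ω₃` is a smooth coframe on `W` which satisfies the structure equations
with the curvature invariants `I`. -/
structure IsCartanCoframe (W : Set P7) (θ : Fin 4 → OneForm P7) (Ω : Fin 3 → OneForm P7)
    (I : P7 → Curvature) : Prop where
  smooth_theta : ∀ μ, ContDiffOn ℝ ∞ (θ μ) W
  smooth_Omega : ∀ i, ContDiffOn ℝ ∞ (Ω i) W
  linearIndependent : ∀ q ∈ W,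
    LinearIndependent ℝ (Sum.elim (fun μ => θ μ q) (fun i => Ω i q))
  structureEquations : StructureEquations W θ Ω I

/-! ### Local equivalences -/

/-- A local diffeomorphism. -/
def IsSmoothBoth {E : Type} [NormedAddCommGroup E] [NormedSpace ℝ E]
    (f : OpenPartialHomeomorph E E) : Prop :=
  ContDiffOn ℝ ∞ f f.source ∧ ContDiffOn ℝ ∞ f.symm f.target

/-- Local point equivalence of `z_y = F` near `j₀` with `z_y = F'` near `j₀'`: a local
transformation `f` of `(x, y, z)` and a local transformation `φ` of `(x, y, z, p)` lying over it,
with `φ j₀ = j₀'`, which carries the initial coframes into each other up to `IsParaCRMatrix`. -/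
def PointEquivalentAt (U : Set J4) (F : J4 → ℝ) (j₀ : J4) (U' : Set J4) (F' : J4 → ℝ) (j₀' : J4) :
    Prop :=
  ∃ (f : OpenPartialHomeomorph J3 J3) (φ : OpenPartialHomeomorph J4 J4),
    IsSmoothBoth f ∧ IsSmoothBoth φ ∧
    j₀ ∈ φ.source ∧ φ j₀ = j₀' ∧ φ.source ⊆ U ∧ φ.target ⊆ U' ∧
    (∀ j ∈ φ.source, toBase j ∈ f.source ∧ toBase (φ j) = f (toBase j)) ∧
    ∀ j ∈ φ.source, ∃ g, IsParaCRMatrix g ∧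
      ∀ i, (omega0 F' i (φ j)).comp (fderiv ℝ φ j) = matAct g (fun k => omega0 F k j) i

/-- A local isomorphism of principal `H₃`-bundles, over neighbourhoods of `j₀ ∈ U` and
`j₀' ∈ U'`, which pulls the forms `θ'`, `Ω'` back to `θ`, `Ω`. -/
def CoframeIsomorphicAt
    (U : Set J4) (θ : Fin 4 → OneForm P7) (Ω : Fin 3 → OneForm P7) (j₀ : J4)
    (U' : Set J4) (θ' : Fin 4 → OneForm P7) (Ω' : Fin 3 → OneForm P7) (j₀' : J4) : Prop :=
  ∃ (φ : OpenPartialHomeomorph J4 J4) (Φ : OpenPartialHomeomorph P7 P7),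
    IsSmoothBoth φ ∧ IsSmoothBoth Φ ∧
    j₀ ∈ φ.source ∧ φ j₀ = j₀' ∧ φ.source ⊆ U ∧ φ.target ⊆ U' ∧
    Φ.source = bundle φ.source ∧ Φ.target = bundle φ.target ∧
    (∀ q ∈ Φ.source, (Φ q).1 = φ q.1) ∧
    (∀ q ∈ Φ.source, ∀ a ∈ params, Φ (act a q) = act a (Φ q)) ∧
    (∀ q ∈ Φ.source, ∀ μ, (θ' μ (Φ q)).comp (fderiv ℝ Φ q) = θ μ q) ∧
    (∀ q ∈ Φ.source, ∀ i, (Ω' i (Φ q)).comp (fderiv ℝ Φ q) = Ω i q)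

end CartanPDE

end

/-!
The proof is Cartan's equivalence method, in its computational form.

On the jet space the adapted coframe `ω` and its dual frame are explicit. Since `D F = 0` and
`[∂_p, D] = ∂_z`, all derivatives of `F` along `D` are known (`opD_dp`), and so are those of the
coefficients of `ω`. This gives explicit connection forms on the section `h = 1` for which the first
four structure equations hold (`torsionEquations`). The last three equations need no computation:
`d² = 0`, applied to the coframe and to the third connection form, yields all linear relations between
the components of the curvature (`curvatureEquations_of_torsionEquations`). The connection forms then
extend to the bundle along the action of `H₃` (`torsionEquations_lift`, `curvatureEquations_lift`).
Conversely, the structure equations, evaluated on the dual frame, determine the connection forms and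
the invariants (`cartanCoframe_unique`).

A coframe `g ω₀` that can be completed is `k ω` for a matrix function `k`. The torsion equations,
restricted to two sections of the bundle, force `k` into `H₃` (`mem_H3`).

The invariants are polynomials in the connection coefficients, their derivatives along the frame and
the torsion. The derivative along `D` does not raise the order in `F`, and with `D` in place of `∂_x`
the coordinate `p` never enters as a coefficient; so the invariants are functions of the 6-jet of
`F` alone (`JetPair`, `baseCurv_eq`).

A point equivalence `φ` carries the adapted coframe of one equation into a coframe that can be
completed, hence, by `mem_H3`, into the adapted coframe of the other up to a smooth function `κ` with
values in `H₃`. Then `(j, u) ↦ (φ j, u κ(j)⁻¹)` preserves `θ`, and it preserves the connection forms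
because these are determined by `θ` (`coframeIsomorphicAt`). Conversely, an isomorphism of the bundles
gives, along a section, a relation between the coframes with values in `H₃`. It follows that the
covering map preserves the direction `∂_p`, so it descends to `(x, y, z)`-space, where it is a local
diffeomorphism by the inverse function theorem (`pointEquivalentAt`).
-/

noncomputable section

namespace CartanPDE

local infixl:70 " ⋏ " => wedge

/-! ### Rules of exterior calculus -/

section Rules

variable {E : Type} [NormedAddCommGroup E] [NormedSpace ℝ E]
variable {E' : Type} [NormedAddCommGroup E'] [NormedSpace ℝ E']

/-- `α` is differentiable at `q`, with exterior derivative `B` there. -/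
structure HasExtD (α : OneForm E) (B : E → E → ℝ) (q : E) : Prop where
  diff : DifferentiableAt ℝ α q
  eq : extD α q = B

theorem extD_congr {α β : OneForm E} {q : E} (h : α =ᶠ[nhds q] β) : extD α q = extD β q := by
  funext v w
  unfold extD
  rw [Filter.EventuallyEq.extDeriv_eq]
  filter_upwards [h] with x hx
  rw [hx]

theorem hasExtD_self {α : OneForm E} {q : E} (h : DifferentiableAt ℝ α q) :
    HasExtD α (extD α q) q := ⟨h, rfl⟩

theorem HasExtD.congr_form {α β : OneForm E} {B : E → E → ℝ} {q : E} (h : HasExtD α B q)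
    (e : β =ᶠ[nhds q] α) : HasExtD β B q :=
  ⟨h.diff.congr_of_eventuallyEq e, (extD_congr e).trans h.eq⟩

theorem hasExtD_const (α : E →L[ℝ] ℝ) (q : E) : HasExtD (fun _ => α) 0 q := by
  refine ⟨differentiableAt_const _, ?_⟩
  funext v w
  rw [extD_apply _ _ (differentiableAt_const _)]
  simp

theorem HasExtD.add {α β : OneForm E} {B C : E → E → ℝ} {q : E} (h : HasExtD α B q)
    (h' : HasExtD β C q) : HasExtD (fun x => α x + β x) (B + C) q := by
  refine ⟨h.diff.fun_add h'.diff, ?_⟩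
  funext v w
  rw [extD_apply _ _ (h.diff.fun_add h'.diff), ← h.eq, ← h'.eq, Pi.add_apply, Pi.add_apply,
    extD_apply _ _ h.diff, extD_apply _ _ h'.diff, fderiv_fun_add h.diff h'.diff]
  simp only [add_apply]
  ring

theorem HasExtD.sub {α β : OneForm E} {B C : E → E → ℝ} {q : E} (h : HasExtD α B q)
    (h' : HasExtD β C q) : HasExtD (fun x => α x - β x) (B - C) q := by
  refine ⟨h.diff.fun_sub h'.diff, ?_⟩
  funext v w
  rw [extD_apply _ _ (h.diff.fun_sub h'.diff), ← h.eq, ← h'.eq, Pi.sub_apply, Pi.sub_apply,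
    extD_apply _ _ h.diff, extD_apply _ _ h'.diff, fderiv_fun_sub h.diff h'.diff]
  simp only [sub_apply]
  ring

/-- The Leibniz rule `d (f α) = df ∧ α + f dα`. -/
theorem HasExtD.smul {f : E → ℝ} {f' : E →L[ℝ] ℝ} {α : OneForm E} {B : E → E → ℝ} {q : E}
    (hf : HasFDerivAt f f' q) (h : HasExtD α B q) :
    HasExtD (fun x => f x • α x) (f' ⋏ α q + f q • B) q := by
  have hd : DifferentiableAt ℝ (fun x => f x • α x) q := hf.differentiableAt.fun_smul h.diff
  refine ⟨hd, ?_⟩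
  funext v w
  rw [extD_apply _ _ hd, ← h.eq, Pi.add_apply, Pi.add_apply, Pi.smul_apply, Pi.smul_apply,
    extD_apply _ _ h.diff, fderiv_fun_smul hf.differentiableAt h.diff, hf.fderiv]
  simp only [add_apply, smul_apply, ContinuousLinearMap.smulRight_apply,
    wedge, smul_eq_mul]
  ring

/-- Naturality of the exterior derivative under pullback by a smooth map. -/
theorem extD_pullback {φ : E → E'} {α : OneForm E'} {q : E} (hφ : ContDiffAt ℝ 2 φ q)
    (hα : DifferentiableAt ℝ α (φ q)) (v w : E) :
    extD (fun x => (α (φ x)).comp (fderiv ℝ φ x)) q v w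
      = extD α (φ q) (fderiv ℝ φ q v) (fderiv ℝ φ q w) := by
  have h1 : DifferentiableAt ℝ φ q := hφ.differentiableAt (by norm_num)
  have h2 : DifferentiableAt ℝ (fderiv ℝ φ) q :=
    (hφ.fderiv_right (m := 1) (by norm_num)).differentiableAt (by norm_num)
  have h3 : HasFDerivAt (fun x => α (φ x)) ((fderiv ℝ α (φ q)).comp (fderiv ℝ φ q)) q :=
    hα.hasFDerivAt.comp q h1.hasFDerivAt
  have h4 := h3.clm_comp h2.hasFDerivAt
  rw [extD_apply _ _ h4.differentiableAt, h4.fderiv, extD_apply _ _ hα]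
  have hs : IsSymmSndFDerivAt ℝ φ q := hφ.isSymmSndFDerivAt (by simp)
  have := hs v w
  simp [this]

theorem differentiableAt_pullback {φ : E → E'} {α : OneForm E'} {q : E} (hφ : ContDiffAt ℝ 2 φ q)
    (hα : DifferentiableAt ℝ α (φ q)) :
    DifferentiableAt ℝ (fun x => (α (φ x)).comp (fderiv ℝ φ x)) q := by
  have h1 : DifferentiableAt ℝ φ q := hφ.differentiableAt (by norm_num)
  have h2 : DifferentiableAt ℝ (fderiv ℝ φ) q :=
    (hφ.fderiv_right (m := 1) (by norm_num)).differentiableAt (by norm_num)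
  have h3 : HasFDerivAt (fun x => α (φ x)) ((fderiv ℝ α (φ q)).comp (fderiv ℝ φ q)) q :=
    hα.hasFDerivAt.comp q h1.hasFDerivAt
  exact (h3.clm_comp h2.hasFDerivAt).differentiableAt

/-- The 2-form field `B` is differentiable at `q`, and its exterior derivative there, as a
trilinear function, is `T`. -/
structure HasExtD2 (B : E → E → E → ℝ) (T : E → E → E → ℝ) (q : E) : Prop where
  diff : ∀ v w, DifferentiableAt ℝ (fun x => B x v w) q
  eq : ∀ u v w, fderiv ℝ (fun x => B x v w) q u - fderiv ℝ (fun x => B x u w) q v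
    + fderiv ℝ (fun x => B x u v) q w = T u v w

theorem HasExtD2.congr_form {B B' : E → E → E → ℝ} {T : E → E → E → ℝ} {q : E}
    (h : HasExtD2 B T q) (e : B' =ᶠ[nhds q] B) : HasExtD2 B' T q := by
  have e' (v w : E) : (fun x => B' x v w) =ᶠ[nhds q] fun x => B x v w := by
    filter_upwards [e] with x hx
    rw [hx]
  refine ⟨fun v w => (h.diff v w).congr_of_eventuallyEq (e' v w), fun u v w => ?_⟩
  rw [(e' v w).fderiv_eq, (e' u w).fderiv_eq, (e' u v).fderiv_eq, h.eq]

theorem HasExtD2.add {B C : E → E → E → ℝ} {S T : E → E → E → ℝ} {q : E}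
    (h : HasExtD2 B S q) (h' : HasExtD2 C T q) : HasExtD2 (fun x => B x + C x) (S + T) q := by
  refine ⟨fun v w => (h.diff v w).fun_add (h'.diff v w), fun u v w => ?_⟩
  simp only [Pi.add_apply]
  rw [fderiv_fun_add (h.diff v w) (h'.diff v w), fderiv_fun_add (h.diff u w) (h'.diff u w),
    fderiv_fun_add (h.diff u v) (h'.diff u v), ← h.eq, ← h'.eq]
  simp only [add_apply]
  ring

theorem HasExtD2.sub {B C : E → E → E → ℝ} {S T : E → E → E → ℝ} {q : E}
    (h : HasExtD2 B S q) (h' : HasExtD2 C T q) : HasExtD2 (fun x => B x - C x) (S - T) q := by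
  refine ⟨fun v w => (h.diff v w).fun_sub (h'.diff v w), fun u v w => ?_⟩
  simp only [Pi.sub_apply]
  rw [fderiv_fun_sub (h.diff v w) (h'.diff v w), fderiv_fun_sub (h.diff u w) (h'.diff u w),
    fderiv_fun_sub (h.diff u v) (h'.diff u v), ← h.eq, ← h'.eq]
  simp only [sub_apply]
  ring

theorem HasExtD2.smul {f : E → ℝ} {f' : E →L[ℝ] ℝ} {B : E → E → E → ℝ} {T : E → E → E → ℝ} {q : E}
    (hf : HasFDerivAt f f' q) (h : HasExtD2 B T q) :
    HasExtD2 (fun x => f x • B x)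
      (fun u v w => f' u * B q v w - f' v * B q u w + f' w * B q u v + f q * T u v w) q := by
  refine ⟨fun v w => hf.differentiableAt.fun_mul (h.diff v w), fun u v w => ?_⟩
  simp only [Pi.smul_apply, smul_eq_mul]
  rw [fderiv_fun_mul hf.differentiableAt (h.diff v w),
    fderiv_fun_mul hf.differentiableAt (h.diff u w),
    fderiv_fun_mul hf.differentiableAt (h.diff u v), ← h.eq, hf.fderiv]
  simp only [add_apply, smul_apply, smul_eq_mul]
  ring

/-- The Leibniz rule `d (α ∧ β) = dα ∧ β - α ∧ dβ`. -/
theorem HasExtD.wedge {α β : OneForm E} {B C : E → E → ℝ} {q : E} (h : HasExtD α B q)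
    (h' : HasExtD β C q) :
    HasExtD2 (fun x => α x ⋏ β x)
      (fun u v w => B u v * β q w - B u w * β q v + B v w * β q u
        - (α q u * C v w - α q v * C u w + α q w * C u v)) q := by
  have ha (v : E) : HasFDerivAt (fun x => α x v) ((fderiv ℝ α q).flip v) q := by
    simpa using h.diff.hasFDerivAt.clm_apply (hasFDerivAt_const v q)
  have hb (v : E) : HasFDerivAt (fun x => β x v) ((fderiv ℝ β q).flip v) q := by
    simpa using h'.diff.hasFDerivAt.clm_apply (hasFDerivAt_const v q)
  have hw (v w : E) := ((ha v).mul (hb w)).sub ((ha w).mul (hb v))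
  have hB (v w : E) : B v w = fderiv ℝ α q v w - fderiv ℝ α q w v := by
    rw [← h.eq, extD_apply _ _ h.diff]
  have hC (v w : E) : C v w = fderiv ℝ β q v w - fderiv ℝ β q w v := by
    rw [← h'.eq, extD_apply _ _ h'.diff]
  have e (v w : E) : fderiv ℝ (fun x => CartanPDE.wedge (α x) (β x) v w) q = _ := (hw v w).fderiv
  refine ⟨fun v w => (hw v w).differentiableAt, fun u v w => ?_⟩
  rw [e, e, e]
  simp only [hB, hC, add_apply, sub_apply, smul_apply, smul_eq_mul, ContinuousLinearMap.flip_apply]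
  ring

/-- `d² = 0`. -/
theorem hasExtD2_extD {α : OneForm E} {q : E} (h : ContDiffAt ℝ 2 α q) :
    HasExtD2 (extD α) 0 q := by
  have h2 : DifferentiableAt ℝ (fderiv ℝ α) q :=
    (h.fderiv_right (m := 1) (by norm_num)).differentiableAt (by norm_num)
  have hev : ∀ᶠ x in nhds q, DifferentiableAt ℝ α x :=
    (h.eventually (by simp)).mono fun x hx => hx.differentiableAt (by norm_num)
  have e (v w : E) : (fun x => extD α x v w)
      =ᶠ[nhds q] fun x => fderiv ℝ α x v w - fderiv ℝ α x w v := by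
    filter_upwards [hev] with x hx
    rw [extD_apply _ _ hx]
  have hd (v w : E) : HasFDerivAt (fun x => fderiv ℝ α x v w)
      (((fderiv ℝ (fderiv ℝ α) q).flip v).flip w) q := by
    have h3 : HasFDerivAt (fun x => fderiv ℝ α x v) ((fderiv ℝ (fderiv ℝ α) q).flip v) q := by
      simpa using h2.hasFDerivAt.clm_apply (hasFDerivAt_const v q)
    simpa using h3.clm_apply (hasFDerivAt_const w q)
  have hf (v w : E) := ((hd v w).sub (hd w v)).congr_of_eventuallyEq (e v w)
  refine ⟨fun v w => (hf v w).differentiableAt, fun u v w => ?_⟩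
  rw [(hf v w).fderiv, (hf u w).fderiv, (hf u v).fderiv]
  have hs : IsSymmSndFDerivAt ℝ α q := h.isSymmSndFDerivAt (by simp)
  simp only [sub_apply, ContinuousLinearMap.flip_apply, hs v u, hs w u, hs w v, Pi.zero_apply]
  ring

end Rules

/-! ### Partial derivatives of smooth functions of the jet coordinates -/

section Jets

variable {U : Set J4} {F f g : J4 → ℝ} {j : J4}

theorem differentiableAt_of_smooth {E G : Type} [NormedAddCommGroup E] [NormedSpace ℝ E]
    [NormedAddCommGroup G] [NormedSpace ℝ G] {f : E → G} {U : Set E} {j : E}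
    (hU : IsOpen U) (hf : ContDiffOn ℝ ∞ f U) (hj : j ∈ U) : DifferentiableAt ℝ f j :=
  (hf.contDiffAt (hU.mem_nhds hj)).differentiableAt (by simp)

theorem smooth_pd (hU : IsOpen U) (hf : ContDiffOn ℝ ∞ f U) (i : Fin 4) :
    ContDiffOn ℝ ∞ (pd i f) U :=
  (hf.fderiv_of_isOpen hU (m := ∞) (by simp)).clm_apply contDiffOn_const

theorem smooth_opD (hU : IsOpen U) (hf : ContDiffOn ℝ ∞ f U) : ContDiffOn ℝ ∞ (opD f) U :=
  (smooth_pd hU hf 0).add (ContDiffOn.mul (contDiff_apply ℝ ℝ (3 : Fin 4)).contDiffOn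
    (smooth_pd hU hf 2))

theorem smooth_opDelta (hU : IsOpen U) (hF : ContDiffOn ℝ ∞ F U) (hf : ContDiffOn ℝ ∞ f U) :
    ContDiffOn ℝ ∞ (opDelta F f) U :=
  (smooth_pd hU hf 1).add (hF.mul (smooth_pd hU hf 2))

theorem smooth_dp (hU : IsOpen U) (hf : ContDiffOn ℝ ∞ f U) (n : ℕ) :
    ContDiffOn ℝ ∞ (dp n f) U := by
  induction n with
  | zero => exact hf
  | succ n ih =>
    rw [dp, Function.iterate_succ_apply']
    exact smooth_pd hU ih 3

theorem smooth_dzp (hU : IsOpen U) (hf : ContDiffOn ℝ ∞ f U) (n : ℕ) :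
    ContDiffOn ℝ ∞ (dzp n f) U := smooth_pd hU (smooth_dp hU hf n) 2

theorem smooth_deltaP (hU : IsOpen U) (hf : ContDiffOn ℝ ∞ f U) (n : ℕ) :
    ContDiffOn ℝ ∞ (deltaP n f) U := smooth_opDelta hU hf (smooth_dp hU hf n)

theorem pd_congr (hU : IsOpen U) (h : ∀ x ∈ U, f x = g x) (hj : j ∈ U) (i : Fin 4) :
    pd i f j = pd i g j := by
  have : f =ᶠ[nhds j] g := Filter.eventuallyEq_of_mem (hU.mem_nhds hj) h
  rw [pd, pd, this.fderiv_eq]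

theorem pd_comm (hU : IsOpen U) (hf : ContDiffOn ℝ ∞ f U) (hj : j ∈ U) (i k : Fin 4) :
    pd i (pd k f) j = pd k (pd i f) j := by
  have hs : IsSymmSndFDerivAt ℝ f j := by
    refine (hf.contDiffAt (hU.mem_nhds hj)).isSymmSndFDerivAt ?_
    rw [minSmoothness_of_isRCLikeNormedField]
    exact WithTop.coe_le_coe.2 le_top
  have h2 : DifferentiableAt ℝ (fderiv ℝ f) j :=
    differentiableAt_of_smooth hU (hf.fderiv_of_isOpen hU (m := ∞) (by simp)) hj
  have e (i k : Fin 4) : pd i (pd k f) j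
      = fderiv ℝ (fderiv ℝ f) j (Pi.single i 1) (Pi.single k 1) := by
    have : fderiv ℝ (pd k f) j = _ :=
      (h2.hasFDerivAt.clm_apply (hasFDerivAt_const (Pi.single k (1 : ℝ) : J4) j)).fderiv
    rw [pd, this]
    simp
  rw [e, e, hs]

theorem fderiv_eq_sum_pd (f : J4 → ℝ) (j v : J4) :
    fderiv ℝ f j v = pd 0 f j * v 0 + pd 1 f j * v 1 + pd 2 f j * v 2 + pd 3 f j * v 3 := by
  have h : v = v 0 • Pi.single 0 1 + v 1 • Pi.single 1 1 + v 2 • Pi.single 2 1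
      + v 3 • Pi.single 3 1 := by
    ext i; fin_cases i <;> simp
  conv_lhs => rw [h]
  simp only [map_add, map_smul, smul_eq_mul, pd]
  ring

/-- `df = f_z ω₀¹ + f_p ω₀² + (D f) ω₀³ + (Δ f) ω₀⁴`. -/
theorem fderiv_eq_omega0 (F f : J4 → ℝ) (j v : J4) :
    fderiv ℝ f j v = pd 2 f j * omega0 F 0 j v + pd 3 f j * omega0 F 1 j v
      + opD f j * omega0 F 2 j v + opDelta F f j * omega0 F 3 j v := by
  rw [fderiv_eq_sum_pd]
  simp [omega0, dcoord, opD, opDelta]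
  ring

/-- `f` is differentiable at `j`, with derivative `d` in the direction `X`. -/
structure HasDir (f : J4 → ℝ) (X : J4) (d : ℝ) (j : J4) : Prop where
  diff : DifferentiableAt ℝ f j
  eq : fderiv ℝ f j X = d

variable {X : J4} {d d' : ℝ}

theorem HasDir.add (h : HasDir f X d j) (h' : HasDir g X d' j) :
    HasDir (fun x => f x + g x) X (d + d') j :=
  ⟨h.diff.fun_add h'.diff, by rw [fderiv_fun_add h.diff h'.diff]; simp [h.eq, h'.eq]⟩

theorem HasDir.sub (h : HasDir f X d j) (h' : HasDir g X d' j) :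
    HasDir (fun x => f x - g x) X (d - d') j :=
  ⟨h.diff.fun_sub h'.diff, by rw [fderiv_fun_sub h.diff h'.diff]; simp [h.eq, h'.eq]⟩

theorem HasDir.mul (h : HasDir f X d j) (h' : HasDir g X d' j) :
    HasDir (fun x => f x * g x) X (f j * d' + d * g j) j :=
  ⟨h.diff.fun_mul h'.diff, by
    rw [fderiv_fun_mul h.diff h'.diff]; simp [h.eq, h'.eq]; ring⟩

theorem HasDir.const_mul (c : ℝ) (h : HasDir f X d j) : HasDir (fun x => c * f x) X (c * d) j :=
  ⟨h.diff.const_mul c, by rw [fderiv_const_mul h.diff]; simp [h.eq]⟩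

theorem HasDir.pow (n : ℕ) (h : HasDir f X d j) :
    HasDir (fun x => f x ^ n) X (n * f j ^ (n - 1) * d) j :=
  ⟨h.diff.fun_pow n, by rw [fderiv_fun_pow n h.diff]; simp [h.eq, mul_assoc]⟩

theorem HasDir.inv (h : HasDir f X d j) (h0 : f j ≠ 0) :
    HasDir (fun x => (f x)⁻¹) X (-d / f j ^ 2) j := by
  have := (hasDerivAt_inv h0).comp_hasFDerivAt j h.diff.hasFDerivAt
  refine ⟨this.differentiableAt, ?_⟩
  have e : fderiv ℝ (fun x => (f x)⁻¹) j = _ := this.fderiv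
  rw [e]
  simp [h.eq]
  ring

theorem HasDir.div (h : HasDir f X d j) (h' : HasDir g X d' j) (h0 : g j ≠ 0) :
    HasDir (fun x => f x / g x) X ((d * g j - f j * d') / g j ^ 2) j := by
  have := h.mul (h'.inv h0)
  simp only [div_eq_mul_inv]
  refine ⟨this.diff, this.eq.trans ?_⟩
  field_simp
  ring

theorem HasDir.of_eq (h : HasDir f X d j) (e : d = d') : HasDir f X d' j := e ▸ h

/-- The vector field `∂_p`. -/
def vp : J4 := Pi.single 3 1

/-- The value at `j` of the vector field `D = ∂_x + p ∂_z`. -/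
def vD (j : J4) : J4 := Pi.single 0 1 + j 3 • Pi.single 2 1

/-- The value at `j` of the vector field `Δ = ∂_y + F ∂_z`. -/
def vDelta (F : J4 → ℝ) (j : J4) : J4 := Pi.single 1 1 + F j • Pi.single 2 1

theorem fderiv_vD (f : J4 → ℝ) (j : J4) : fderiv ℝ f j (vD j) = opD f j := by
  simp [vD, opD, pd]

theorem fderiv_vDelta (F f : J4 → ℝ) (j : J4) : fderiv ℝ f j (vDelta F j) = opDelta F f j := by
  simp [vDelta, opDelta, pd]

/-- The commutator `[∂_k, D] = δ_{k3} ∂_z`. -/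
theorem opD_pd (hU : IsOpen U) (hf : ContDiffOn ℝ ∞ f U) (hj : j ∈ U) (k : Fin 4) :
    opD (pd k f) j = pd k (opD f) j - (if k = 3 then pd 2 f j else 0) := by
  have h0 := (differentiableAt_of_smooth hU (smooth_pd hU hf 0) hj).hasFDerivAt
  have h2 := (differentiableAt_of_smooth hU (smooth_pd hU hf 2) hj).hasFDerivAt
  have h3 : HasFDerivAt (fun x : J4 => x 3) (ContinuousLinearMap.proj 3) j :=
    (ContinuousLinearMap.proj (R := ℝ) (φ := fun _ : Fin 4 => ℝ) 3).hasFDerivAt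
  have h : fderiv ℝ (opD f) j = _ := (h0.add (h3.mul h2)).fderiv
  rw [pd, h, opD, pd_comm hU hf hj 0 k, pd_comm hU hf hj 2 k]
  have e (g : J4 → ℝ) (i : Fin 4) : fderiv ℝ g j (Pi.single i 1) = pd i g j := rfl
  simp only [add_apply, smul_apply, smul_eq_mul, ContinuousLinearMap.proj_apply, e]
  by_cases hk : k = 3
  · subst hk
    simp
    ring
  · simp [hk, Ne.symm hk]

/-- The commutator `[∂_k, Δ] = F_k ∂_z`. -/
theorem pd_opDelta (hU : IsOpen U) (hF : ContDiffOn ℝ ∞ F U) (hf : ContDiffOn ℝ ∞ f U)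
    (hj : j ∈ U) (k : Fin 4) :
    pd k (opDelta F f) j = opDelta F (pd k f) j + pd k F j * pd 2 f j := by
  have h1 := (differentiableAt_of_smooth hU (smooth_pd hU hf 1) hj).hasFDerivAt
  have h2 := (differentiableAt_of_smooth hU (smooth_pd hU hf 2) hj).hasFDerivAt
  have h3 := (differentiableAt_of_smooth hU hF hj).hasFDerivAt
  have h : fderiv ℝ (opDelta F f) j = _ := (h1.add (h3.mul h2)).fderiv
  rw [pd, h, opDelta, pd_comm hU hf hj 1 k, pd_comm hU hf hj 2 k]
  have e (g : J4 → ℝ) (i : Fin 4) : fderiv ℝ g j (Pi.single i 1) = pd i g j := rfl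
  simp only [add_apply, smul_apply, smul_eq_mul, e]
  ring

end Jets

/-! ### Derivatives of `F` and of the coefficients of the adapted coframe -/

namespace IsAdmissible

variable {U : Set J4} {F f g : J4 → ℝ} {j : J4}

/-- `D ∂_pⁿ⁺¹ F = -(n + 1) ∂_z ∂_pⁿ F`, by induction from `D F = 0` with `[∂_p, D] = ∂_z`. -/
theorem opD_dp (h : IsAdmissible U F) (n : ℕ) :
    ∀ j ∈ U, opD (dp (n + 1) F) j = -((n + 1 : ℕ) : ℝ) * dzp n F j := by
  induction n with
  | zero =>
    intro j hj
    have := opD_pd h.isOpen h.smooth hj 3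
    rw [pd_congr h.isOpen (g := fun _ => 0) (fun x hx => h.opD_eq_zero x hx) hj] at this
    simpa [pd, dp, dzp] using this
  | succ n ih =>
    intro j hj
    have e : dp (n + 2) F = pd 3 (dp (n + 1) F) := Function.iterate_succ_apply' _ _ _
    have e' : pd 3 (dzp n F) j = dzp (n + 1) F j := by
      rw [dzp, pd_comm h.isOpen (smooth_dp h.isOpen h.smooth n) hj 3 2, dzp, dp, dp,
        Function.iterate_succ_apply']
    rw [e, opD_pd h.isOpen (smooth_dp h.isOpen h.smooth _) hj 3, pd_congr h.isOpen ih hj]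
    have hd := differentiableAt_of_smooth h.isOpen (smooth_dzp h.isOpen h.smooth n) hj
    have : pd 3 (fun j => -((n + 1 : ℕ) : ℝ) * dzp n F j) j
        = -((n + 1 : ℕ) : ℝ) * dzp (n + 1) F j := by
      rw [← e', pd, fderiv_const_mul hd]; simp [pd]
    rw [this]
    rw [if_pos rfl, show pd 2 (dp (n + 1) F) j = dzp (n + 1) F j from rfl]
    push_cast
    ring

theorem dp_p (h : IsAdmissible U F) (hj : j ∈ U) (n : ℕ) :
    HasDir (dp n F) vp (dp (n + 1) F j) j :=
  ⟨differentiableAt_of_smooth h.isOpen (smooth_dp h.isOpen h.smooth n) hj, by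
    rw [dp, dp, Function.iterate_succ_apply']; rfl⟩

theorem dp_D (h : IsAdmissible U F) (hj : j ∈ U) (n : ℕ) :
    HasDir (dp (n + 1) F) (vD j) (-((n + 1 : ℕ) : ℝ) * dzp n F j) j :=
  ⟨differentiableAt_of_smooth h.isOpen (smooth_dp h.isOpen h.smooth _) hj, by
    rw [fderiv_vD, h.opD_dp n j hj]⟩

theorem dp_Delta (h : IsAdmissible U F) (hj : j ∈ U) (n : ℕ) :
    HasDir (dp n F) (vDelta F j) (deltaP n F j) j :=
  ⟨differentiableAt_of_smooth h.isOpen (smooth_dp h.isOpen h.smooth _) hj, by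
    rw [fderiv_vDelta]; rfl⟩

theorem dzp_p (h : IsAdmissible U F) (hj : j ∈ U) (n : ℕ) :
    HasDir (dzp n F) vp (dzp (n + 1) F j) j :=
  ⟨differentiableAt_of_smooth h.isOpen (smooth_dzp h.isOpen h.smooth _) hj, by
    have := pd_comm h.isOpen (smooth_dp h.isOpen h.smooth n) hj 3 2
    rw [dzp, dzp, dp, dp, Function.iterate_succ_apply']; exact this⟩

theorem deltaP_p (h : IsAdmissible U F) (hj : j ∈ U) (n : ℕ) :
    HasDir (deltaP n F) vp (deltaP (n + 1) F j + dp 1 F j * dzp n F j) j :=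
  ⟨differentiableAt_of_smooth h.isOpen (smooth_deltaP h.isOpen h.smooth _) hj, by
    have := pd_opDelta h.isOpen h.smooth (smooth_dp h.isOpen h.smooth n) hj 3
    rw [deltaP, deltaP, dp, dp, Function.iterate_succ_apply', dzp]; exact this⟩

end IsAdmissible

/-- The coefficient of `-ω₀¹` in `ω³`. -/
def cA (F : J4 → ℝ) (j : J4) : ℝ := 1 / 3 * (dp 3 F j / dp 2 F j)

/-- The coefficient of `-ω₀¹` in `ω²`. -/
def cB (F : J4 → ℝ) (j : J4) : ℝ :=
  (deltaP 3 F j * dp 2 F j - deltaP 2 F j * dp 3 F j + 3 * dp 1 F j * dp 2 F j * dzp 2 F j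
    - 3 * dp 2 F j ^ 2 * dzp 1 F j - 2 * dp 1 F j * dp 3 F j * dzp 1 F j) / (6 * dp 2 F j ^ 3)

/-- The coefficient of `ω₀¹` in `ω⁴`. -/
def cC (F : J4 → ℝ) (j : J4) : ℝ :=
  (4 * dp 3 F j ^ 2 - 3 * dp 2 F j * dp 4 F j) / (18 * dp 2 F j ^ 2)

/-- The fourth derivation `F_pp⁻¹ (Δ - F_p D)` of the frame dual to `omega F`; the second one
is `∂_p` and the third one is `D`. -/
def opE4 (F f : J4 → ℝ) (j : J4) : ℝ := (opDelta F f j - dp 1 F j * opD f j) / dp 2 F j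

namespace IsAdmissible

variable {U : Set J4} {F f g : J4 → ℝ} {j : J4}

theorem cA_p (h : IsAdmissible U F) (hj : j ∈ U) :
    HasDir (cA F) vp (cA F j ^ 2 - 2 * cC F j) j := by
  have h2 := h.Fpp_ne_zero j hj
  refine (((h.dp_p hj 3).div (h.dp_p hj 2) h2).const_mul (1 / 3)).of_eq ?_
  simp only [cA, cC]
  field_simp
  ring

theorem cA_D (h : IsAdmissible U F) (hj : j ∈ U) :
    HasDir (cA F) (vD j) ((2 * cA F j * dzp 1 F j - dzp 2 F j) / dp 2 F j) j := by
  have h2 := h.Fpp_ne_zero j hj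
  refine (((h.dp_D hj 2).div (h.dp_D hj 1) h2).const_mul (1 / 3)).of_eq ?_
  simp only [cA]
  push_cast
  field_simp
  ring

theorem cA_Delta (h : IsAdmissible U F) (hj : j ∈ U) :
    HasDir (cA F) (vDelta F j) (2 * cB F j * dp 2 F j + dzp 1 F j
      + dp 1 F j * ((2 * cA F j * dzp 1 F j - dzp 2 F j) / dp 2 F j)) j := by
  have h2 := h.Fpp_ne_zero j hj
  refine (((h.dp_Delta hj 3).div (h.dp_Delta hj 2) h2).const_mul (1 / 3)).of_eq ?_
  simp only [cA, cB]
  field_simp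
  ring

theorem cC_p (h : IsAdmissible U F) (hj : j ∈ U) :
    HasDir (cC F) vp ((11 * dp 2 F j * dp 3 F j * dp 4 F j - 8 * dp 3 F j ^ 3
      - 3 * dp 2 F j ^ 2 * dp 5 F j) / (18 * dp 2 F j ^ 3)) j := by
  have h2 := h.Fpp_ne_zero j hj
  have n3 := ((h.dp_p hj 3).pow 2).const_mul 4
  have n2 := ((h.dp_p hj 2).const_mul 3).mul (h.dp_p hj 4)
  have dd := ((h.dp_p hj 2).pow 2).const_mul 18
  refine ((n3.sub n2).div dd (by positivity)).of_eq ?_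
  push_cast
  field_simp
  ring

theorem cC_D (h : IsAdmissible U F) (hj : j ∈ U) :
    HasDir (cC F) (vD j) ((12 * dp 2 F j ^ 2 * dzp 3 F j - 24 * dp 2 F j * dp 3 F j * dzp 2 F j
      + 16 * dp 3 F j ^ 2 * dzp 1 F j - 6 * dp 2 F j * dp 4 F j * dzp 1 F j)
      / (18 * dp 2 F j ^ 3)) j := by
  have h2 := h.Fpp_ne_zero j hj
  have n3 := ((h.dp_D hj 2).pow 2).const_mul 4
  have n2 := ((h.dp_D hj 1).const_mul 3).mul (h.dp_D hj 3)
  have dd := ((h.dp_D hj 1).pow 2).const_mul 18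
  refine ((n3.sub n2).div dd (by positivity)).of_eq ?_
  push_cast
  field_simp
  ring

theorem cC_Delta (h : IsAdmissible U F) (hj : j ∈ U) :
    HasDir (cC F) (vDelta F j) ((8 * dp 2 F j * dp 3 F j * deltaP 3 F j
      - 3 * dp 2 F j ^ 2 * deltaP 4 F j - 8 * dp 3 F j ^ 2 * deltaP 2 F j
      + 3 * dp 2 F j * dp 4 F j * deltaP 2 F j) / (18 * dp 2 F j ^ 3)) j := by
  have h2 := h.Fpp_ne_zero j hj
  have n3 := ((h.dp_Delta hj 3).pow 2).const_mul 4
  have n2 := ((h.dp_Delta hj 2).const_mul 3).mul (h.dp_Delta hj 4)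
  have dd := ((h.dp_Delta hj 2).pow 2).const_mul 18
  refine ((n3.sub n2).div dd (by positivity)).of_eq ?_
  push_cast
  field_simp
  ring

end IsAdmissible

/-! ### The torsion of the adapted coframe -/

theorem omega_zero (F : J4 → ℝ) : omega F 0 = omega0 F 0 := rfl
theorem omega_one (F : J4 → ℝ) :
    omega F 1 = fun j => omega0 F 1 j - cB F j • omega0 F 0 j := rfl
theorem omega_two (F : J4 → ℝ) :
    omega F 2 = fun j => omega0 F 2 j + dp 1 F j • omega0 F 3 j - cA F j • omega0 F 0 j := rfl
theorem omega_three (F : J4 → ℝ) :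
    omega F 3 = fun j => dp 2 F j • omega0 F 3 j + cC F j • omega0 F 0 j := rfl

/-- The coefficient of `ω¹ ∧ ω²` in `dω²`. -/
def torsB (F : J4 → ℝ) (j : J4) : ℝ := pd 3 (cB F) j - cA F j * cB F j

/-- The coefficient of `ω¹ ∧ ω⁴` in `dω⁴`. -/
def torsC (F : J4 → ℝ) (j : J4) : ℝ :=
  -(cC F j * dzp 0 F j / dp 2 F j) - opE4 F (cC F) j
    + (dzp 2 F j - 2 * cA F j * dzp 1 F j) / dp 2 F j + 3 * cA F j * cB F j

/-- The coefficient of `ω³` in the second connection form. -/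
def conn23 (F : J4 → ℝ) (j : J4) : ℝ :=
  torsB F j + torsC F j - (cA F j * cB F j + opD (cA F) j - cC F j * dzp 0 F j / dp 2 F j)

/-- The restrictions of the forms `Ω₁, Ω₂, Ω₃` to the section `h = 1` of the bundle. -/
def conn (F : J4 → ℝ) : Fin 3 → OneForm J4 :=
  ![fun j => (2 * torsB F j + torsC F j) • omega F 0 j - cA F j • omega F 1 j
      + cB F j • omega F 2 j + (dzp 0 F j / dp 2 F j) • omega F 3 j,
    fun j => (cC F j * cB F j + opD (cC F) j + 2 * dzp 1 F j * cC F j / dp 2 F j) • omega F 0 j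
      + cC F j • omega F 1 j + conn23 F j • omega F 2 j
      - (3 * cB F j + 2 * dzp 1 F j / dp 2 F j) • omega F 3 j,
    fun j => (torsB F j + torsC F j) • omega F 0 j + cA F j • omega F 1 j
      + (2 * cB F j) • omega F 2 j + (dzp 0 F j / dp 2 F j) • omega F 3 j]

/-- The torsion coefficient `A₁` on the section `h = 1`. -/
def baseA1 (F : J4 → ℝ) (j : J4) : ℝ := pd 3 (cC F) j - 4 * cA F j * cC F j

/-- The torsion coefficient `B₁` on the section `h = 1`. -/
def baseB1 (F : J4 → ℝ) (j : J4) : ℝ := opD (cB F) j + cB F j ^ 2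

/-- The torsion coefficient `B₂` on the section `h = 1`. -/
def baseB2 (F : J4 → ℝ) (j : J4) : ℝ :=
  -(opE4 F (cB F) j + cB F j * dzp 0 F j / dp 2 F j)

namespace IsAdmissible

variable {U : Set J4} {F f g : J4 → ℝ} {j : J4}

theorem smooth_cA (h : IsAdmissible U F) : ContDiffOn ℝ ∞ (cA F) U := by
  have d (n : ℕ) := smooth_dp h.isOpen h.smooth n
  exact contDiffOn_const.mul ((d 3).div (d 2) h.Fpp_ne_zero)

theorem smooth_cB (h : IsAdmissible U F) : ContDiffOn ℝ ∞ (cB F) U := by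
  have d (n : ℕ) := smooth_dp h.isOpen h.smooth n
  have z (n : ℕ) := smooth_dzp h.isOpen h.smooth n
  have y (n : ℕ) := smooth_deltaP h.isOpen h.smooth n
  refine ContDiffOn.div ?_ (contDiffOn_const.mul ((d 2).pow 3)) fun x hx => ?_
  · have := d 1; have := d 2; have := d 3; have := z 1; have := z 2; have := y 2; have := y 3
    fun_prop
  · have := h.Fpp_ne_zero x hx
    positivity

theorem smooth_cC (h : IsAdmissible U F) : ContDiffOn ℝ ∞ (cC F) U := by
  have d (n : ℕ) := smooth_dp h.isOpen h.smooth n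
  refine ContDiffOn.div ?_ (contDiffOn_const.mul ((d 2).pow 2)) fun x hx => ?_
  · have := d 2; have := d 3; have := d 4
    fun_prop
  · have := h.Fpp_ne_zero x hx
    positivity

theorem smooth_opE4 (h : IsAdmissible U F) (hf : ContDiffOn ℝ ∞ f U) :
    ContDiffOn ℝ ∞ (opE4 F f) U :=
  ((smooth_opDelta h.isOpen h.smooth hf).sub
    ((smooth_dp h.isOpen h.smooth 1).mul (smooth_opD h.isOpen hf))).div
    (smooth_dp h.isOpen h.smooth 2) h.Fpp_ne_zero

theorem hasFDerivAt (h : IsAdmissible U F) (hf : ContDiffOn ℝ ∞ f U) (hj : j ∈ U) :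
    HasFDerivAt f (fderiv ℝ f j) j := (differentiableAt_of_smooth h.isOpen hf hj).hasFDerivAt

theorem hasExtD_omega0_zero (h : IsAdmissible U F) (hj : j ∈ U) :
    HasExtD (omega0 F 0) (-(omega0 F 1 j ⋏ omega0 F 2 j) - fderiv ℝ F j ⋏ omega0 F 3 j) j := by
  have h3 : HasFDerivAt (fun x : J4 => x 3) (dcoord 3) j := (dcoord 3).hasFDerivAt
  have := ((hasExtD_const (dcoord 2) j).sub (HasExtD.smul h3 (hasExtD_const (dcoord 0) j))).sub
    (HasExtD.smul (h.hasFDerivAt h.smooth hj) (hasExtD_const (dcoord 1) j))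
  refine ⟨this.diff, this.eq.trans ?_⟩
  simp [omega0]

theorem hasExtD_omega_zero (h : IsAdmissible U F) (hj : j ∈ U) :
    HasExtD (omega F 0) (conn F 0 j ⋏ omega F 0 j - omega F 1 j ⋏ omega F 2 j) j := by
  have h2 := h.Fpp_ne_zero j hj
  refine ⟨(h.hasExtD_omega0_zero hj).diff, (h.hasExtD_omega0_zero hj).eq.trans ?_⟩
  have hD := h.opD_eq_zero j hj
  funext v w
  simp only [wedge, Pi.sub_apply, Pi.neg_apply, fderiv_eq_omega0 F, hD]
  simp only [conn, omega_zero, omega_one, omega_two, omega_three, Matrix.cons_val, add_apply,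
    sub_apply, smul_apply, smul_eq_mul]
  rw [show dzp 0 F j = pd 2 F j from rfl, show pd 3 F j = dp 1 F j from rfl]
  generalize omega0 F 0 j v = v0, omega0 F 1 j v = v1, omega0 F 2 j v = v2, omega0 F 3 j v = v3,
    omega0 F 0 j w = w0, omega0 F 1 j w = w1, omega0 F 2 j w = w2, omega0 F 3 j w = w3
  field_simp
  ring

theorem hasExtD_omega_one (h : IsAdmissible U F) (hj : j ∈ U) :
    HasExtD (omega F 1) ((conn F 0 j - conn F 2 j) ⋏ omega F 1 j
      + baseB1 F j • (omega F 0 j ⋏ omega F 2 j) - baseB2 F j • (omega F 0 j ⋏ omega F 3 j)) j := by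
  have h2 := h.Fpp_ne_zero j hj
  have := (hasExtD_const (dcoord 3) j).sub
    ((h.hasExtD_omega_zero hj).smul (h.hasFDerivAt h.smooth_cB hj))
  refine ⟨this.diff, this.eq.trans ?_⟩
  funext v w
  simp only [wedge, Pi.sub_apply, Pi.add_apply, Pi.zero_apply, Pi.smul_apply, fderiv_eq_omega0 F]
  simp only [conn, omega_zero, omega_one, omega_two, omega_three, Matrix.cons_val, add_apply,
    sub_apply, smul_apply, smul_eq_mul, baseB1, baseB2, torsB, opE4]
  generalize omega0 F 0 j v = v0, omega0 F 1 j v = v1, omega0 F 2 j v = v2, omega0 F 3 j v = v3,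
    omega0 F 0 j w = w0, omega0 F 1 j w = w1, omega0 F 2 j w = w2, omega0 F 3 j w = w3
  field_simp
  ring

theorem hasExtD_omega_two (h : IsAdmissible U F) (hj : j ∈ U) :
    HasExtD (omega F 2) (conn F 1 j ⋏ omega F 0 j + conn F 2 j ⋏ omega F 2 j
      + omega F 1 j ⋏ omega F 3 j) j := by
  have h2 := h.Fpp_ne_zero j hj
  have := ((hasExtD_const (dcoord 0) j).add ((hasExtD_const (dcoord 1) j).smul
    (h.hasFDerivAt (smooth_dp h.isOpen h.smooth 1) hj))).sub
    ((h.hasExtD_omega_zero hj).smul (h.hasFDerivAt h.smooth_cA hj))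
  refine ⟨this.diff, this.eq.trans ?_⟩
  have e1 : pd 3 (dp 1 F) j = dp 2 F j := (h.dp_p hj 1).eq
  have e2 : opD (dp 1 F) j = -dzp 0 F j := by rw [h.opD_dp 0 j hj]; simp
  have e3 : pd 3 (cA F) j = cA F j ^ 2 - 2 * cC F j := (h.cA_p hj).eq
  have e4 : opD (cA F) j = (2 * cA F j * dzp 1 F j - dzp 2 F j) / dp 2 F j := by
    rw [← fderiv_vD, (h.cA_D hj).eq]
  have e5 := (h.cA_Delta hj).eq
  rw [fderiv_vDelta] at e5
  rw [show dcoord 1 = omega0 F 3 j from rfl]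
  funext v w
  simp only [wedge, Pi.sub_apply, Pi.add_apply, Pi.zero_apply, Pi.smul_apply, fderiv_eq_omega0 F,
    e1, e2, e3, e4, e5]
  simp only [conn, omega_zero, omega_one, omega_two, omega_three, Matrix.cons_val, add_apply,
    sub_apply, smul_apply, smul_eq_mul, conn23, e4]
  rw [show pd 2 (dp 1 F) j = dzp 1 F j from rfl]
  generalize omega0 F 0 j v = v0, omega0 F 1 j v = v1, omega0 F 2 j v = v2, omega0 F 3 j v = v3,
    omega0 F 0 j w = w0, omega0 F 1 j w = w1, omega0 F 2 j w = w2, omega0 F 3 j w = w3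
  field_simp
  ring

theorem hasExtD_omega_three (h : IsAdmissible U F) (hj : j ∈ U) :
    HasExtD (omega F 3) (((2 : ℝ) • conn F 2 j - conn F 0 j) ⋏ omega F 3 j
      - conn F 1 j ⋏ omega F 2 j - baseA1 F j • (omega F 0 j ⋏ omega F 1 j)) j := by
  have h2 := h.Fpp_ne_zero j hj
  have := ((hasExtD_const (dcoord 1) j).smul
    (h.hasFDerivAt (smooth_dp h.isOpen h.smooth 2) hj)).add
    ((h.hasExtD_omega_zero hj).smul (h.hasFDerivAt h.smooth_cC hj))
  refine ⟨this.diff, this.eq.trans ?_⟩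
  have e1 : pd 3 (dp 2 F) j = 3 * cA F j * dp 2 F j := by
    rw [cA, show pd 3 (dp 2 F) j = dp 3 F j from (h.dp_p hj 2).eq]; field_simp
  have e2 : opD (dp 2 F) j = -2 * dzp 1 F j := by rw [h.opD_dp 1 j hj]; norm_num
  rw [show dcoord 1 = omega0 F 3 j from rfl]
  funext v w
  simp only [wedge, Pi.sub_apply, Pi.add_apply, Pi.zero_apply, Pi.smul_apply, fderiv_eq_omega0 F,
    e1, e2]
  have e4 : opD (cA F) j = (2 * cA F j * dzp 1 F j - dzp 2 F j) / dp 2 F j := by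
    rw [← fderiv_vD, (h.cA_D hj).eq]
  simp only [conn, omega_zero, omega_one, omega_two, omega_three, Matrix.cons_val, add_apply,
    sub_apply, smul_apply, smul_eq_mul, conn23, torsC, baseA1, opE4, e4]
  rw [show pd 2 (dp 2 F) j = dzp 2 F j from rfl]
  generalize omega0 F 0 j v = v0, omega0 F 1 j v = v1, omega0 F 2 j v = v2, omega0 F 3 j v = v3,
    omega0 F 0 j w = w0, omega0 F 1 j w = w1, omega0 F 2 j w = w2, omega0 F 3 j w = w3
  field_simp
  ring

end IsAdmissible

/-! ### The torsion equations and the Bianchi identities -/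

section Bianchi

variable {E : Type} [NormedAddCommGroup E] [NormedSpace ℝ E]

/-- The first four structure equations at the point `q`, for a coframe `o` with connection forms `p`;
`a`, `b`, `b'` are the torsion coefficients `A₁`, `B₁`, `B₂`. -/
def TorsionEquations (o : Fin 4 → OneForm E) (p : Fin 3 → OneForm E) (a b b' : ℝ) (q : E) : Prop :=
  extD (o 0) q = p 0 q ⋏ o 0 q - o 1 q ⋏ o 2 q ∧
  extD (o 1) q = (p 0 q - p 2 q) ⋏ o 1 q + b • (o 0 q ⋏ o 2 q) - b' • (o 0 q ⋏ o 3 q) ∧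
  extD (o 2) q = p 1 q ⋏ o 0 q + p 2 q ⋏ o 2 q + o 1 q ⋏ o 3 q ∧
  extD (o 3) q = ((2 : ℝ) • p 2 q - p 0 q) ⋏ o 3 q - p 1 q ⋏ o 2 q - a • (o 0 q ⋏ o 1 q)

theorem HasExtD2.unique {B : E → E → E → ℝ} {S T : E → E → E → ℝ} {q : E}
    (h : HasExtD2 B S q) (h' : HasExtD2 B T q) (u v w : E) : S u v w = T u v w := by
  rw [← h.eq, h'.eq]

theorem extD_add_left {α : OneForm E} {q : E} (h : DifferentiableAt ℝ α q) (v v' w : E) :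
    extD α q (v + v') w = extD α q v w + extD α q v' w := by
  simp only [extD_apply _ _ h, map_add, add_apply]; ring

theorem extD_smul_left {α : OneForm E} {q : E} (h : DifferentiableAt ℝ α q) (c : ℝ) (v w : E) :
    extD α q (c • v) w = c * extD α q v w := by
  simp only [extD_apply _ _ h, map_smul, smul_apply, smul_eq_mul]; ring

theorem extD_swap {α : OneForm E} {q : E} (h : DifferentiableAt ℝ α q) (v w : E) :
    extD α q w v = -extD α q v w := by
  simp only [extD_apply _ _ h]; ring

theorem extD_same {α : OneForm E} {q : E} (h : DifferentiableAt ℝ α q) (v : E) :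
    extD α q v v = 0 := by
  simp only [extD_apply _ _ h]; ring

/-- The components of the exterior derivative of a 1-form with respect to a coframe `o` with dual
frame `e`. -/
theorem extD_eq_frame {α : OneForm E} {q : E} (h : DifferentiableAt ℝ α q) (o : Fin 4 → E →L[ℝ] ℝ)
    (e : Fin 4 → E)
    (he : ∀ v, v = o 0 v • e 0 + o 1 v • e 1 + o 2 v • e 2 + o 3 v • e 3) :
    extD α q = extD α q (e 0) (e 1) • (o 0 ⋏ o 1) + extD α q (e 0) (e 2) • (o 0 ⋏ o 2)
      + extD α q (e 0) (e 3) • (o 0 ⋏ o 3) + extD α q (e 1) (e 2) • (o 1 ⋏ o 2)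
      + extD α q (e 1) (e 3) • (o 1 ⋏ o 3) + extD α q (e 2) (e 3) • (o 2 ⋏ o 3) := by
  funext v w
  have hl (w : E) : extD α q v w = o 0 v * extD α q (e 0) w + o 1 v * extD α q (e 1) w
      + o 2 v * extD α q (e 2) w + o 3 v * extD α q (e 3) w := by
    conv_lhs => rw [he v]
    simp only [extD_add_left h, extD_smul_left h]
  have hr (v : E) : extD α q v w = o 0 w * extD α q v (e 0) + o 1 w * extD α q v (e 1)
      + o 2 w * extD α q v (e 2) + o 3 w * extD α q v (e 3) := by
    rw [extD_swap h]
    conv_lhs => rw [he w]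
    simp only [extD_add_left h, extD_smul_left h]
    rw [extD_swap h v, extD_swap h v, extD_swap h v, extD_swap h v]
    ring
  rw [hl]
  simp only [hr (e _), extD_same h, Pi.add_apply, Pi.smul_apply, smul_eq_mul, wedge]
  rw [extD_swap h (e 0) (e 1), extD_swap h (e 0) (e 2), extD_swap h (e 0) (e 3),
    extD_swap h (e 1) (e 2), extD_swap h (e 1) (e 3), extD_swap h (e 2) (e 3)]
  ring

/-- The identities `d²θⁱ = 0` for a coframe which satisfies the torsion equations, expressed by the
curvature forms `R₁ = dΩ₁ - Ω₂ ∧ θ²`, `R₂ = dΩ₂ - Ω₂ ∧ (Ω₁ - Ω₃)` and `R₃ = dΩ₃`. Ten components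
are free of derivatives of the torsion coefficients; one of the others is needed as well. -/
theorem bianchi_first {U : Set E} (hU : IsOpen U) {o : Fin 4 → OneForm E} {p : Fin 3 → OneForm E}
    {a b b' : E → ℝ} (ho : ∀ i, ContDiffOn ℝ ∞ (o i) U) (hp : ∀ i, ContDiffOn ℝ ∞ (p i) U)
    (ha : ContDiffOn ℝ ∞ a U) (hb : ContDiffOn ℝ ∞ b U) (hb' : ContDiffOn ℝ ∞ b' U)
    (h : ∀ q ∈ U, TorsionEquations o p (a q) (b q) (b' q) q) {q : E} (hq : q ∈ U)
    (e : Fin 4 → E) (he : ∀ i k, o i q (e k) = if i = k then 1 else 0)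
    {R : Fin 3 → Fin 4 → Fin 4 → ℝ}
    (hR0 : ∀ k l, extD (p 0) q (e k) (e l) = R 0 k l + (p 1 q ⋏ o 1 q) (e k) (e l))
    (hR1 : ∀ k l, extD (p 1) q (e k) (e l) = R 1 k l + (p 1 q ⋏ (p 0 q - p 2 q)) (e k) (e l))
    (hR2 : ∀ k l, extD (p 2) q (e k) (e l) = R 2 k l) :
    (R 0 1 2 = 0 ∧ R 0 1 3 = 0 ∧ R 0 2 3 = b' q ∧
      R 0 0 2 = 2 * R 2 0 2 + R 1 0 3) ∧
    (R 1 1 2 = -R 2 0 1 ∧ R 1 1 3 = 0 ∧ R 1 2 3 = R 2 0 3 - b q) ∧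
    (R 2 1 2 = 0 ∧ R 2 1 3 = 0 ∧ R 2 2 3 = 2 * b' q) ∧
    R 0 0 3 = fderiv ℝ b' q (e 1) + b' q * (3 * p 2 q (e 1) - p 0 q (e 1)) + R 2 0 3 - b q := by
  have n := hU.mem_nhds hq
  have d {f : E → ℝ} (hf : ContDiffOn ℝ ∞ f U) : HasFDerivAt f (fderiv ℝ f q) q :=
    (differentiableAt_of_smooth hU hf hq).hasFDerivAt
  have do' (i : Fin 4) : HasExtD (o i) (extD (o i) q) q :=
    hasExtD_self (differentiableAt_of_smooth hU (ho i) hq)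
  have dp' (i : Fin 3) : HasExtD (p i) (extD (p i) q) q :=
    hasExtD_self (differentiableAt_of_smooth hU (hp i) hq)
  have z (i : Fin 4) : HasExtD2 (extD (o i)) 0 q :=
    hasExtD2_extD (((ho i).contDiffAt n).of_le (WithTop.coe_le_coe.2 le_top))
  obtain ⟨t0, t1, t2, t3⟩ := h q hq
  have b0 := (z 0).unique ((((dp' 0).wedge (do' 0)).sub ((do' 1).wedge (do' 2))).congr_form
    (Filter.eventuallyEq_of_mem n fun x hx => (h x hx).1))
  have b1 := (z 1).unique ((((((dp' 0).sub (dp' 2)).wedge (do' 1)).add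
    (HasExtD2.smul (d hb) ((do' 0).wedge (do' 2)))).sub
    (HasExtD2.smul (d hb') ((do' 0).wedge (do' 3)))).congr_form
    (Filter.eventuallyEq_of_mem n fun x hx => (h x hx).2.1))
  have b2 := (z 2).unique (((((dp' 1).wedge (do' 0)).add ((dp' 2).wedge (do' 2))).add
    ((do' 1).wedge (do' 3))).congr_form
    (Filter.eventuallyEq_of_mem n fun x hx => (h x hx).2.2.1))
  have b3 := (z 3).unique ((((((HasExtD.smul (hasFDerivAt_const (2 : ℝ) q) (dp' 2)).sub
    (dp' 0)).wedge (do' 3)).sub ((dp' 1).wedge (do' 2))).sub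
    (HasExtD2.smul (d ha) ((do' 0).wedge (do' 1)))).congr_form
    (Filter.eventuallyEq_of_mem n fun x hx => (h x hx).2.2.2))
  simp only [Pi.zero_apply, Pi.add_apply, Pi.sub_apply, Pi.smul_apply, smul_eq_mul, t0, t1, t2, t3,
    wedge, sub_apply, smul_apply, zero_apply] at b0 b1 b2 b3
  simp only [wedge, sub_apply] at hR0 hR1
  -- The components below are those from which the eleven relations follow by linear algebra.
  have c0 := b0 (e 0) (e 1) (e 2)
  have c1 := b0 (e 0) (e 1) (e 3)
  have c2 := b0 (e 0) (e 2) (e 3)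
  have c3 := b1 (e 0) (e 1) (e 3)
  have c4 := b1 (e 1) (e 2) (e 3)
  have c5 := b2 (e 0) (e 1) (e 2)
  have c6 := b2 (e 0) (e 1) (e 3)
  have c7 := b2 (e 0) (e 2) (e 3)
  have c8 := b2 (e 1) (e 2) (e 3)
  have c9 := b3 (e 0) (e 2) (e 3)
  have c10 := b3 (e 1) (e 2) (e 3)
  simp only [hR0, hR1, hR2, he] at c0 c1 c2 c3 c4 c5 c6 c7 c8 c9 c10
  simp only [Fin.reduceEq, ↓reduceIte] at c0 c1 c2 c3 c4 c5 c6 c7 c8 c9 c10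
  clear b0 b1 b2 b3
  ring_nf at c0 c1 c2 c3 c4 c5 c6 c7 c8 c9 c10
  refine ⟨⟨?_, ?_, ?_, ?_⟩, ⟨?_, ?_, ?_⟩, ⟨?_, ?_, ?_⟩, ?_⟩ <;> linarith

/-- The last three structure equations at the point `q`, for a coframe `o` with connection forms `p`
and curvature invariants `c`. -/
def CurvatureEquations (o : Fin 4 → OneForm E) (p : Fin 3 → OneForm E) (c : Curvature) (q : E) :
    Prop :=
  extD (p 0) q = p 1 q ⋏ o 1 q + (c.A2 - 2 * c.C1) • (o 0 q ⋏ o 1 q)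
      + (3 * c.B3 + c.E1) • (o 0 q ⋏ o 2 q)
      + (2 * c.B1 - 3 * c.B4) • (o 0 q ⋏ o 3 q) + c.B2 • (o 2 q ⋏ o 3 q) ∧
  extD (p 1) q = p 1 q ⋏ (p 0 q - p 2 q) - c.A3 • (o 0 q ⋏ o 1 q) + c.E2 • (o 0 q ⋏ o 2 q)
      - (c.B3 + c.E1) • (o 0 q ⋏ o 3 q) + c.C1 • (o 1 q ⋏ o 2 q)
      + (c.B1 - 2 * c.B4) • (o 2 q ⋏ o 3 q) ∧
  extD (p 2) q = -(c.C1 • (o 0 q ⋏ o 1 q)) + (2 * c.B3 + c.E1) • (o 0 q ⋏ o 2 q)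
      + (2 * (c.B1 - c.B4)) • (o 0 q ⋏ o 3 q) + (2 * c.B2) • (o 2 q ⋏ o 3 q)

/-- The components of the curvature forms `R₁ = dΩ₁ - Ω₂ ∧ θ²`, `R₂ = dΩ₂ - Ω₂ ∧ (Ω₁ - Ω₃)` and
`R₃ = dΩ₃` with respect to a frame `e`. -/
def curvComp (o : Fin 4 → OneForm E) (p : Fin 3 → OneForm E) (e : Fin 4 → E → E) (q : E) :
    Fin 3 → Fin 4 → Fin 4 → ℝ :=
  ![fun k l => extD (p 0) q (e k q) (e l q) - (p 1 q ⋏ o 1 q) (e k q) (e l q),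
    fun k l => extD (p 1) q (e k q) (e l q) - (p 1 q ⋏ (p 0 q - p 2 q)) (e k q) (e l q),
    fun k l => extD (p 2) q (e k q) (e l q)]

/-- The curvature invariants, from the torsion coefficients and the curvature components. -/
def curvOf (a b b' : ℝ) (R : Fin 3 → Fin 4 → Fin 4 → ℝ) : Curvature where
  A1 := a
  A2 := R 0 0 1 - 2 * R 2 0 1
  A3 := -R 1 0 1
  B1 := b
  B2 := b'
  B3 := R 2 0 2 + R 1 0 3
  B4 := b - R 2 0 3 / 2
  C1 := -R 2 0 1
  E1 := -2 * R 1 0 3 - R 2 0 2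
  E2 := R 1 0 2

/-- The curvature equations follow from the torsion equations. The Bianchi identities for
`dθ¹, …, dθ⁴` leave one relation between the curvature components open, which follows from
`d²Ω₃ = 0`. -/
theorem curvatureEquations_of_torsionEquations {U : Set E} (hU : IsOpen U)
    {o : Fin 4 → OneForm E} {p : Fin 3 → OneForm E}
    {a b b' : E → ℝ} (ho : ∀ i, ContDiffOn ℝ ∞ (o i) U) (hp : ∀ i, ContDiffOn ℝ ∞ (p i) U)
    (ha : ContDiffOn ℝ ∞ a U) (hb : ContDiffOn ℝ ∞ b U) (hb' : ContDiffOn ℝ ∞ b' U)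
    (h : ∀ q ∈ U, TorsionEquations o p (a q) (b q) (b' q) q)
    (e : Fin 4 → E → E) (hes : ∀ k, ContDiffOn ℝ ∞ (e k) U)
    (he : ∀ q ∈ U, ∀ i k, o i q (e k q) = if i = k then 1 else 0)
    (hev : ∀ q ∈ U, ∀ v, v = o 0 q v • e 0 q + o 1 q v • e 1 q + o 2 q v • e 2 q + o 3 q v • e 3 q)
    {q : E} (hq : q ∈ U) :
    CurvatureEquations o p (curvOf (a q) (b q) (b' q) (curvComp o p e q)) q ∧
      curvComp o p e q 1 1 2 = -curvComp o p e q 2 0 1 := by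
  have n := hU.mem_nhds hq
  have hpd (i : Fin 3) {x : E} (hx : x ∈ U) : DifferentiableAt ℝ (p i) x :=
    differentiableAt_of_smooth hU (hp i) hx
  have B (x : E) (hx : x ∈ U) := bianchi_first hU ho hp ha hb hb' h hx (fun k => e k x) (he x hx)
    (R := curvComp o p e x) (by simp [curvComp]) (by simp [curvComp]) (by simp [curvComp])
  obtain ⟨⟨B1, B2, B3, B4⟩, ⟨B5, B6, B7⟩, ⟨B8, B9, B10⟩, B11⟩ := B q hq
  have hs (k l : Fin 4) : DifferentiableAt ℝ (fun x => extD (p 2) x (e k x) (e l x)) q := by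
    have hf : ContDiffOn ℝ ∞ (fderiv ℝ (p 2)) U := (hp 2).fderiv_of_isOpen hU (m := ∞) (by simp)
    have : ContDiffOn ℝ ∞ (fun x => fderiv ℝ (p 2) x (e k x) (e l x)
        - fderiv ℝ (p 2) x (e l x) (e k x)) U :=
      ((hf.clm_apply (hes k)).clm_apply (hes l)).sub ((hf.clm_apply (hes l)).clm_apply (hes k))
    refine (differentiableAt_of_smooth hU this hq).congr_of_eventuallyEq
      (Filter.eventuallyEq_of_mem n fun x hx => ?_)
    exact extD_apply _ _ (hpd 2 hx) _ _
  have dp2 : ∀ x ∈ U, extD (p 2) x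
      = extD (p 2) x (e 0 x) (e 1 x) • (o 0 x ⋏ o 1 x)
        + extD (p 2) x (e 0 x) (e 2 x) • (o 0 x ⋏ o 2 x)
        + extD (p 2) x (e 0 x) (e 3 x) • (o 0 x ⋏ o 3 x) + (2 * b' x) • (o 2 x ⋏ o 3 x) := by
    intro x hx
    obtain ⟨-, -, ⟨h12, h13, h23⟩, -⟩ := B x hx
    conv_lhs => rw [extD_eq_frame (hpd 2 hx) (fun i => o i x) (fun k => e k x) (hev x hx)]
    simp only [curvComp, Matrix.cons_val] at h12 h13 h23
    rw [h12, h13, h23]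
    simp
  have do' (i : Fin 4) : HasExtD (o i) (extD (o i) q) q :=
    hasExtD_self (differentiableAt_of_smooth hU (ho i) hq)
  -- The component of `d²Ω₃ = 0` along the last three frame vectors, which eliminates the
  -- derivative of `b'` from the eleventh relation.
  have key : curvComp o p e q 0 0 3 = 3 / 2 * curvComp o p e q 2 0 3 - b q := by
    have z := (hasExtD2_extD (((hp 2).contDiffAt n).of_le (WithTop.coe_le_coe.2 le_top))).unique
      (((((HasExtD2.smul (hs 0 1).hasFDerivAt ((do' 0).wedge (do' 1))).add
        (HasExtD2.smul (hs 0 2).hasFDerivAt ((do' 0).wedge (do' 2)))).add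
        (HasExtD2.smul (hs 0 3).hasFDerivAt ((do' 0).wedge (do' 3)))).add
        (HasExtD2.smul ((differentiableAt_of_smooth hU hb' hq).hasFDerivAt.const_mul 2)
          ((do' 2).wedge (do' 3)))).congr_form (Filter.eventuallyEq_of_mem n dp2))
      (e 1 q) (e 2 q) (e 3 q)
    obtain ⟨t0, t1, t2, t3⟩ := h q hq
    simp only [Pi.zero_apply, Pi.add_apply, Pi.sub_apply, Pi.smul_apply, smul_eq_mul, t0, t1, t2,
      t3, wedge, sub_apply, smul_apply, he q hq] at z
    simp only [Fin.reduceEq, ↓reduceIte] at z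
    have e3 : curvComp o p e q 2 0 3 = extD (p 2) q (e 0 q) (e 3 q) := rfl
    rw [B11, e3]
    ring_nf at z
    linarith
  have R0 (k l : Fin 4) : extD (p 0) q (e k q) (e l q)
      = curvComp o p e q 0 k l + (p 1 q ⋏ o 1 q) (e k q) (e l q) := by simp [curvComp]
  have R1 (k l : Fin 4) : extD (p 1) q (e k q) (e l q)
      = curvComp o p e q 1 k l + (p 1 q ⋏ (p 0 q - p 2 q)) (e k q) (e l q) := by simp [curvComp]
  have R2 (k l : Fin 4) : extD (p 2) q (e k q) (e l q) = curvComp o p e q 2 k l := by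
    simp [curvComp]
  have hp1 (i : Fin 3) (v : E) : p i q v = o 0 q v * p i q (e 0 q) + o 1 q v * p i q (e 1 q)
      + o 2 q v * p i q (e 2 q) + o 3 q v * p i q (e 3 q) := by
    conv_lhs => rw [hev q hq v]
    simp
  refine ⟨⟨?_, ?_, ?_⟩, B5⟩
  · rw [extD_eq_frame (hpd 0 hq) (fun i => o i q) (fun k => e k q) (hev q hq)]
    funext v w
    simp only [R0, B1, B2, B3, B4, key, curvOf, Pi.add_apply, Pi.smul_apply, smul_eq_mul, wedge,
      he q hq]
    simp only [Fin.reduceEq, ↓reduceIte]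
    rw [hp1 1 v, hp1 1 w]
    ring
  · rw [extD_eq_frame (hpd 1 hq) (fun i => o i q) (fun k => e k q) (hev q hq)]
    funext v w
    simp only [R1, B5, B6, B7, curvOf, Pi.add_apply, Pi.sub_apply, Pi.smul_apply, smul_eq_mul,
      wedge, sub_apply]
    rw [hp1 1 v, hp1 1 w, hp1 0 v, hp1 0 w, hp1 2 v, hp1 2 w]
    ring
  · rw [extD_eq_frame (hpd 2 hq) (fun i => o i q) (fun k => e k q) (hev q hq)]
    funext v w
    simp only [R2, B8, B9, B10, curvOf, Pi.add_apply, Pi.neg_apply, Pi.smul_apply, smul_eq_mul,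
      wedge]
    ring

end Bianchi

/-! ### The structure equations on the jet space -/

/-- The frame dual to the adapted coframe. -/
def frame (F : J4 → ℝ) : Fin 4 → J4 → J4 :=
  ![fun j => Pi.single 2 1 + cB F j • vp + cA F j • vD j
      - (cC F j / dp 2 F j) • (vDelta F j - dp 1 F j • vD j),
    fun _ => vp, fun j => vD j,
    fun j => (dp 2 F j)⁻¹ • (vDelta F j - dp 1 F j • vD j)]

/-- The curvature invariants on the section `h = 1`. -/
def baseCurv (F : J4 → ℝ) (j : J4) : Curvature :=
  curvOf (baseA1 F j) (baseB1 F j) (baseB2 F j) (curvComp (omega F) (conn F) (frame F) j)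

/-- `conn23` in terms of the derivatives of `F`. -/
def conn23Formula (F : J4 → ℝ) (x : J4) : ℝ :=
  (12 * (dp 1 F x * dp 2 F x ^ 2 * dzp 3 F x) - 24 * (dp 1 F x * dp 2 F x * dp 3 F x * dzp 2 F x)
    - 6 * (dp 1 F x * dp 2 F x * dp 4 F x * dzp 1 F x) + 16 * (dp 1 F x * dp 3 F x ^ 2 * dzp 1 F x)
    + 18 * (dp 2 F x ^ 3 * dzp 2 F x) - 12 * (dp 2 F x ^ 2 * dp 3 F x * dzp 1 F x)
    + 3 * (dp 2 F x ^ 2 * deltaP 4 F x) - 8 * (dp 2 F x * dp 3 F x * deltaP 3 F x)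
    - 3 * (dp 2 F x * dp 4 F x * deltaP 2 F x) + 8 * (dp 3 F x ^ 2 * deltaP 2 F x))
    / (9 * dp 2 F x ^ 4)

theorem smooth_omega0 {U : Set J4} {F : J4 → ℝ} (hF : ContDiffOn ℝ ∞ F U) (i : Fin 4) :
    ContDiffOn ℝ ∞ (omega0 F i) U := by
  fin_cases i
  · exact (contDiffOn_const.sub ((contDiff_apply ℝ ℝ (3 : Fin 4)).contDiffOn.smul
      contDiffOn_const)).sub (hF.smul contDiffOn_const)
  all_goals exact contDiffOn_const

namespace IsAdmissible

variable {U : Set J4} {F f g : J4 → ℝ} {j : J4}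

theorem smooth_omega (h : IsAdmissible U F) (i : Fin 4) : ContDiffOn ℝ ∞ (omega F i) U := by
  have d (n : ℕ) := smooth_dp h.isOpen h.smooth n
  have h0 : ContDiffOn ℝ ∞ (omega F 0) U := smooth_omega0 h.smooth 0
  fin_cases i
  · exact h0
  · exact contDiffOn_const.sub (h.smooth_cB.smul h0)
  · exact (contDiffOn_const.add ((d 1).smul contDiffOn_const)).sub (h.smooth_cA.smul h0)
  · exact ((d 2).smul contDiffOn_const).add (h.smooth_cC.smul h0)

theorem smooth_torsB (h : IsAdmissible U F) : ContDiffOn ℝ ∞ (torsB F) U :=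
  (smooth_pd h.isOpen h.smooth_cB 3).sub (h.smooth_cA.mul h.smooth_cB)

theorem smooth_torsC (h : IsAdmissible U F) : ContDiffOn ℝ ∞ (torsC F) U := by
  have d (n : ℕ) := smooth_dp h.isOpen h.smooth n
  have z (n : ℕ) := smooth_dzp h.isOpen h.smooth n
  exact (((((h.smooth_cC.mul (z 0)).div (d 2) h.Fpp_ne_zero).neg.sub
    (h.smooth_opE4 h.smooth_cC)).add (((z 2).sub ((contDiffOn_const.mul h.smooth_cA).mul
      (z 1))).div (d 2) h.Fpp_ne_zero)).add ((contDiffOn_const.mul h.smooth_cA).mul h.smooth_cB))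

theorem smooth_conn23 (h : IsAdmissible U F) : ContDiffOn ℝ ∞ (conn23 F) U :=
  (h.smooth_torsB.add h.smooth_torsC).sub (((h.smooth_cA.mul h.smooth_cB).add
    (smooth_opD h.isOpen h.smooth_cA)).sub ((h.smooth_cC.mul (smooth_dzp h.isOpen h.smooth 0)).div
      (smooth_dp h.isOpen h.smooth 2) h.Fpp_ne_zero))

theorem smooth_conn (h : IsAdmissible U F) (i : Fin 3) : ContDiffOn ℝ ∞ (conn F i) U := by
  have d (n : ℕ) := smooth_dp h.isOpen h.smooth n
  have z (n : ℕ) := smooth_dzp h.isOpen h.smooth n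
  have o := h.smooth_omega
  have zd := (z 0).div (d 2) h.Fpp_ne_zero
  fin_cases i
  · exact (((((contDiffOn_const.mul h.smooth_torsB).add h.smooth_torsC).smul (o 0)).sub
      (h.smooth_cA.smul (o 1))).add (h.smooth_cB.smul (o 2))).add (zd.smul (o 3))
  · exact ((((((h.smooth_cC.mul h.smooth_cB).add (smooth_opD h.isOpen h.smooth_cC)).add
      (((contDiffOn_const.mul (z 1)).mul h.smooth_cC).div (d 2) h.Fpp_ne_zero)).smul (o 0)).add
      (h.smooth_cC.smul (o 1))).add (h.smooth_conn23.smul (o 2))).sub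
      (((contDiffOn_const.mul h.smooth_cB).add ((contDiffOn_const.mul (z 1)).div (d 2)
        h.Fpp_ne_zero)).smul (o 3))
  · exact ((((h.smooth_torsB.add h.smooth_torsC).smul (o 0)).add
      (h.smooth_cA.smul (o 1))).add ((contDiffOn_const.mul h.smooth_cB).smul (o 2))).add
      (zd.smul (o 3))

theorem smooth_baseA1 (h : IsAdmissible U F) : ContDiffOn ℝ ∞ (baseA1 F) U :=
  (smooth_pd h.isOpen h.smooth_cC 3).sub ((contDiffOn_const.mul h.smooth_cA).mul h.smooth_cC)

theorem smooth_baseB1 (h : IsAdmissible U F) : ContDiffOn ℝ ∞ (baseB1 F) U :=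
  (smooth_opD h.isOpen h.smooth_cB).add (h.smooth_cB.pow 2)

theorem smooth_baseB2 (h : IsAdmissible U F) : ContDiffOn ℝ ∞ (baseB2 F) U :=
  ((h.smooth_opE4 h.smooth_cB).add ((h.smooth_cB.mul (smooth_dzp h.isOpen h.smooth 0)).div
    (smooth_dp h.isOpen h.smooth 2) h.Fpp_ne_zero)).neg

theorem smooth_frame (h : IsAdmissible U F) (k : Fin 4) : ContDiffOn ℝ ∞ (frame F k) U := by
  have d (n : ℕ) := smooth_dp h.isOpen h.smooth n
  have hD : ContDiffOn ℝ ∞ vD U := contDiffOn_const.add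
    ((contDiff_apply ℝ ℝ (3 : Fin 4)).contDiffOn.smul contDiffOn_const)
  have hY : ContDiffOn ℝ ∞ (vDelta F) U := contDiffOn_const.add
    (h.smooth.smul contDiffOn_const)
  have hX := hY.sub ((d 1).smul hD)
  fin_cases k
  · exact ((contDiffOn_const.add (h.smooth_cB.smul contDiffOn_const)).add
      (h.smooth_cA.smul hD)).sub ((h.smooth_cC.div (d 2) h.Fpp_ne_zero).smul hX)
  · exact contDiffOn_const
  · exact hD
  · exact ((d 2).inv h.Fpp_ne_zero).smul hX

theorem omega_frame (h : IsAdmissible U F) (hj : j ∈ U) (i k : Fin 4) :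
    omega F i j (frame F k j) = if i = k then 1 else 0 := by
  have h2 := h.Fpp_ne_zero j hj
  fin_cases i <;> fin_cases k <;>
    simp [omega_zero, omega_one, omega_two, omega_three, omega0, frame, vp, vD, vDelta, dcoord] <;>
    field_simp <;> ring_nf <;> simp

/-- Every vector is the combination of the frame with the values of the coframe as coefficients. -/
theorem eq_sum_frame (h : IsAdmissible U F) (hj : j ∈ U) (v : J4) :
    v = omega F 0 j v • frame F 0 j + omega F 1 j v • frame F 1 j + omega F 2 j v • frame F 2 j
      + omega F 3 j v • frame F 3 j := by
  have h2 := h.Fpp_ne_zero j hj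
  ext i
  fin_cases i <;>
    simp [omega_zero, omega_one, omega_two, omega_three, omega0, frame, vp, vD, vDelta, dcoord] <;>
    field_simp <;> ring

theorem torsionEquations (h : IsAdmissible U F) (hj : j ∈ U) :
    TorsionEquations (omega F) (conn F) (baseA1 F j) (baseB1 F j) (baseB2 F j) j :=
  ⟨(h.hasExtD_omega_zero hj).eq, (h.hasExtD_omega_one hj).eq, (h.hasExtD_omega_two hj).eq,
    (h.hasExtD_omega_three hj).eq⟩

theorem curvatureEquations (h : IsAdmissible U F) (hj : j ∈ U) :
    CurvatureEquations (omega F) (conn F) (baseCurv F j) j ∧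
      curvComp (omega F) (conn F) (frame F) j 1 1 2
        = -curvComp (omega F) (conn F) (frame F) j 2 0 1 :=
  curvatureEquations_of_torsionEquations h.isOpen h.smooth_omega h.smooth_conn h.smooth_baseA1
    h.smooth_baseB1 h.smooth_baseB2 (fun _ hq => h.torsionEquations hq) (frame F) h.smooth_frame
    (fun _ hq => h.omega_frame hq) (fun _ hq => h.eq_sum_frame hq) hj

theorem baseCurv_A1 (h : IsAdmissible U F) (hj : j ∈ U) :
    (baseCurv F j).A1 = -(1 / 54) * (monge F j / dp 2 F j ^ 3) := by
  have h2 := h.Fpp_ne_zero j hj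
  have e : pd 3 (cC F) j = _ := (h.cC_p hj).eq
  simp only [baseCurv, curvOf, baseA1, e, cA, cC, monge]
  field_simp
  ring

theorem conn23_eq (h : IsAdmissible U F) (hj : j ∈ U) : conn23 F j = conn23Formula F j := by
  have h2 := h.Fpp_ne_zero j hj
  have d (n : ℕ) := h.dp_p hj n
  have z (n : ℕ) := h.dzp_p hj n
  have y (n : ℕ) := h.deltaP_p hj n
  have eb : pd 3 (cB F) j = _ := ((((((y 3).mul (d 2)).sub ((y 2).mul (d 3))).add
    ((((d 1).const_mul 3).mul (d 2)).mul (z 2))).sub ((((d 2).pow 2).const_mul 3).mul (z 1))).sub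
    ((((d 1).const_mul 2).mul (d 3)).mul (z 1))).div (((d 2).pow 3).const_mul 6)
    (by positivity) |>.eq
  have e1 : opD (cC F) j = _ := (fderiv_vD _ _).symm.trans (h.cC_D hj).eq
  have e2 : opDelta F (cC F) j = _ := (fderiv_vDelta _ _ _).symm.trans (h.cC_Delta hj).eq
  have e3 : opD (cA F) j = _ := (fderiv_vD _ _).symm.trans (h.cA_D hj).eq
  simp only [conn23, torsB, torsC, opE4, conn23Formula, eb, e1, e2, e3]
  simp only [cA, cB, cC]
  push_cast
  field_simp
  ring

/-- `C₁` is the component `R₂(∂_p, D)` of the curvature form `R₂ = dΩ₂ - Ω₂ ∧ (Ω₁ - Ω₃)`. -/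
theorem baseCurv_C1_eq (h : IsAdmissible U F) (hj : j ∈ U) :
    (baseCurv F j).C1
      = pd 3 (conn23 F) j - 2 * opD (cC F) j + 4 * cB F j * cC F j - cA F j * conn23 F j := by
  have h2 := h.Fpp_ne_zero j hj
  have hC : (baseCurv F j).C1 = curvComp (omega F) (conn F) (frame F) j 1 1 2 :=
    (h.curvatureEquations hj).2.symm
  have o (i : Fin 4) := hasExtD_self (differentiableAt_of_smooth h.isOpen (h.smooth_omega i) hj)
  have f {g : J4 → ℝ} (hg : ContDiffOn ℝ ∞ g U) := h.hasFDerivAt hg hj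
  have d (n : ℕ) := smooth_dp h.isOpen h.smooth n
  have z (n : ℕ) := smooth_dzp h.isOpen h.smooth n
  have e : extD (conn F 1) j = _ := ((((HasExtD.smul
    (f (((h.smooth_cC.mul h.smooth_cB).add (smooth_opD h.isOpen h.smooth_cC)).add
      (((contDiffOn_const.mul (z 1)).mul h.smooth_cC).div (d 2) h.Fpp_ne_zero))) (o 0)).add
    (HasExtD.smul (f h.smooth_cC) (o 1))).add (HasExtD.smul (f h.smooth_conn23) (o 2))).sub
    (HasExtD.smul (f ((contDiffOn_const.mul h.smooth_cB).add ((contDiffOn_const.mul (z 1)).div (d 2)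
        h.Fpp_ne_zero))) (o 3))).eq
  obtain ⟨t0, t1, t2, t3⟩ := h.torsionEquations hj
  have w := h.omega_frame hj
  have f1 (g : J4 → ℝ) : fderiv ℝ g j (frame F 1 j) = pd 3 g j := rfl
  have f2 (g : J4 → ℝ) : fderiv ℝ g j (frame F 2 j) = opD g j := fderiv_vD g j
  rw [hC]
  simp only [curvComp, Matrix.cons_val, e, Pi.add_apply, Pi.sub_apply, Pi.smul_apply,
    Pi.div_apply, smul_eq_mul, t0, t1, t2, t3, wedge, sub_apply, smul_apply, w, f1, f2]
  simp only [conn, Matrix.cons_val, add_apply, sub_apply, smul_apply, smul_eq_mul, w,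
    Fin.reduceEq, ↓reduceIte]
  ring

theorem baseCurv_C1 (h : IsAdmissible U F) (hj : j ∈ U) :
    (baseCurv F j).C1 = 1 / 3 * (invK F j / dp 2 F j ^ 5) := by
  have h2 := h.Fpp_ne_zero j hj
  have d (n : ℕ) := h.dp_p hj n
  have z (n : ℕ) := h.dzp_p hj n
  have y (n : ℕ) := h.deltaP_p hj n
  have n1 := (((d 1).mul ((d 2).pow 2)).mul (z 3)).const_mul 12
  have n2 := ((((d 1).mul (d 2)).mul (d 3)).mul (z 2)).const_mul 24
  have n3 := ((((d 1).mul (d 2)).mul (d 4)).mul (z 1)).const_mul 6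
  have n4 := (((d 1).mul ((d 3).pow 2)).mul (z 1)).const_mul 16
  have n5 := (((d 2).pow 3).mul (z 2)).const_mul 18
  have n6 := ((((d 2).pow 2).mul (d 3)).mul (z 1)).const_mul 12
  have n7 := (((d 2).pow 2).mul (y 4)).const_mul 3
  have n8 := (((d 2).mul (d 3)).mul (y 3)).const_mul 8
  have n9 := (((d 2).mul (d 4)).mul (y 2)).const_mul 3
  have n10 := (((d 3).pow 2).mul (y 2)).const_mul 8
  have e : pd 3 (conn23Formula F) j = _ := ((((((((((n1.sub n2).sub n3).add n4).add n5).sub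
    n6).add n7).sub n8).sub n9).add n10).div (((d 2).pow 4).const_mul 9) (by positivity)).eq
  have e1 : opD (cC F) j = _ := (fderiv_vD _ _).symm.trans (h.cC_D hj).eq
  rw [h.baseCurv_C1_eq hj, pd_congr h.isOpen (fun x hx => h.conn23_eq hx) hj, h.conn23_eq hj, e, e1]
  simp only [cA, cB, cC, invK, conn23Formula]
  push_cast
  field_simp
  ring

end IsAdmissible

/-! ### Passage to the principal bundle -/

/-- The pullback of a 1-form from the jet space to the bundle. -/
def pull (α : OneForm J4) : OneForm P7 := fun q =>
  (α q.1).comp (ContinuousLinearMap.fst ℝ J4 (Fin 3 → ℝ))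

/-- The differentials `du₃, du₅, du₈` of the fibre coordinates. -/
def du (i : Fin 3) : P7 →L[ℝ] ℝ :=
  (ContinuousLinearMap.proj i).comp (ContinuousLinearMap.snd ℝ J4 (Fin 3 → ℝ))

theorem HasExtD.pull {α : OneForm J4} {B : J4 → J4 → ℝ} {q : P7} (h : HasExtD α B q.1) :
    HasExtD (pull α) (fun v w => B v.1 w.1) q := by
  have hφ : ContDiffAt ℝ 2 (Prod.fst : P7 → J4) q := contDiffAt_fst
  have e : CartanPDE.pull α = fun x => (α x.1).comp (fderiv ℝ (Prod.fst : P7 → J4) x) := by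
    funext x
    rw [fderiv_fst]
    rfl
  rw [e]
  refine ⟨differentiableAt_pullback hφ h.diff, ?_⟩
  funext v w
  rw [extD_pullback hφ h.diff, h.eq, fderiv_fst]
  rfl

theorem lift_zero (α : Fin 4 → OneForm J4) :
    lift α 0 = fun q => (q.2 0 * q.2 1) • pull (α 0) q := by
  funext q
  simp [lift, matAct, hMat, Fin.sum_univ_four, pull]

theorem lift_one (α : Fin 4 → OneForm J4) : lift α 1 = fun q => q.2 0 • pull (α 1) q := by
  funext q
  simp [lift, matAct, hMat, Fin.sum_univ_four, pull]

theorem lift_two (α : Fin 4 → OneForm J4) :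
    lift α 2 = fun q => (-1 * (q.2 0 * q.2 2)) • pull (α 0) q + q.2 1 • pull (α 2) q := by
  funext q
  simp [lift, matAct, hMat, Fin.sum_univ_four, pull]

theorem lift_three (α : Fin 4 → OneForm J4) :
    lift α 3 = fun q => (-1 / 2 * (q.2 0 * q.2 2 ^ 2 * (q.2 1)⁻¹)) • pull (α 0) q
      + q.2 2 • pull (α 2) q + (q.2 1 * (q.2 0)⁻¹) • pull (α 3) q := by
  funext q
  simp only [lift, matAct, hMat, Fin.sum_univ_four, pull]
  simp only [Matrix.of_apply, Matrix.cons_val', Matrix.cons_val, zero_smul, add_zero]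
  congr 3
  ring

/-- The connection forms on the bundle of the lifted coframe, from connection forms `p` of the
coframe `o`: the entries of `dh h⁻¹` plus the forms `p`, transformed by the action of `H₃`. -/
def liftConn (o : Fin 4 → OneForm J4) (p : Fin 3 → OneForm J4) : Fin 3 → OneForm P7 :=
  ![fun q => (q.2 0)⁻¹ • du 0 + (q.2 1)⁻¹ • du 1 + pull (p 0) q
      - (q.2 0 * q.2 2 * (q.2 1)⁻¹) • pull (o 1) q,
    fun q => (q.2 2 * (q.2 1)⁻¹ ^ 2) • du 1 - (q.2 2 * (q.2 0)⁻¹ * (q.2 1)⁻¹) • du 0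
      - (q.2 1)⁻¹ • du 2 - (q.2 2 * (q.2 1)⁻¹) • pull (p 0) q + (q.2 0)⁻¹ • pull (p 1) q
      + (q.2 2 * (q.2 1)⁻¹) • pull (p 2) q
      + (1 / 2 * (q.2 0 * q.2 2 ^ 2 * (q.2 1)⁻¹ ^ 2)) • pull (o 1) q,
    fun q => (q.2 1)⁻¹ • du 1 + pull (p 2) q]

/-- The curvature invariants at the point `h` of the fibre, from those at `h = 1`. -/
def liftCurv (c : Curvature) (u : Fin 3 → ℝ) : Curvature where
  A1 := c.A1 / u 0 ^ 3
  A2 := c.A2 / (u 0 ^ 2 * u 1)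
  A3 := c.A3 / (u 0 ^ 3 * u 1) + c.A2 * u 2 / (u 0 ^ 2 * u 1 ^ 2)
  B1 := c.B1 / u 1 ^ 2 + c.B2 * u 2 * u 0 / u 1 ^ 3
  B2 := u 0 * c.B2 / u 1 ^ 2
  B3 := c.B3 / (u 0 * u 1 ^ 2) - (c.B1 - c.B4) * u 2 / u 1 ^ 3
    - c.B2 * u 2 ^ 2 * u 0 / (2 * u 1 ^ 4)
  B4 := c.B4 / u 1 ^ 2
  C1 := c.C1 / (u 0 ^ 2 * u 1)
  E1 := c.E1 / (u 0 * u 1 ^ 2)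
  E2 := c.E2 / (u 0 ^ 2 * u 1 ^ 2) + c.E1 * u 2 / (u 0 * u 1 ^ 3)

theorem hasFDerivAt_u (i : Fin 3) (q : P7) : HasFDerivAt (fun q : P7 => q.2 i) (du i) q :=
  (du i).hasFDerivAt

theorem hasFDerivAt_u_inv {i : Fin 3} {q : P7} (h : q.2 i ≠ 0) :
    HasFDerivAt (fun q : P7 => (q.2 i)⁻¹) (-(q.2 i ^ 2)⁻¹ • du i) q :=
  (hasDerivAt_inv h).comp_hasFDerivAt q (hasFDerivAt_u i q)

section Lift

variable {o : Fin 4 → OneForm J4} {p : Fin 3 → OneForm J4} {c : Curvature} {q : P7}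

theorem torsionEquations_lift (hq : q.2 ∈ params)
    (ho : ∀ i, DifferentiableAt ℝ (o i) q.1)
    (ht : TorsionEquations o p c.A1 c.B1 c.B2 q.1) :
    TorsionEquations (lift o) (liftConn o p) (liftCurv c q.2).A1 (liftCurv c q.2).B1
      (liftCurv c q.2).B2 q := by
  obtain ⟨hs0, ht0⟩ := hq
  obtain ⟨t0, t1, t2, t3⟩ := ht
  have o' (i : Fin 4) : HasExtD (pull (o i)) (fun v w => extD (o i) q.1 v.1 w.1) q :=
    (hasExtD_self (ho i)).pull
  have s := hasFDerivAt_u 0 q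
  have t := hasFDerivAt_u 1 q
  have r := hasFDerivAt_u 2 q
  have s' := hasFDerivAt_u_inv hs0
  have t' := hasFDerivAt_u_inv ht0
  refine ⟨?_, ?_, ?_, ?_⟩
  · have e : extD (fun q => (q.2 0 * q.2 1) • pull (o 0) q) q = _ := ((o' 0).smul (s.mul t)).eq
    rw [← lift_zero] at e
    rw [e]
    funext v w
    simp only [t0, liftConn, lift_zero, lift_one, lift_two, Matrix.cons_val, wedge, Pi.add_apply,
      Pi.sub_apply, Pi.mul_apply, Pi.smul_apply, smul_eq_mul, add_apply, sub_apply, smul_apply,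
      pull, ContinuousLinearMap.comp_apply, ContinuousLinearMap.coe_fst']
    field_simp
    ring
  · have e : extD (fun q => q.2 0 • pull (o 1) q) q = _ := ((o' 1).smul s).eq
    rw [← lift_one] at e
    rw [e]
    funext v w
    simp only [t1, liftConn, liftCurv, lift_zero, lift_one, lift_two, lift_three, Matrix.cons_val,
      wedge, Pi.add_apply, Pi.sub_apply, Pi.smul_apply, smul_eq_mul, add_apply, sub_apply,
      smul_apply, pull, ContinuousLinearMap.comp_apply, ContinuousLinearMap.coe_fst']
    field_simp
    ring
  · have e : extD (fun q => (-1 * (q.2 0 * q.2 2)) • pull (o 0) q + q.2 1 • pull (o 2) q) q = _ :=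
      (((o' 0).smul ((s.mul r).const_mul (-1))).add ((o' 2).smul t)).eq
    rw [← lift_two] at e
    rw [e]
    funext v w
    simp only [t0, t2, liftConn, lift_zero, lift_one, lift_two, lift_three, Matrix.cons_val,
      wedge, Pi.add_apply, Pi.sub_apply, Pi.mul_apply, Pi.smul_apply, smul_eq_mul, add_apply,
      sub_apply, smul_apply, pull, ContinuousLinearMap.comp_apply, ContinuousLinearMap.coe_fst']
    field_simp
    ring
  · have e : extD (fun q => (-1 / 2 * (q.2 0 * q.2 2 ^ 2 * (q.2 1)⁻¹)) • pull (o 0) q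
      + q.2 2 • pull (o 2) q + (q.2 1 * (q.2 0)⁻¹) • pull (o 3) q) q = _ :=
      ((((o' 0).smul (((s.mul (r.pow 2)).mul t').const_mul (-1 / 2))).add ((o' 2).smul r)).add
        ((o' 3).smul (t.mul s'))).eq
    rw [← lift_three] at e
    rw [e]
    funext v w
    simp only [t0, t2, t3, liftConn, liftCurv, lift_zero, lift_one, lift_two, lift_three,
      Matrix.cons_val, wedge, Pi.add_apply, Pi.sub_apply, Pi.mul_apply, Pi.smul_apply, smul_eq_mul,
      add_apply, sub_apply, smul_apply, pull, ContinuousLinearMap.comp_apply, ContinuousLinearMap.coe_fst',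
      nsmul_eq_mul]
    push_cast
    field_simp
    ring

theorem curvatureEquations_lift (hq : q.2 ∈ params)
    (ho : ∀ i, DifferentiableAt ℝ (o i) q.1) (hp : ∀ i, DifferentiableAt ℝ (p i) q.1)
    (ht : TorsionEquations o p c.A1 c.B1 c.B2 q.1) (hc : CurvatureEquations o p c q.1) :
    CurvatureEquations (lift o) (liftConn o p) (liftCurv c q.2) q := by
  obtain ⟨hs0, ht0⟩ := hq
  obtain ⟨-, t1, -, -⟩ := ht
  obtain ⟨c0, c1, c2⟩ := hc
  have o' (i : Fin 4) : HasExtD (pull (o i)) (fun v w => extD (o i) q.1 v.1 w.1) q :=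
    (hasExtD_self (ho i)).pull
  have p' (i : Fin 3) : HasExtD (pull (p i)) (fun v w => extD (p i) q.1 v.1 w.1) q :=
    (hasExtD_self (hp i)).pull
  have u' (i : Fin 3) := hasExtD_const (du i) q
  have s := hasFDerivAt_u 0 q
  have t := hasFDerivAt_u 1 q
  have r := hasFDerivAt_u 2 q
  have s' := hasFDerivAt_u_inv hs0
  have t' := hasFDerivAt_u_inv ht0
  refine ⟨?_, ?_, ?_⟩
  · have e : extD (liftConn o p 0) q = _ :=
      (((((u' 0).smul s').add ((u' 1).smul t')).add (p' 0)).sub ((o' 1).smul ((s.mul r).mul t'))).eq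
    rw [e]
    funext v w
    simp only [c0, t1, liftConn, liftCurv, lift_zero, lift_one, lift_two, lift_three,
      Matrix.cons_val, wedge, Pi.add_apply, Pi.sub_apply, Pi.mul_apply, Pi.smul_apply, smul_eq_mul,
      add_apply, sub_apply, smul_apply, pull, ContinuousLinearMap.comp_apply, ContinuousLinearMap.coe_fst',
      Pi.zero_apply]
    field_simp
    ring
  · have e : extD (liftConn o p 1) q = _ :=
      (((((((u' 1).smul (r.mul (t'.pow 2))).sub ((u' 0).smul ((r.mul s').mul t'))).sub
      ((u' 2).smul t')).sub ((p' 0).smul (r.mul t'))).add ((p' 1).smul s')).add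
      ((p' 2).smul (r.mul t'))).add
      ((o' 1).smul (((s.mul (r.pow 2)).mul (t'.pow 2)).const_mul (1 / 2))) |>.eq
    rw [e]
    funext v w
    simp only [c0, c1, c2, t1, liftConn, liftCurv, lift_zero, lift_one, lift_two, lift_three,
      Matrix.cons_val, wedge, Pi.add_apply, Pi.sub_apply, Pi.mul_apply, Pi.smul_apply, smul_eq_mul,
      add_apply, sub_apply, smul_apply, pull, ContinuousLinearMap.comp_apply, ContinuousLinearMap.coe_fst',
      Pi.zero_apply, Pi.neg_apply, nsmul_eq_mul]
    push_cast
    field_simp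
    ring
  · have e : extD (liftConn o p 2) q = _ := (((u' 1).smul t').add (p' 2)).eq
    rw [e]
    funext v w
    simp only [c2, liftCurv, lift_zero, lift_one, lift_two, lift_three, wedge, Pi.add_apply,
      Pi.neg_apply, Pi.smul_apply, smul_eq_mul, add_apply, smul_apply, pull,
      ContinuousLinearMap.comp_apply, ContinuousLinearMap.coe_fst', Pi.zero_apply]
    field_simp
    ring

end Lift

/-! ### Existence of the Cartan coframe -/

theorem isOpen_params : IsOpen params := by
  have h (i : Fin 3) : IsOpen {u : Fin 3 → ℝ | u i ≠ 0} :=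
    isOpen_ne_fun (continuous_apply i) continuous_const
  exact (h 0).inter (h 1)

theorem isOpen_bundle {U : Set J4} (hU : IsOpen U) : IsOpen (bundle U) := hU.prod isOpen_params

theorem smooth_u {W : Set P7} (i : Fin 3) : ContDiffOn ℝ ∞ (fun q : P7 => q.2 i) W :=
  (du i).contDiff.contDiffOn

section Smooth

variable {U : Set J4} {α : OneForm J4}

theorem smooth_pull (hα : ContDiffOn ℝ ∞ α U) : ContDiffOn ℝ ∞ (pull α) (bundle U) :=
  (hα.comp contDiff_fst.contDiffOn fun _ hq => hq.1).clm_comp contDiffOn_const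

theorem smooth_u_inv (i : Fin 3) (hi : i = 0 ∨ i = 1) :
    ContDiffOn ℝ ∞ (fun q : P7 => (q.2 i)⁻¹) (bundle U) := by
  refine (smooth_u i).inv fun q hq => ?_
  rcases hi with rfl | rfl
  · exact hq.2.1
  · exact hq.2.2

theorem smooth_lift {o : Fin 4 → OneForm J4} (ho : ∀ i, ContDiffOn ℝ ∞ (o i) U) (i : Fin 4) :
    ContDiffOn ℝ ∞ (lift o i) (bundle U) := by
  have o' (i : Fin 4) := smooth_pull (ho i)
  have s := smooth_u (W := bundle U) 0
  have t := smooth_u (W := bundle U) 1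
  have r := smooth_u (W := bundle U) 2
  have s' := smooth_u_inv (U := U) 0 (Or.inl rfl)
  have t' := smooth_u_inv (U := U) 1 (Or.inr rfl)
  fin_cases i
  · change ContDiffOn ℝ ∞ (lift o 0) _
    rw [lift_zero]
    exact (s.mul t).smul (o' 0)
  · change ContDiffOn ℝ ∞ (lift o 1) _
    rw [lift_one]
    exact s.smul (o' 1)
  · change ContDiffOn ℝ ∞ (lift o 2) _
    rw [lift_two]
    exact ((contDiffOn_const.mul (s.mul r)).smul (o' 0)).add (t.smul (o' 2))
  · change ContDiffOn ℝ ∞ (lift o 3) _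
    rw [lift_three]
    exact (((contDiffOn_const.mul ((s.mul (r.pow 2)).mul t')).smul (o' 0)).add
      (r.smul (o' 2))).add ((t.mul s').smul (o' 3))

theorem smooth_liftConn {o : Fin 4 → OneForm J4} {p : Fin 3 → OneForm J4}
    (ho : ∀ i, ContDiffOn ℝ ∞ (o i) U) (hp : ∀ i, ContDiffOn ℝ ∞ (p i) U) (i : Fin 3) :
    ContDiffOn ℝ ∞ (liftConn o p i) (bundle U) := by
  have o' (i : Fin 4) := smooth_pull (ho i)
  have p' (i : Fin 3) := smooth_pull (hp i)
  have u' (i : Fin 3) : ContDiffOn ℝ ∞ (fun _ : P7 => du i) (bundle U) := contDiffOn_const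
  have s := smooth_u (W := bundle U) 0
  have t := smooth_u (W := bundle U) 1
  have r := smooth_u (W := bundle U) 2
  have s' := smooth_u_inv (U := U) 0 (Or.inl rfl)
  have t' := smooth_u_inv (U := U) 1 (Or.inr rfl)
  fin_cases i
  · exact (((s'.smul (u' 0)).add (t'.smul (u' 1))).add (p' 0)).sub
      (((s.mul r).mul t').smul (o' 1))
  · exact (((((((r.mul (t'.pow 2)).smul (u' 1)).sub (((r.mul s').mul t').smul (u' 0))).sub
      (t'.smul (u' 2))).sub ((r.mul t').smul (p' 0))).add (s'.smul (p' 1))).add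
      ((r.mul t').smul (p' 2))).add
      ((contDiffOn_const.mul ((s.mul (r.pow 2)).mul (t'.pow 2))).smul (o' 1))
  · exact (t'.smul (u' 1)).add (p' 2)

end Smooth

/-- The frame of the horizontal directions at `(j, u)` that is dual to `lift o`, if `e` is dual to
`o` at `j`. -/
def liftFrame (e : Fin 4 → J4) (u : Fin 3 → ℝ) : Fin 4 → P7 :=
  ![((u 0 * u 1)⁻¹ • e 0 + (u 2 / u 1 ^ 2) • e 2 - (u 0 * u 2 ^ 2 / (2 * u 1 ^ 3)) • e 3, 0),
    ((u 0)⁻¹ • e 1, 0),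
    ((u 1)⁻¹ • e 2 - (u 0 * u 2 / u 1 ^ 2) • e 3, 0),
    ((u 0 / u 1) • e 3, 0)]

theorem lift_liftFrame {o : Fin 4 → OneForm J4} {e : Fin 4 → J4} {q : P7} (hq : q.2 ∈ params)
    (he : ∀ i k, o i q.1 (e k) = if i = k then 1 else 0) (i k : Fin 4) :
    lift o i q (liftFrame e q.2 k) = if i = k then 1 else 0 := by
  obtain ⟨hs, ht⟩ := hq
  fin_cases i <;> fin_cases k <;>
    simp [lift, matAct, hMat, Fin.sum_univ_four, liftFrame, he] <;> field_simp <;> ring_nf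

theorem linearIndependent_lift {o : Fin 4 → OneForm J4} {p : Fin 3 → OneForm J4} {e : Fin 4 → J4}
    {q : P7} (hq : q.2 ∈ params) (he : ∀ i k, o i q.1 (e k) = if i = k then 1 else 0) :
    LinearIndependent ℝ (Sum.elim (fun μ => lift o μ q) (fun i => liftConn o p i q)) := by
  obtain ⟨hs, ht⟩ := id hq
  rw [Fintype.linearIndependent_iff]
  intro g hg
  have hv (v : P7) : g (.inl 0) * lift o 0 q v + g (.inl 1) * lift o 1 q v
      + g (.inl 2) * lift o 2 q v + g (.inl 3) * lift o 3 q v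
      + (g (.inr 0) * liftConn o p 0 q v + g (.inr 1) * liftConn o p 1 q v
      + g (.inr 2) * liftConn o p 2 q v) = 0 := by
    have := DFunLike.congr_fun hg v
    simpa [Fintype.sum_sum_type, Fin.sum_univ_four, Fin.sum_univ_three] using this
  have z (i : Fin 4) (x : Fin 3 → ℝ) : lift o i q (0, x) = 0 := by
    simp [lift, matAct]
  have h2 := hv (0, Pi.single 2 1)
  have h1 := hv (0, Pi.single 1 1)
  have h0 := hv (0, Pi.single 0 1)
  simp [z, liftConn, du, pull, ht] at h2
  simp [z, liftConn, du, pull, h2, hs] at h0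
  simp [z, liftConn, du, pull, h2, h0, ht] at h1
  have hk (k : Fin 4) := hv (liftFrame e q.2 k)
  simp only [lift_liftFrame hq he, h0, h1, h2] at hk
  rintro (i | i)
  · fin_cases i
    · simpa using hk 0
    · simpa using hk 1
    · simpa using hk 2
    · simpa using hk 3
  · fin_cases i <;> assumption

theorem structureEquations_iff {W : Set P7} {θ : Fin 4 → OneForm P7} {Ω : Fin 3 → OneForm P7}
    {I : P7 → Curvature} : StructureEquations W θ Ω I ↔
      ∀ q ∈ W, TorsionEquations θ Ω (I q).A1 (I q).B1 (I q).B2 q ∧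
        CurvatureEquations θ Ω (I q) q := by
  refine forall₂_congr fun q _ => ?_
  simp only [TorsionEquations, CurvatureEquations, and_assoc]

/-- The Cartan coframe of `F`. -/
theorem IsAdmissible.isCartanCoframe {U : Set J4} {F : J4 → ℝ} (h : IsAdmissible U F) :
    IsCartanCoframe (bundle U) (lift (omega F)) (liftConn (omega F) (conn F))
      (fun q => liftCurv (baseCurv F q.1) q.2) where
  smooth_theta := smooth_lift h.smooth_omega
  smooth_Omega := smooth_liftConn h.smooth_omega h.smooth_conn
  linearIndependent q hq := linearIndependent_lift hq.2 (h.omega_frame hq.1)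
  structureEquations := by
    rw [structureEquations_iff]
    intro q hq
    have d (i : Fin 4) := differentiableAt_of_smooth h.isOpen (h.smooth_omega i) hq.1
    have d' (i : Fin 3) := differentiableAt_of_smooth h.isOpen (h.smooth_conn i) hq.1
    exact ⟨torsionEquations_lift hq.2 d (h.torsionEquations hq.1),
      curvatureEquations_lift hq.2 d d' (h.torsionEquations hq.1) (h.curvatureEquations hq.1).1⟩

/-! ### Uniqueness of the connection forms and of the curvature invariants -/

section Uniqueness

variable {E : Type} [NormedAddCommGroup E] [NormedSpace ℝ E]

/-- The torsion equations determine the connection forms and the torsion coefficients. -/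
theorem TorsionEquations.unique {o : Fin 4 → OneForm E} {p p' : Fin 3 → OneForm E}
    {a b c a' b' c' : ℝ} {q : E} (e : Fin 4 → E)
    (he : ∀ i k, o i q (e k) = if i = k then 1 else 0)
    (h : TorsionEquations o p a b c q) (h' : TorsionEquations o p' a' b' c' q) :
    (∀ i, p i q = p' i q) ∧ a = a' ∧ b = b' ∧ c = c' := by
  have E0 (v w : E) := congrFun₂ (h.1.symm.trans h'.1) v w
  have E1 (v w : E) := congrFun₂ (h.2.1.symm.trans h'.2.1) v w
  have E2 (v w : E) := congrFun₂ (h.2.2.1.symm.trans h'.2.2.1) v w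
  have E3 (v w : E) := congrFun₂ (h.2.2.2.symm.trans h'.2.2.2) v w
  simp only [wedge, Pi.add_apply, Pi.sub_apply, Pi.smul_apply, smul_eq_mul, sub_apply,
    smul_apply] at E0 E1 E2 E3
  have f0 (v : E) := E0 v (e 0)
  have f1 (v : E) := E1 v (e 1)
  have f2 (v : E) := E2 v (e 2)
  have f3 (v : E) := E2 v (e 0)
  have g1 := E3 (e 0) (e 3)
  have g2 := E3 (e 0) (e 2)
  have g3 := E3 (e 0) (e 1)
  have g4 := E1 (e 0) (e 2)
  have g5 := E1 (e 0) (e 3)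
  simp only [he] at f0 f1 f2 f3 g1 g2 g3 g4 g5
  simp only [Fin.reduceEq, ↓reduceIte] at f0 f1 f2 f3 g1 g2 g3 g4 g5
  have k0 (k : Fin 4) := f0 (e k)
  have k1 (k : Fin 4) := f1 (e k)
  have k2 (k : Fin 4) := f2 (e k)
  have k3 (k : Fin 4) := f3 (e k)
  simp only [he] at k0 k1 k2 k3
  have k01 := k0 1; have k02 := k0 2; have k03 := k0 3
  have k10 := k1 0; have k12 := k1 2; have k13 := k1 3
  have k20 := k2 0; have k21 := k2 1; have k23 := k2 3
  have k31 := k3 1; have k32 := k3 2; have k33 := k3 3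
  simp only [Fin.reduceEq, ↓reduceIte] at k01 k02 k03 k10 k12 k13 k20 k21 k23 k31 k32 k33
  clear k0 k1 k2 k3 E0 E1 E2 E3
  ring_nf at k01 k02 k03 k10 k12 k13 k20 k21 k23 k31 k32 k33 g1 g2 g3 g4 g5
  have z00 : p 0 q (e 0) = p' 0 q (e 0) := by linarith
  have z0 (v : E) : p 0 q v = p' 0 q v := by
    have := f0 v
    rw [z00] at this
    linarith
  have z20 : p 2 q (e 0) = p' 2 q (e 0) := by linarith
  have z21 : p 2 q (e 1) = p' 2 q (e 1) := by linarith
  have z2 (v : E) : p 2 q v = p' 2 q v := by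
    have := f1 v
    rw [z0 (e 1), z21, z0 v] at this
    linarith
  have z10 : p 1 q (e 0) = p' 1 q (e 0) := by linarith
  have z1 (v : E) : p 1 q v = p' 1 q v := by
    have := f3 v
    rw [z10, z20, z2 v] at this
    linarith
  refine ⟨fun i => ?_, ?_, ?_, ?_⟩
  · ext v
    fin_cases i
    · exact z0 v
    · exact z1 v
    · exact z2 v
  · have := z2 (e 1); have := z0 (e 1); have := z1 (e 1); linarith
  · have := z2 (e 2); have := z0 (e 2); linarith
  · have := z2 (e 3); have := z0 (e 3); linarith

/-- The curvature equations determine the curvature invariants. -/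
theorem CurvatureEquations.unique {o : Fin 4 → OneForm E} {p p' : Fin 3 → OneForm E}
    {c c' : Curvature} {q : E} (e : Fin 4 → E)
    (he : ∀ i k, o i q (e k) = if i = k then 1 else 0)
    (hp : ∀ i, p i =ᶠ[nhds q] p' i)
    (ht : TorsionEquations o p c.A1 c.B1 c.B2 q) (ht' : TorsionEquations o p' c'.A1 c'.B1 c'.B2 q)
    (h : CurvatureEquations o p c q) (h' : CurvatureEquations o p' c' q) : c = c' := by
  obtain ⟨-, hA1, hB1, hB2⟩ := ht.unique e he ht'
  have E0 (v w : E) := congrFun₂ (h.1.symm.trans ((extD_congr (hp 0)).trans h'.1)) v w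
  have E1 (v w : E) := congrFun₂ (h.2.1.symm.trans ((extD_congr (hp 1)).trans h'.2.1)) v w
  have E2 (v w : E) := congrFun₂ (h.2.2.symm.trans ((extD_congr (hp 2)).trans h'.2.2)) v w
  simp only [wedge, Pi.add_apply, Pi.sub_apply, Pi.neg_apply, Pi.smul_apply, smul_eq_mul, sub_apply,
    (hp 0).eq_of_nhds, (hp 1).eq_of_nhds, (hp 2).eq_of_nhds] at E0 E1 E2
  have e00 := E0 (e 0) (e 1)
  have e11 := E1 (e 0) (e 1)
  have e12 := E1 (e 0) (e 2)
  have e13 := E1 (e 0) (e 3)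
  have e21 := E2 (e 0) (e 1)
  have e22 := E2 (e 0) (e 2)
  have e23 := E2 (e 0) (e 3)
  simp only [he] at e00 e11 e12 e13 e21 e22 e23
  simp only [Fin.reduceEq, ↓reduceIte] at e00 e11 e12 e13 e21 e22 e23
  cases c
  cases c'
  simp only [Curvature.mk.injEq] at *
  refine ⟨?_, ?_, ?_, ?_, ?_, ?_, ?_, ?_, ?_, ?_⟩ <;> linarith

/-- On every open part of the bundle, the structure equations determine the connection forms and the
curvature invariants. -/
theorem IsAdmissible.cartanCoframe_unique {U : Set J4} {F : J4 → ℝ} (h : IsAdmissible U F)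
    {W : Set P7} (hW : IsOpen W) (hWU : W ⊆ bundle U)
    {Ω Ω' : Fin 3 → OneForm P7} {I I' : P7 → Curvature}
    (h1 : StructureEquations W (lift (omega F)) Ω I)
    (h2 : StructureEquations W (lift (omega F)) Ω' I') :
    ∀ q ∈ W, (∀ i, Ω' i q = Ω i q) ∧ I' q = I q := by
  rw [structureEquations_iff] at h1 h2
  have he (q : P7) (hq : q ∈ W) := lift_liftFrame (hWU hq).2 (h.omega_frame (hWU hq).1)
  have hu (q : P7) (hq : q ∈ W) := (h2 q hq).1.unique _ (he q hq) (h1 q hq).1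
  intro q hq
  exact ⟨(hu q hq).1, (h2 q hq).2.unique _ (he q hq)
    (fun i => Filter.eventuallyEq_of_mem (hW.mem_nhds hq) fun x hx => (hu x hx).1 i)
    (h2 q hq).1 (h1 q hq).1 (h1 q hq).2⟩

end Uniqueness

/-! ### Uniqueness of the reduction -/

section Pullback

variable {E E' : Type} [NormedAddCommGroup E] [NormedSpace ℝ E] [NormedAddCommGroup E']
  [NormedSpace ℝ E']

/-- The pullback `φ* α`. -/
def formPullback (φ : E → E') (α : OneForm E') : OneForm E := fun x => (α (φ x)).comp (fderiv ℝ φ x)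

theorem TorsionEquations.pullback {φ : E → E'} {q : E} {o : Fin 4 → OneForm E'}
    {p : Fin 3 → OneForm E'} {a b c : ℝ} (hφ : ContDiffAt ℝ 2 φ q)
    (ho : ∀ i, DifferentiableAt ℝ (o i) (φ q)) (h : TorsionEquations o p a b c (φ q)) :
    TorsionEquations (fun i => formPullback φ (o i)) (fun i => formPullback φ (p i)) a b c q := by
  obtain ⟨h0, h1, h2, h3⟩ := h
  refine ⟨?_, ?_, ?_, ?_⟩ <;> funext v w <;> unfold formPullback <;>
    rw [extD_pullback hφ (ho _)] <;> simp only [h0, h1, h2, h3] <;> rfl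

theorem CurvatureEquations.pullback {φ : E → E'} {q : E} {o : Fin 4 → OneForm E'}
    {p : Fin 3 → OneForm E'} {c : Curvature} (hφ : ContDiffAt ℝ 2 φ q)
    (hp : ∀ i, DifferentiableAt ℝ (p i) (φ q)) (h : CurvatureEquations o p c (φ q)) :
    CurvatureEquations (fun i => formPullback φ (o i)) (fun i => formPullback φ (p i)) c q := by
  obtain ⟨h0, h1, h2⟩ := h
  refine ⟨?_, ?_, ?_⟩ <;> funext v w <;> unfold formPullback <;>
    rw [extD_pullback hφ (hp _)] <;> simp only [h0, h1, h2] <;> rfl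

theorem TorsionEquations.congr_form {q : E} {o o' : Fin 4 → OneForm E}
    {p : Fin 3 → OneForm E} {a b c : ℝ} (h : TorsionEquations o p a b c q)
    (e : ∀ i, o' i =ᶠ[nhds q] o i) : TorsionEquations o' p a b c q := by
  simp only [TorsionEquations, extD_congr (e _), (e _).eq_of_nhds]
  exact h

theorem CurvatureEquations.congr_form {q : E} {o o' : Fin 4 → OneForm E}
    {p : Fin 3 → OneForm E} {c : Curvature} (h : CurvatureEquations o p c q)
    (e : ∀ i, o' i =ᶠ[nhds q] o i) : CurvatureEquations o' p c q := by
  simp only [CurvatureEquations, (e _).eq_of_nhds]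
  exact h

end Pullback

/-- The pullback of `lift α` by the section `u` of the bundle is `h(u) α`. -/
theorem formPullback_section_lift (α : Fin 4 → OneForm J4) {u : J4 → Fin 3 → ℝ} {j : J4}
    (hu : DifferentiableAt ℝ u j) (i : Fin 4) :
    formPullback (fun x => (x, u x)) (lift α i) j = matAct (hMat (u j)) (fun k => α k j) i := by
  have h : fderiv ℝ (fun x => (x, u x)) j = (ContinuousLinearMap.id ℝ J4).prod (fderiv ℝ u j) :=
    ((hasFDerivAt_id j).prodMk hu.hasFDerivAt).fderiv
  ext v
  simp [formPullback, h, lift, matAct]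

/-- The torsion equations for the coframe `h(u) α` on the jet space, if those for `lift α` hold on
the bundle. -/
theorem torsionEquations_section {V : Set J4} (hV : IsOpen V) {α : Fin 4 → OneForm J4}
    (hα : ∀ i, ContDiffOn ℝ ∞ (α i) V) {Ω : Fin 3 → OneForm P7} {I : P7 → Curvature}
    (h : StructureEquations (bundle V) (lift α) Ω I) {u : J4 → Fin 3 → ℝ}
    (hu : ContDiffOn ℝ ∞ u V) (hup : ∀ j ∈ V, u j ∈ params) :
    ∃ (p : Fin 3 → OneForm J4) (a b c : J4 → ℝ), ∀ j ∈ V,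
      TorsionEquations (fun i x => matAct (hMat (u x)) (fun k => α k x) i) p (a j) (b j) (c j)
        j := by
  refine ⟨fun i => formPullback (fun x => (x, u x)) (Ω i), fun j => (I (j, u j)).A1,
    fun j => (I (j, u j)).B1, fun j => (I (j, u j)).B2, fun j hj => ?_⟩
  have hq : (j, u j) ∈ bundle V := ⟨hj, hup j hj⟩
  have hs : ContDiffAt ℝ 2 (fun x => (x, u x)) j :=
    contDiffAt_id.prodMk ((hu.contDiffAt (hV.mem_nhds hj)).of_le (WithTop.coe_le_coe.2 le_top))
  refine (TorsionEquations.pullback hs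
    (fun i => differentiableAt_of_smooth (isOpen_bundle hV) (smooth_lift hα i) hq)
    ((structureEquations_iff.1 h) _ hq).1).congr_form fun i => ?_
  refine Filter.eventuallyEq_of_mem (hV.mem_nhds hj) fun x hx => ?_
  exact (formPullback_section_lift α (differentiableAt_of_smooth hV hu hx) i).symm

section Reduction

variable {U V : Set J4} {F : J4 → ℝ}

/-- Among the coframes that differ from the adapted one by a unipotent matrix transverse to `H₃`,
only the adapted coframe itself satisfies the torsion equations. -/
theorem IsAdmissible.unipotent_eq_zero (h : IsAdmissible U F) (hV : IsOpen V) (hVU : V ⊆ U)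
    {s t r : J4 → ℝ} (hs : ContDiffOn ℝ ∞ s V) (ht : ContDiffOn ℝ ∞ t V) (hr : ContDiffOn ℝ ∞ r V)
    {β : Fin 4 → OneForm J4} (b0 : ∀ j ∈ V, β 0 j = omega F 0 j)
    (b1 : ∀ j ∈ V, β 1 j = omega F 1 j + s j • omega F 0 j)
    (b2 : ∀ j ∈ V, β 2 j = omega F 2 j + t j • omega F 0 j)
    (b3 : ∀ j ∈ V, β 3 j = omega F 3 j + r j • omega F 0 j)
    {p : Fin 3 → OneForm J4} {a b c : J4 → ℝ}
    (hT : ∀ j ∈ V, TorsionEquations β p (a j) (b j) (c j) j) :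
    ∀ j ∈ V, s j = 0 ∧ t j = 0 ∧ r j = 0 := by
  have dd {f : J4 → ℝ} (hf : ContDiffOn ℝ ∞ f V) {j : J4} (hj : j ∈ V) :
      HasFDerivAt f (fderiv ℝ f j) j := (differentiableAt_of_smooth hV hf hj).hasFDerivAt
  have o {j : J4} (hj : j ∈ V) (i : Fin 4) : HasExtD (omega F i) (extD (omega F i) j) j :=
    hasExtD_self (differentiableAt_of_smooth h.isOpen (h.smooth_omega i) (hVU hj))
  have ev {f g : OneForm J4} (e : ∀ j ∈ V, f j = g j) {j : J4} (hj : j ∈ V) : f =ᶠ[nhds j] g :=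
    Filter.eventuallyEq_of_mem (hV.mem_nhds hj) e
  -- The vanishing of `t` on all of `V` comes first, since then its derivative drops out of `dβ³`.
  have htz : ∀ j ∈ V, t j = 0 := by
    intro j hj
    obtain ⟨t0, t1, t2, t3⟩ := hT j hj
    obtain ⟨u0, u1, u2, u3⟩ := h.torsionEquations (hVU hj)
    rw [((o hj 0).congr_form (ev b0 hj)).eq] at t0
    rw [(((o hj 1).add ((o hj 0).smul (dd hs hj))).congr_form (ev b1 hj)).eq] at t1
    rw [(((o hj 2).add ((o hj 0).smul (dd ht hj))).congr_form (ev b2 hj)).eq] at t2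
    rw [(((o hj 3).add ((o hj 0).smul (dd hr hj))).congr_form (ev b3 hj)).eq] at t3
    have w := h.omega_frame (hVU hj)
    have c1 := congrFun₂ t0 (frame F 0 j) (frame F 1 j)
    have c3 := congrFun₂ t2 (frame F 1 j) (frame F 2 j)
    have c4 := congrFun₂ t3 (frame F 1 j) (frame F 3 j)
    simp only [u0, u2, u3, b0 j hj, b1 j hj, b2 j hj, b3 j hj, wedge, Pi.add_apply,
      Pi.sub_apply, Pi.smul_apply, smul_eq_mul, add_apply, sub_apply, smul_apply, w] at c1 c3 c4
    simp only [Fin.reduceEq, ↓reduceIte] at c1 c3 c4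
    linarith
  intro j hj
  obtain ⟨t0, t1, t2, t3⟩ := hT j hj
  obtain ⟨u0, u1, u2, u3⟩ := h.torsionEquations (hVU hj)
  have b2' : ∀ j ∈ V, β 2 j = omega F 2 j := fun j hj => by rw [b2 j hj, htz j hj]; simp
  rw [((o hj 0).congr_form (ev b0 hj)).eq] at t0
  rw [(((o hj 1).add ((o hj 0).smul (dd hs hj))).congr_form (ev b1 hj)).eq] at t1
  rw [((o hj 2).congr_form (ev b2' hj)).eq] at t2
  rw [(((o hj 3).add ((o hj 0).smul (dd hr hj))).congr_form (ev b3 hj)).eq] at t3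
  have w := h.omega_frame (hVU hj)
  have c1 := congrFun₂ t0 (frame F 0 j) (frame F 2 j)
  have c2 := congrFun₂ t1 (frame F 1 j) (frame F 2 j)
  have c3 := congrFun₂ t3 (frame F 1 j) (frame F 2 j)
  have c4 := congrFun₂ t3 (frame F 2 j) (frame F 3 j)
  have c5 := congrFun₂ t2 (frame F 0 j) (frame F 1 j)
  have c6 := congrFun₂ t2 (frame F 0 j) (frame F 3 j)
  simp only [u0, u1, u2, u3, b0 j hj, b1 j hj, b2' j hj, b3 j hj, wedge, Pi.add_apply,
    Pi.sub_apply, Pi.smul_apply, smul_eq_mul, add_apply, sub_apply, smul_apply, w]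
    at c1 c2 c3 c4 c5 c6
  simp only [Fin.reduceEq, ↓reduceIte] at c1 c2 c3 c4 c5 c6
  refine ⟨by linarith, htz j hj, by linarith⟩

theorem smooth_modify {g : J4 → Matrix (Fin 4) (Fin 4) ℝ} {α : Fin 4 → OneForm J4}
    (hg : ∀ i k, ContDiffOn ℝ ∞ (fun j => g j i k) U) (hα : ∀ i, ContDiffOn ℝ ∞ (α i) U)
    (i : Fin 4) : ContDiffOn ℝ ∞ (modify g α i) U := by
  change ContDiffOn ℝ ∞ (fun j => ∑ k, g j i k • α k j) U
  exact ContDiffOn.sum (f := fun k j => g j i k • α k j) fun k _ => (hg i k).smul (hα k)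

/-- If a coframe in the class of the initial one lifts to a coframe with the structure equations,
then its matrix with respect to the adapted coframe lies in `H₃`. The first and the third equation
on the section `h = 1` fix the diagonal of the matrix up to two parameters; on the section where
the matrix has become unipotent, `unipotent_eq_zero` disposes of its remaining entries. -/
theorem IsAdmissible.mem_H3 (h : IsAdmissible U F) (hV : IsOpen V) (hVU : V ⊆ U)
    {g : J4 → Matrix (Fin 4) (Fin 4) ℝ} (hg : ∀ i k, ContDiffOn ℝ ∞ (fun j => g j i k) V)
    (hG : ∀ j ∈ V, IsParaCRMatrix (g j)) {Ω : Fin 3 → OneForm P7} {I : P7 → Curvature}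
    (hC : StructureEquations (bundle V) (lift (modify g (omega0 F))) Ω I) :
    ∃ κ : J4 → Fin 3 → ℝ, ContDiffOn ℝ ∞ κ V ∧ ∀ j ∈ V, κ j ∈ params ∧
      ∀ i, modify g (omega0 F) i j = matAct (hMat (κ j)) (fun k => omega F k j) i := by
  set α := modify g (omega0 F) with hα
  have αs (i : Fin 4) : ContDiffOn ℝ ∞ (α i) V :=
    smooth_modify hg (fun i => (smooth_omega0 h.smooth i).mono hVU) i
  -- The matrix of `α` with respect to the adapted coframe.
  set k : Fin 4 → Fin 4 → J4 → ℝ := fun i l j => α i j (frame F l j) with hk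
  have ks (i l : Fin 4) : ContDiffOn ℝ ∞ (k i l) V :=
    (αs i).clm_apply ((h.smooth_frame l).mono hVU)
  have hαk : ∀ j ∈ V, ∀ i, α i j = k i 0 j • omega F 0 j + k i 1 j • omega F 1 j
      + k i 2 j • omega F 2 j + k i 3 j • omega F 3 j := by
    intro j hj i
    ext v
    conv_lhs => rw [h.eq_sum_frame (hVU hj) v]
    simp [hk, mul_comm]
  have kz : ∀ j ∈ V, k 0 0 j ≠ 0 ∧ k 0 1 j = 0 ∧ k 0 2 j = 0 ∧ k 0 3 j = 0 ∧ k 1 2 j = 0 ∧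
      k 1 3 j = 0 ∧ k 2 1 j = 0 ∧ k 3 1 j = 0 := by
    intro j hj
    obtain ⟨hd, g01, g02, g03, g12, g13, g21, g31⟩ := hG j hj
    have h2 := h.Fpp_ne_zero j (hVU hj)
    have g00 : g j 0 0 ≠ 0 := by
      intro hz
      refine hd (Matrix.det_eq_zero_of_row_eq_zero 0 fun i => ?_)
      fin_cases i <;> assumption
    have e : k 0 0 j = g j 0 0 := by
      simp [hk, hα, modify, matAct, Fin.sum_univ_four, g01, g02, g03, omega0, dcoord, frame, vp,
        vD, vDelta]
      ring
    refine ⟨e ▸ g00, ?_, ?_, ?_, ?_, ?_, ?_, ?_⟩ <;>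
      simp [hk, hα, modify, matAct, Fin.sum_univ_four, g01, g02, g03, g12, g13, g21, g31, omega0,
        dcoord, frame, vp, vD, vDelta]
    all_goals
      right
      ring
  have dd (i l : Fin 4) {j : J4} (hj : j ∈ V) :
      HasFDerivAt (k i l) (fderiv ℝ (k i l) j) j :=
    (differentiableAt_of_smooth hV (ks i l) hj).hasFDerivAt
  have o {j : J4} (hj : j ∈ V) (i : Fin 4) : HasExtD (omega F i) (extD (omega F i) j) j :=
    hasExtD_self (differentiableAt_of_smooth h.isOpen (h.smooth_omega i) (hVU hj))
  have ev {f g : OneForm J4} (e : ∀ j ∈ V, f j = g j) {j : J4} (hj : j ∈ V) : f =ᶠ[nhds j] g :=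
    Filter.eventuallyEq_of_mem (hV.mem_nhds hj) e
  -- The equations on the section `h = 1`: `u₆ = 0`, and the relations between the diagonal entries.
  have diag : ∀ j ∈ V, k 2 3 j = 0 ∧ k 0 0 j = k 1 1 j * k 2 2 j ∧
      k 2 2 j = k 1 1 j * k 3 3 j := by
    obtain ⟨p, a, b, c, hT⟩ := torsionEquations_section hV αs hC (u := fun _ => ![1, 1, 0])
      contDiffOn_const (fun j _ => ⟨by simp, by simp⟩)
    have hT' : ∀ j ∈ V, TorsionEquations α p (a j) (b j) (c j) j := by
      intro j hj
      refine (hT j hj).congr_form fun i => Filter.Eventually.of_forall fun x => ?_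
      rw [hMat_one]
      simp [matAct, Matrix.one_apply]
    have e {j : J4} (hj : j ∈ V) (i : Fin 4) := (((((o hj 0).smul (dd i 0 hj)).add
      ((o hj 1).smul (dd i 1 hj))).add ((o hj 2).smul (dd i 2 hj))).add
      ((o hj 3).smul (dd i 3 hj))).congr_form (ev (fun j hj => hαk j hj i) hj) |>.eq
    have dz (i l : Fin 4) (hz : ∀ j ∈ V, k i l j = 0) {j : J4} (hj : j ∈ V) :
        fderiv ℝ (k i l) j = 0 := by
      rw [(Filter.eventuallyEq_of_mem (hV.mem_nhds hj) hz : k i l =ᶠ[nhds j] fun _ => 0).fderiv_eq]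
      simp
    have v (j : J4) (i l : Fin 4) : α i j (frame F l j) = k i l j := rfl
    have first : ∀ j ∈ V, k 0 0 j = k 1 1 j * k 2 2 j ∧ k 2 3 j = 0 := by
      intro j hj
      obtain ⟨z00, z01, z02, z03, z12, z13, z21, z31⟩ := kz j hj
      have t0 := (hT' j hj).1
      obtain ⟨u0, u1, u2, u3⟩ := h.torsionEquations (hVU hj)
      rw [e hj] at t0
      have w := h.omega_frame (hVU hj)
      have d01 := dz 0 1 (fun j hj => (kz j hj).2.1) hj
      have d02 := dz 0 2 (fun j hj => (kz j hj).2.2.1) hj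
      have d03 := dz 0 3 (fun j hj => (kz j hj).2.2.2.1) hj
      have c1 := congrFun₂ t0 (frame F 1 j) (frame F 2 j)
      have c2 := congrFun₂ t0 (frame F 1 j) (frame F 3 j)
      simp only [u0, u1, u2, u3, wedge, Pi.add_apply, d01, d02, d03, zero_apply,
        Pi.sub_apply, Pi.smul_apply, smul_eq_mul, sub_apply, v, w, z01, z02, z03, z12, z13,
        z21] at c1 c2
      simp only [Fin.reduceEq, ↓reduceIte] at c1 c2
      have c1' : k 0 0 j = k 1 1 j * k 2 2 j := by linarith
      have c2' : k 1 1 j * k 2 3 j = 0 := by linarith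
      have h11 : k 1 1 j ≠ 0 := left_ne_zero_of_mul (c1' ▸ z00)
      exact ⟨c1', (mul_eq_zero.1 c2').resolve_left h11⟩
    intro j hj
    obtain ⟨z00, z01, z02, z03, z12, z13, z21, z31⟩ := kz j hj
    obtain ⟨f1, f2⟩ := first j hj
    refine ⟨f2, f1, ?_⟩
    have t2 := (hT' j hj).2.2.1
    obtain ⟨u0, u1, u2, u3⟩ := h.torsionEquations (hVU hj)
    rw [e hj] at t2
    have w := h.omega_frame (hVU hj)
    have d21 := dz 2 1 (fun j hj => (kz j hj).2.2.2.2.2.2.1) hj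
    have d23 := dz 2 3 (fun j hj => (first j hj).2) hj
    have c3 := congrFun₂ t2 (frame F 1 j) (frame F 3 j)
    simp only [u0, u1, u2, u3, wedge, Pi.add_apply, d21, d23, zero_apply,
      Pi.sub_apply, Pi.smul_apply, smul_eq_mul, sub_apply, v, w, z01, z03, z13, z21,
      f2] at c3
    simp only [Fin.reduceEq, ↓reduceIte] at c3
    linarith
  have h11 : ∀ j ∈ V, k 1 1 j ≠ 0 := fun j hj =>
    left_ne_zero_of_mul ((diag j hj).2.1 ▸ (kz j hj).1)
  have h22 : ∀ j ∈ V, k 2 2 j ≠ 0 := fun j hj =>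
    right_ne_zero_of_mul ((diag j hj).2.1 ▸ (kz j hj).1)
  set κ : J4 → Fin 3 → ℝ := fun j => ![k 1 1 j, k 2 2 j, k 3 2 j] with hκ
  have κp : ∀ j ∈ V, κ j ∈ params := fun j hj => ⟨h11 j hj, h22 j hj⟩
  have κs : ContDiffOn ℝ ∞ κ V := by
    rw [contDiffOn_pi]
    intro i
    fin_cases i
    exacts [ks 1 1, ks 2 2, ks 3 2]
  have κi : ContDiffOn ℝ ∞ (fun j => hInv (κ j)) V := by
    rw [contDiffOn_pi]
    intro i
    fin_cases i
    · exact (ks 1 1).inv h11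
    · exact (ks 2 2).inv h22
    · exact (((ks 1 1).mul (ks 3 2)).div ((ks 2 2).pow 2)
        fun j hj => pow_ne_zero 2 (h22 j hj)).neg
  obtain ⟨p, a, b, c, hT⟩ := torsionEquations_section hV αs hC κi (fun j hj => hInv_mem (κp j hj))
  -- The entries of the first column of `h(κ)⁻¹ k`, where `k` is the matrix of `α`.
  have key := h.unipotent_eq_zero hV hVU (s := fun j => k 1 0 j / k 1 1 j)
    (t := fun j => (k 1 1 j * k 3 2 j + k 2 0 j) / k 2 2 j)
    (r := fun j => k 1 1 j / k 2 2 j * k 3 0 j - k 1 1 j * k 3 2 j * k 2 0 j / k 2 2 j ^ 2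
      - k 1 1 j ^ 2 * k 3 2 j ^ 2 / (2 * k 2 2 j ^ 2))
    ((ks 1 0).div (ks 1 1) h11)
    ((((ks 1 1).mul (ks 3 2)).add (ks 2 0)).div (ks 2 2) h22)
    (((((ks 1 1).div (ks 2 2) h22).mul (ks 3 0)).sub
      ((((ks 1 1).mul (ks 3 2)).mul (ks 2 0)).div ((ks 2 2).pow 2)
        fun j hj => pow_ne_zero 2 (h22 j hj))).sub
      ((((ks 1 1).pow 2).mul ((ks 3 2).pow 2)).div (contDiffOn_const.mul ((ks 2 2).pow 2))
        fun j hj => mul_ne_zero two_ne_zero (pow_ne_zero 2 (h22 j hj))))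
    ?_ ?_ ?_ ?_ hT
  · refine ⟨κ, κs, fun j hj => ⟨κp j hj, ?_⟩⟩
    obtain ⟨s0, t0, r0⟩ := key j hj
    obtain ⟨z00, z01, z02, z03, z12, z13, z21, z31⟩ := kz j hj
    obtain ⟨z23, d0, d2⟩ := diag j hj
    have e11 := h11 j hj
    have e22 := h22 j hj
    have k10 : k 1 0 j = 0 := by simpa [e11] using s0
    have k20 : k 2 0 j = -(k 1 1 j * k 3 2 j) := by
      rw [div_eq_zero_iff] at t0
      linarith [t0.resolve_right e22]
    have k33 : k 3 3 j = k 2 2 j / k 1 1 j := by rw [eq_div_iff e11, d2]; ring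
    have k30 : k 3 0 j = -(k 1 1 j * k 3 2 j ^ 2 / (2 * k 2 2 j)) := by
      simp only [k20] at r0
      field_simp at r0 ⊢
      refine mul_left_cancel₀ e11 ?_
      linarith
    intro i
    rw [hαk j hj i]
    fin_cases i <;>
      simp [matAct, hMat, Fin.sum_univ_four, hκ, z01, z02, z03, z12, z13, z21, z31, z23, d0, k10,
        k20, k30, k33]
  all_goals
    intro j hj
    obtain ⟨z00, z01, z02, z03, z12, z13, z21, z31⟩ := kz j hj
    obtain ⟨z23, d0, d2⟩ := diag j hj
    have e11 := h11 j hj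
    have e22 := h22 j hj
    have k33 : k 3 3 j = k 2 2 j / k 1 1 j := by rw [eq_div_iff e11, d2]; ring
    ext v
    simp [matAct, hMat, hInv, Fin.sum_univ_four, hκ, hαk j hj, z01, z02, z03, z12, z13, z21, z31,
      z23, d0, k33]
    field_simp
    try ring

end Reduction

namespace IsAdmissible

variable {U : Set J4} {F : J4 → ℝ}

/-- The invariants `A₁` and `C₁` on the bundle. -/
theorem liftCurv_baseCurv (h : IsAdmissible U F) {q : P7} (hq : q ∈ bundle U) :
    (liftCurv (baseCurv F q.1) q.2).A1
        = -(1 / 54) * (1 / q.2 0 ^ 3) * (monge F q.1 / dp 2 F q.1 ^ 3) ∧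
      (liftCurv (baseCurv F q.1) q.2).C1
        = 1 / 3 * (1 / (q.2 0 ^ 2 * q.2 1)) * (invK F q.1 / dp 2 F q.1 ^ 5) := by
  simp only [liftCurv, h.baseCurv_A1 hq.1, h.baseCurv_C1 hq.1]
  constructor <;> ring

/-- The adapted coframe is obtained from the initial one by a matrix of the structure group. -/
theorem exists_modify_eq_omega (h : IsAdmissible U F) :
    ∃ g : J4 → Matrix (Fin 4) (Fin 4) ℝ, (∀ i k, ContDiffOn ℝ ∞ (fun j => g j i k) U) ∧
      ∀ j ∈ U, IsParaCRMatrix (g j) ∧ ∀ i, modify g (omega0 F) i j = omega F i j := by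
  have d (n : ℕ) := smooth_dp h.isOpen h.smooth n
  refine ⟨fun j => !![1, 0, 0, 0; -cB F j, 1, 0, 0; -cA F j, 0, 1, dp 1 F j;
    cC F j, 0, 0, dp 2 F j], fun i k => ?_, fun j hj => ⟨⟨?_, ?_⟩, fun i => ?_⟩⟩
  · fin_cases i <;> fin_cases k
    all_goals first
      | exact contDiffOn_const
      | exact h.smooth_cA.neg
      | exact h.smooth_cB.neg
      | exact h.smooth_cC
      | exact d 1
      | exact d 2
  · simp [Matrix.det_succ_row_zero, Fin.sum_univ_succ, h.Fpp_ne_zero j hj]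
  · simp
  · fin_cases i <;>
      simp [modify, matAct, Fin.sum_univ_four, omega, cA, cB, cC] <;> module

/-- A coframe for which the structure equations hold differs from the adapted one by an element
of `H₃`. -/
theorem exists_mem_H3 (h : IsAdmissible U F) {V : Set J4} (hV : IsOpen V) (hVU : V ⊆ U)
    {g : J4 → Matrix (Fin 4) (Fin 4) ℝ} (hg : ∀ i k, ContDiffOn ℝ ∞ (fun j => g j i k) V)
    (hG : ∀ j ∈ V, IsParaCRMatrix (g j)) {Ω : Fin 3 → OneForm P7} {I : P7 → Curvature}
    (hC : IsCartanCoframe (bundle V) (lift (modify g (omega0 F))) Ω I) {j : J4} (hj : j ∈ V) :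
    ∃ h ∈ H3, ∀ i,
      modify g (omega0 F) i j = matAct (h : Matrix (Fin 4) (Fin 4) ℝ) (fun k => omega F k j) i := by
  obtain ⟨κ, -, hκ⟩ := h.mem_H3 hV hVU hg hG hC.structureEquations
  obtain ⟨hp, e⟩ := hκ j hj
  exact ⟨⟨hMat (κ j), hMat (hInv (κ j)), mul_eq_one_comm.1 (hMat_hInv hp), hMat_hInv hp⟩,
    ⟨κ j, hp, rfl⟩, e⟩

end IsAdmissible

/-! ### Dependence of the invariants on finite jets -/

/-- The pairs of functions obtained from the pair `F`, `F'` by the same sequence of operations: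
constants, sums, products, inverses of functions without zeros, and at most `n` successive partial
derivatives with respect to `y`, `z` and `p`. The derivative with respect to `x` is left out, since
`D` serves in its place, so that the coordinate `p` is not needed as a coefficient. -/
inductive JetPair (U U' : Set J4) (F F' : J4 → ℝ) : ℕ → (J4 → ℝ) → (J4 → ℝ) → Prop
  | base (n : ℕ) : JetPair U U' F F' n F F'
  | const (n : ℕ) (c : ℝ) : JetPair U U' F F' n (fun _ => c) (fun _ => c)
  | add {n : ℕ} {f f' g g' : J4 → ℝ} : JetPair U U' F F' n f f' → JetPair U U' F F' n g g' →
      JetPair U U' F F' n (fun x => f x + g x) (fun x => f' x + g' x)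
  | mul {n : ℕ} {f f' g g' : J4 → ℝ} : JetPair U U' F F' n f f' → JetPair U U' F F' n g g' →
      JetPair U U' F F' n (fun x => f x * g x) (fun x => f' x * g' x)
  | inv {n : ℕ} {f f' : J4 → ℝ} : JetPair U U' F F' n f f' → (∀ x ∈ U, f x ≠ 0) →
      (∀ x ∈ U', f' x ≠ 0) → JetPair U U' F F' n (fun x => (f x)⁻¹) (fun x => (f' x)⁻¹)
  | pd {n : ℕ} {f f' : J4 → ℝ} (k : Fin 4) (hk : k ≠ 0) : JetPair U U' F F' n f f' →
      JetPair U U' F F' (n + 1) (pd k f) (pd k f')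
  | mono {n m : ℕ} {f f' : J4 → ℝ} (hnm : n ≤ m) : JetPair U U' F F' n f f' →
      JetPair U U' F F' m f f'
  | congr {n : ℕ} {f f' g g' : J4 → ℝ} : JetPair U U' F F' n f f' → (∀ x ∈ U, g x = f x) →
      (∀ x ∈ U', g' x = f' x) → JetPair U U' F F' n g g'

/-- The partial derivatives of order at most `n` of `f` at `j` agree with those of `f'` at `j'`. -/
def JetsAgree (j j' : J4) : ℕ → (J4 → ℝ) → (J4 → ℝ) → Prop
  | 0, f, f' => f j = f' j'
  | n + 1, f, f' => f j = f' j' ∧ ∀ k, JetsAgree j j' n (pd k f) (pd k f')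

namespace JetsAgree

variable {U U' : Set J4} {f f' g g' : J4 → ℝ} {j j' : J4}

theorem eq {n : ℕ} (h : JetsAgree j j' n f f') : f j = f' j' := by
  cases n with
  | zero => exact h
  | succ n => exact h.1

theorem of_succ {n : ℕ} (h : JetsAgree j j' (n + 1) f f') : JetsAgree j j' n f f' := by
  induction n generalizing f f' with
  | zero => exact h.1
  | succ n ih => exact ⟨h.1, fun k => ih (h.2 k)⟩

theorem mono {n m : ℕ} (hnm : n ≤ m) (h : JetsAgree j j' m f f') : JetsAgree j j' n f f' := by
  induction m, hnm using Nat.le_induction with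
  | base => exact h
  | succ m _ ih => exact ih h.of_succ

theorem const (n : ℕ) (c : ℝ) : JetsAgree j j' n (fun _ => c) (fun _ => c) := by
  induction n generalizing c with
  | zero => rfl
  | succ n ih =>
    refine ⟨rfl, fun k => ?_⟩
    have e : pd k (fun _ : J4 => c) = fun _ => 0 := by funext x; simp [pd]
    rw [e]
    exact ih 0

theorem congr (hU : IsOpen U) (hU' : IsOpen U') (hj : j ∈ U) (hj' : j' ∈ U') {n : ℕ}
    (h : JetsAgree j j' n f f') (e : ∀ x ∈ U, g x = f x) (e' : ∀ x ∈ U', g' x = f' x) :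
    JetsAgree j j' n g g' := by
  induction n generalizing f f' g g' with
  | zero => exact (e j hj).trans (h.trans (e' j' hj').symm)
  | succ n ih =>
    exact ⟨(e j hj).trans (h.1.trans (e' j' hj').symm), fun k => ih (h.2 k)
      (fun x hx => pd_congr hU e hx k) fun x hx => pd_congr hU' e' hx k⟩

theorem add (hU : IsOpen U) (hU' : IsOpen U') (hj : j ∈ U) (hj' : j' ∈ U') {n : ℕ}
    (hf : ContDiffOn ℝ ∞ f U) (hf' : ContDiffOn ℝ ∞ f' U') (hg : ContDiffOn ℝ ∞ g U)
    (hg' : ContDiffOn ℝ ∞ g' U') (h : JetsAgree j j' n f f') (h' : JetsAgree j j' n g g') :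
    JetsAgree j j' n (fun x => f x + g x) (fun x => f' x + g' x) := by
  induction n generalizing f f' g g' with
  | zero => exact congrArg₂ (· + ·) h h'
  | succ n ih =>
    refine ⟨congrArg₂ (· + ·) h.1 h'.1, fun k => ?_⟩
    have hp {U : Set J4} {f g : J4 → ℝ} (hU : IsOpen U) (hf : ContDiffOn ℝ ∞ f U)
        (hg : ContDiffOn ℝ ∞ g U) (x : J4) (hx : x ∈ U) :
        pd k (fun x => f x + g x) x = pd k f x + pd k g x := by
      rw [pd, fderiv_fun_add (differentiableAt_of_smooth hU hf hx)
        (differentiableAt_of_smooth hU hg hx)]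
      rfl
    exact (ih (smooth_pd hU hf k) (smooth_pd hU' hf' k) (smooth_pd hU hg k) (smooth_pd hU' hg' k)
      (h.2 k) (h'.2 k)).congr hU hU' hj hj' (hp hU hf hg) (hp hU' hf' hg')

theorem mul (hU : IsOpen U) (hU' : IsOpen U') (hj : j ∈ U) (hj' : j' ∈ U') {n : ℕ}
    (hf : ContDiffOn ℝ ∞ f U) (hf' : ContDiffOn ℝ ∞ f' U') (hg : ContDiffOn ℝ ∞ g U)
    (hg' : ContDiffOn ℝ ∞ g' U') (h : JetsAgree j j' n f f') (h' : JetsAgree j j' n g g') :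
    JetsAgree j j' n (fun x => f x * g x) (fun x => f' x * g' x) := by
  induction n generalizing f f' g g' with
  | zero => exact congrArg₂ (· * ·) h h'
  | succ n ih =>
    refine ⟨congrArg₂ (· * ·) h.1 h'.1, fun k => ?_⟩
    have hp {U : Set J4} {f g : J4 → ℝ} (hU : IsOpen U) (hf : ContDiffOn ℝ ∞ f U)
        (hg : ContDiffOn ℝ ∞ g U) (x : J4) (hx : x ∈ U) :
        pd k (fun x => f x * g x) x = f x * pd k g x + g x * pd k f x := by
      rw [pd, fderiv_fun_mul (differentiableAt_of_smooth hU hf hx)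
        (differentiableAt_of_smooth hU hg hx)]
      rfl
    have s {U : Set J4} {f : J4 → ℝ} (hU : IsOpen U) (hf : ContDiffOn ℝ ∞ f U) := smooth_pd hU hf k
    exact (add hU hU' hj hj' (hf.mul (s hU hg)) (hf'.mul (s hU' hg')) (hg.mul (s hU hf))
      (hg'.mul (s hU' hf')) (ih hf hf' (s hU hg) (s hU' hg') h.of_succ (h'.2 k))
      (ih hg hg' (s hU hf) (s hU' hf') h'.of_succ (h.2 k))).congr hU hU' hj hj' (hp hU hf hg)
      (hp hU' hf' hg')

theorem inv (hU : IsOpen U) (hU' : IsOpen U') (hj : j ∈ U) (hj' : j' ∈ U') {n : ℕ}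
    (hf : ContDiffOn ℝ ∞ f U) (hf' : ContDiffOn ℝ ∞ f' U') (h0 : ∀ x ∈ U, f x ≠ 0)
    (h0' : ∀ x ∈ U', f' x ≠ 0) (h : JetsAgree j j' n f f') :
    JetsAgree j j' n (fun x => (f x)⁻¹) (fun x => (f' x)⁻¹) := by
  induction n with
  | zero => exact congrArg (·⁻¹) h
  | succ n ih =>
    refine ⟨congrArg (·⁻¹) h.1, fun k => ?_⟩
    have hp {U : Set J4} {f : J4 → ℝ} (hU : IsOpen U) (hf : ContDiffOn ℝ ∞ f U)
        (h0 : ∀ x ∈ U, f x ≠ 0) (x : J4) (hx : x ∈ U) :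
        pd k (fun x => (f x)⁻¹) x = -1 * pd k f x * ((f x)⁻¹ * (f x)⁻¹) := by
      have d : HasDir f (Pi.single k 1) (pd k f x) x :=
        ⟨differentiableAt_of_smooth hU hf hx, rfl⟩
      rw [pd, (d.inv (h0 x hx)).eq]
      field_simp
    have s {U : Set J4} {f : J4 → ℝ} (hU : IsOpen U) (hf : ContDiffOn ℝ ∞ f U) := smooth_pd hU hf k
    have i := hf.inv h0
    have i' := hf'.inv h0'
    exact (mul hU hU' hj hj' (contDiffOn_const.mul (s hU hf)) (contDiffOn_const.mul (s hU' hf'))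
      (i.mul i) (i'.mul i') (mul hU hU' hj hj' contDiffOn_const contDiffOn_const (s hU hf)
        (s hU' hf') (const n _) (h.2 k))
      (mul hU hU' hj hj' i i' i i' (ih h.of_succ) (ih h.of_succ))).congr hU hU' hj hj'
      (hp hU hf h0) (hp hU' hf' h0')

theorem of_iteratedFDeriv (hU : IsOpen U) (hU' : IsOpen U') (hj : j ∈ U) (hj' : j' ∈ U') {n : ℕ}
    (hf : ContDiffOn ℝ ∞ f U) (hf' : ContDiffOn ℝ ∞ f' U')
    (h : ∀ k ≤ n, iteratedFDeriv ℝ k f j = iteratedFDeriv ℝ k f' j') : JetsAgree j j' n f f' := by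
  induction n generalizing f f' with
  | zero =>
    change f j = f' j'
    simpa using congrArg (fun T => T ![]) (h 0 le_rfl)
  | succ n ih =>
    refine ⟨by simpa using congrArg (fun T => T ![]) (h 0 (Nat.zero_le _)), fun k => ?_⟩
    refine ih (smooth_pd hU hf k) (smooth_pd hU' hf' k) fun i hi => ?_
    have hp {U : Set J4} {f : J4 → ℝ} {j : J4} (hU : IsOpen U) (hf : ContDiffOn ℝ ∞ f U)
        (hj : j ∈ U) (v : Fin i → J4) :
        iteratedFDeriv ℝ i (pd k f) j v
          = iteratedFDeriv ℝ (i + 1) f j (Fin.snoc v (Pi.single k 1)) := by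
      have e : pd k f = (ContinuousLinearMap.apply ℝ ℝ (Pi.single k 1 : J4)) ∘ fderiv ℝ f := rfl
      rw [e, ContinuousLinearMap.iteratedFDeriv_comp_left _
        (((hf.fderiv_of_isOpen hU (m := ∞) (by simp)).contDiffAt (hU.mem_nhds hj))) (i := i)
        (WithTop.coe_le_coe.2 le_top), iteratedFDeriv_succ_apply_right]
      simp [Fin.init_snoc]
    ext v
    rw [hp hU hf hj, hp hU' hf' hj', h (i + 1) (by omega)]

end JetsAgree

namespace JetPair

variable {U U' : Set J4} {F F' f f' g g' : J4 → ℝ} {n : ℕ}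

theorem smooth (hF : IsAdmissible U F) (hF' : IsAdmissible U' F') (h : JetPair U U' F F' n f f') :
    ContDiffOn ℝ ∞ f U ∧ ContDiffOn ℝ ∞ f' U' := by
  induction h with
  | base n => exact ⟨hF.smooth, hF'.smooth⟩
  | const n c => exact ⟨contDiffOn_const, contDiffOn_const⟩
  | add _ _ h h' => exact ⟨h.1.add h'.1, h.2.add h'.2⟩
  | mul _ _ h h' => exact ⟨h.1.mul h'.1, h.2.mul h'.2⟩
  | inv _ h0 h0' h => exact ⟨h.1.inv h0, h.2.inv h0'⟩
  | pd k _ _ h => exact ⟨smooth_pd hF.isOpen h.1 k, smooth_pd hF'.isOpen h.2 k⟩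
  | mono _ _ h => exact h
  | congr _ e e' h => exact ⟨h.1.congr e, h.2.congr e'⟩

theorem jetsAgree (hF : IsAdmissible U F) (hF' : IsAdmissible U' F')
    (h : JetPair U U' F F' n f f') {j j' : J4} (hj : j ∈ U) (hj' : j' ∈ U') {N : ℕ} (hn : n ≤ N)
    (hN : ∀ k ≤ N, iteratedFDeriv ℝ k F j = iteratedFDeriv ℝ k F' j') :
    JetsAgree j j' (N - n) f f' := by
  have o := hF.isOpen
  have o' := hF'.isOpen
  induction h with
  | base n =>
    exact (JetsAgree.of_iteratedFDeriv o o' hj hj' hF.smooth hF'.smooth hN).mono (Nat.sub_le N n)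
  | const n c => exact JetsAgree.const _ c
  | add a b h h' =>
    exact (h hn).add o o' hj hj' (a.smooth hF hF').1 (a.smooth hF hF').2 (b.smooth hF hF').1
      (b.smooth hF hF').2 (h' hn)
  | mul a b h h' =>
    exact (h hn).mul o o' hj hj' (a.smooth hF hF').1 (a.smooth hF hF').2 (b.smooth hF hF').1
      (b.smooth hF hF').2 (h' hn)
  | inv a h0 h0' h =>
    exact (h hn).inv o o' hj hj' (a.smooth hF hF').1 (a.smooth hF hF').2 h0 h0'
  | @pd m _ _ k _ _ h =>
    have e : N - m = N - (m + 1) + 1 := by omega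
    have := h (by omega)
    rw [e] at this
    exact this.2 k
  | mono hnm _ h => exact (h (hnm.trans hn)).mono (by omega)
  | congr _ e e' h => exact (h hn).congr o o' hj hj' e e'

theorem neg (h : JetPair U U' F F' n f f') :
    JetPair U U' F F' n (fun x => -f x) (fun x => -f' x) :=
  ((const n (-1)).mul h).congr (fun _ _ => by ring) fun _ _ => by ring

theorem sub (h : JetPair U U' F F' n f f') (h' : JetPair U U' F F' n g g') :
    JetPair U U' F F' n (fun x => f x - g x) (fun x => f' x - g' x) :=
  (h.add h'.neg).congr (fun _ _ => by ring) fun _ _ => by ring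

theorem div (h : JetPair U U' F F' n f f') (h' : JetPair U U' F F' n g g')
    (h0 : ∀ x ∈ U, g x ≠ 0) (h0' : ∀ x ∈ U', g' x ≠ 0) :
    JetPair U U' F F' n (fun x => f x / g x) (fun x => f' x / g' x) :=
  (h.mul (h'.inv h0 h0')).congr (fun _ _ => div_eq_mul_inv _ _) fun _ _ => div_eq_mul_inv _ _

theorem pow (h : JetPair U U' F F' n f f') (m : ℕ) :
    JetPair U U' F F' n (fun x => f x ^ m) (fun x => f' x ^ m) := by
  induction m with
  | zero => exact (const n 1).congr (by simp) (by simp)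
  | succ m ih => exact (ih.mul h).congr (fun _ _ => pow_succ _ _) fun _ _ => pow_succ _ _

/-- Differentiation along `D` does not raise the order, because `D F = 0` and
`[∂_k, D] = δ_{k3} ∂_z`. -/
theorem opD (hF : IsAdmissible U F) (hF' : IsAdmissible U' F') (h : JetPair U U' F F' n f f') :
    JetPair U U' F F' n (opD f) (opD f') := by
  have eq {U : Set J4} {F f : J4 → ℝ} (hU : IsAdmissible U F) (hf : ContDiffOn ℝ ∞ f U) {x : J4}
      (hx : x ∈ U) : HasDir f (vD x) (CartanPDE.opD f x) x :=
    ⟨differentiableAt_of_smooth hU.isOpen hf hx, fderiv_vD f x⟩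
  induction h with
  | base n => exact (const n 0).congr hF.opD_eq_zero hF'.opD_eq_zero
  | const n c =>
    exact (const n 0).congr (fun x _ => by simp [CartanPDE.opD, CartanPDE.pd])
      fun x _ => by simp [CartanPDE.opD, CartanPDE.pd]
  | add a b h h' =>
    refine (h.add h').congr (fun x hx => ?_) fun x hx => ?_ <;> rw [← fderiv_vD]
    · exact ((eq hF (a.smooth hF hF').1 hx).add (eq hF (b.smooth hF hF').1 hx)).eq
    · exact ((eq hF' (a.smooth hF hF').2 hx).add (eq hF' (b.smooth hF hF').2 hx)).eq
  | mul a b h h' =>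
    refine ((a.mul h').add (h.mul b)).congr (fun x hx => ?_) fun x hx => ?_ <;> rw [← fderiv_vD]
    · exact ((eq hF (a.smooth hF hF').1 hx).mul (eq hF (b.smooth hF hF').1 hx)).eq
    · exact ((eq hF' (a.smooth hF hF').2 hx).mul (eq hF' (b.smooth hF hF').2 hx)).eq
  | inv a h0 h0' h =>
    refine (h.neg.div (a.pow 2) (fun x hx => pow_ne_zero 2 (h0 x hx))
      fun x hx => pow_ne_zero 2 (h0' x hx)).congr (fun x hx => ?_) fun x hx => ?_ <;>
      rw [← fderiv_vD]
    · exact ((eq hF (a.smooth hF hF').1 hx).inv (h0 x hx)).eq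
    · exact ((eq hF' (a.smooth hF hF').2 hx).inv (h0' x hx)).eq
  | @pd m f f' k hk a h =>
    have b : JetPair U U' F F' (m + 1) (fun x => if k = 3 then CartanPDE.pd 2 f x else 0)
        (fun x => if k = 3 then CartanPDE.pd 2 f' x else 0) := by
      split_ifs
      · exact a.pd 2 (by simp)
      · exact const _ 0
    exact ((h.pd k hk).sub b).congr (fun x hx => opD_pd hF.isOpen (a.smooth hF hF').1 hx k)
      fun x hx => opD_pd hF'.isOpen (a.smooth hF hF').2 hx k
  | mono hnm _ h => exact h.mono hnm
  | congr a e e' h =>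
    refine h.congr (fun x hx => ?_) fun x hx => ?_ <;> unfold CartanPDE.opD
    · rw [pd_congr hF.isOpen e hx, pd_congr hF.isOpen e hx]
    · rw [pd_congr hF'.isOpen e' hx, pd_congr hF'.isOpen e' hx]

theorem opDelta (h : JetPair U U' F F' n f f') :
    JetPair U U' F F' (n + 1) (opDelta F f) (opDelta F' f') :=
  (h.pd 1 (by simp)).add ((base _).mul (h.pd 2 (by simp)))

theorem dp (m : ℕ) : JetPair U U' F F' m (dp m F) (dp m F') := by
  induction m with
  | zero => exact base 0
  | succ m ih =>
    have e (F : J4 → ℝ) : CartanPDE.dp (m + 1) F = CartanPDE.pd 3 (CartanPDE.dp m F) :=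
      Function.iterate_succ_apply' _ _ _
    rw [e, e]
    exact ih.pd 3 (by simp)

theorem dzp (m : ℕ) : JetPair U U' F F' (m + 1) (dzp m F) (dzp m F') := (dp m).pd 2 (by simp)

theorem deltaP (m : ℕ) : JetPair U U' F F' (m + 1) (deltaP m F) (deltaP m F') := (dp m).opDelta

end JetPair

namespace JetPair

variable {U U' : Set J4} {F F' f f' : J4 → ℝ} {n : ℕ}

theorem cA (hF : IsAdmissible U F) (hF' : IsAdmissible U' F') :
    JetPair U U' F F' 3 (cA F) (cA F') :=
  (const _ _).mul ((dp 3).div ((dp 2).mono (by simp)) hF.Fpp_ne_zero hF'.Fpp_ne_zero)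

theorem cB (hF : IsAdmissible U F) (hF' : IsAdmissible U' F') :
    JetPair U U' F F' 4 (cB F) (cB F') := by
  have d (n : ℕ) (hn : n ≤ 4) : JetPair U U' F F' 4 _ _ := (dp n).mono hn
  have z (n : ℕ) (hn : n + 1 ≤ 4) : JetPair U U' F F' 4 _ _ := (dzp n).mono hn
  have D (n : ℕ) (hn : n + 1 ≤ 4) : JetPair U U' F F' 4 _ _ := (deltaP n).mono hn
  have d1 := d 1 (by simp)
  have d2 := d 2 (by simp)
  have d3 := d 3 (by simp)
  have z1 := z 1 (by simp)
  have z2 := z 2 (by simp)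
  have D2 := D 2 (by simp)
  have D3 := D 3 (by simp)
  exact (((((D3.mul d2).sub (D2.mul d3)).add ((((const 4 3).mul d1).mul d2).mul z2)).sub
    (((const 4 3).mul (d2.pow 2)).mul z1)).sub ((((const 4 2).mul d1).mul d3).mul z1)).div
    ((const 4 6).mul (d2.pow 3))
    (fun x hx => mul_ne_zero (by simp) (pow_ne_zero 3 (hF.Fpp_ne_zero x hx)))
    fun x hx => mul_ne_zero (by simp) (pow_ne_zero 3 (hF'.Fpp_ne_zero x hx))

theorem cC (hF : IsAdmissible U F) (hF' : IsAdmissible U' F') :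
    JetPair U U' F F' 4 (cC F) (cC F') := by
  have d2 : JetPair U U' F F' 4 _ _ := (dp 2).mono (by simp)
  have d3 : JetPair U U' F F' 4 _ _ := (dp 3).mono (by simp)
  exact (((const 4 4).mul (d3.pow 2)).sub (((const 4 3).mul d2).mul (dp 4))).div
    ((const 4 18).mul (d2.pow 2))
    (fun x hx => mul_ne_zero (by simp) (pow_ne_zero 2 (hF.Fpp_ne_zero x hx)))
    fun x hx => mul_ne_zero (by simp) (pow_ne_zero 2 (hF'.Fpp_ne_zero x hx))

theorem opE4 (hF : IsAdmissible U F) (hF' : IsAdmissible U' F') (hn : 1 ≤ n)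
    (h : JetPair U U' F F' n f f') : JetPair U U' F F' (n + 1) (opE4 F f) (opE4 F' f') :=
  (h.opDelta.sub (((dp 1).mono (by omega)).mul ((h.opD hF hF').mono (by omega)))).div
    ((dp 2).mono (by omega)) hF.Fpp_ne_zero hF'.Fpp_ne_zero

theorem torsB (hF : IsAdmissible U F) (hF' : IsAdmissible U' F') :
    JetPair U U' F F' 5 (torsB F) (torsB F') :=
  ((cB hF hF').pd 3 (by simp)).sub
    (((cA hF hF').mono (by simp)).mul ((cB hF hF').mono (by simp)))

theorem torsC (hF : IsAdmissible U F) (hF' : IsAdmissible U' F') :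
    JetPair U U' F F' 5 (torsC F) (torsC F') := by
  have a : JetPair U U' F F' 5 _ _ := (cA hF hF').mono (by simp)
  have b : JetPair U U' F F' 5 _ _ := (cB hF hF').mono (by simp)
  have c : JetPair U U' F F' 5 _ _ := (cC hF hF').mono (by simp)
  have d2 : JetPair U U' F F' 5 _ _ := (dp 2).mono (by simp)
  have z (n : ℕ) (hn : n + 1 ≤ 5) : JetPair U U' F F' 5 _ _ := (dzp n).mono hn
  have q {f f' : J4 → ℝ} (h : JetPair U U' F F' 5 f f') :=
    h.div d2 hF.Fpp_ne_zero hF'.Fpp_ne_zero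
  exact (((q (c.mul (z 0 (by simp)))).neg.sub ((cC hF hF').opE4 hF hF' (by simp))).add
    (q ((z 2 (by simp)).sub (((const 5 2).mul a).mul (z 1 (by simp)))))).add
    (((const 5 3).mul a).mul b)

theorem conn23 (hF : IsAdmissible U F) (hF' : IsAdmissible U' F') :
    JetPair U U' F F' 5 (conn23 F) (conn23 F') := by
  have a : JetPair U U' F F' 5 _ _ := (cA hF hF').mono (by simp)
  have b : JetPair U U' F F' 5 _ _ := (cB hF hF').mono (by simp)
  have c : JetPair U U' F F' 5 _ _ := (cC hF hF').mono (by simp)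
  exact ((torsB hF hF').add (torsC hF hF')).sub (((a.mul b).add (a.opD hF hF')).sub
    ((c.mul ((dzp 0).mono (by simp))).div ((dp 2).mono (by simp)) hF.Fpp_ne_zero hF'.Fpp_ne_zero))

theorem baseA1 (hF : IsAdmissible U F) (hF' : IsAdmissible U' F') :
    JetPair U U' F F' 5 (baseA1 F) (baseA1 F') :=
  ((cC hF hF').pd 3 (by simp)).sub (((const 5 4).mul ((cA hF hF').mono (by simp))).mul
    ((cC hF hF').mono (by simp)))

theorem baseB1 (hF : IsAdmissible U F) (hF' : IsAdmissible U' F') :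
    JetPair U U' F F' 5 (baseB1 F) (baseB1 F') :=
  (((cB hF hF').opD hF hF').add ((cB hF hF').pow 2)).mono (by simp)

theorem baseB2 (hF : IsAdmissible U F) (hF' : IsAdmissible U' F') :
    JetPair U U' F F' 5 (baseB2 F) (baseB2 F') := by
  have b : JetPair U U' F F' 5 _ _ := (cB hF hF').mono (by simp)
  exact (((cB hF hF').opE4 hF hF' (by simp)).add ((b.mul ((dzp 0).mono (by simp))).div
    ((dp 2).mono (by simp)) hF.Fpp_ne_zero hF'.Fpp_ne_zero)).neg

/-- The components of the connection forms with respect to the adapted coframe. -/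
theorem conn_frame (hF : IsAdmissible U F) (hF' : IsAdmissible U' F') (i : Fin 3) (k : Fin 4) :
    JetPair U U' F F' 5 (fun j => conn F i j (frame F k j))
      (fun j => conn F' i j (frame F' k j)) := by
  have a : JetPair U U' F F' 5 _ _ := (cA hF hF').mono (by simp)
  have b : JetPair U U' F F' 5 _ _ := (cB hF hF').mono (by simp)
  have c : JetPair U U' F F' 5 _ _ := (cC hF hF').mono (by simp)
  have t := torsB hF hF'
  have s := torsC hF hF'
  have d2 : JetPair U U' F F' 5 _ _ := (dp 2).mono (by simp)
  have z (n : ℕ) (hn : n + 1 ≤ 5) : JetPair U U' F F' 5 _ _ := (dzp n).mono hn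
  have q {f f' : J4 → ℝ} (h : JetPair U U' F F' 5 f f') :=
    h.div d2 hF.Fpp_ne_zero hF'.Fpp_ne_zero
  have z0 := q (z 0 (by simp))
  have z1 := q ((const 5 2).mul (z 1 (by simp)))
  have z1c := q (((const 5 2).mul (z 1 (by simp))).mul c)
  have cD : JetPair U U' F F' 5 _ _ := ((cC hF hF').opD hF hF').mono (by simp)
  -- The entries of this matrix are the coefficients in the definition of `conn`.
  have key {U : Set J4} {F : J4 → ℝ} (h : IsAdmissible U F) (j : J4) (hj : j ∈ U) :
      conn F i j (frame F k j) =
        !![2 * CartanPDE.torsB F j + CartanPDE.torsC F j, -CartanPDE.cA F j, CartanPDE.cB F j,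
            CartanPDE.dzp 0 F j / CartanPDE.dp 2 F j;
          CartanPDE.cC F j * CartanPDE.cB F j + CartanPDE.opD (CartanPDE.cC F) j
            + 2 * CartanPDE.dzp 1 F j * CartanPDE.cC F j / CartanPDE.dp 2 F j, CartanPDE.cC F j,
            CartanPDE.conn23 F j,
            -(3 * CartanPDE.cB F j + 2 * CartanPDE.dzp 1 F j / CartanPDE.dp 2 F j);
          CartanPDE.torsB F j + CartanPDE.torsC F j, CartanPDE.cA F j, 2 * CartanPDE.cB F j,
            CartanPDE.dzp 0 F j / CartanPDE.dp 2 F j] i k := by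
    fin_cases i <;> simp [conn, h.omega_frame hj] <;> fin_cases k <;> simp
  refine JetPair.congr ?_ (key hF) (key hF')
  fin_cases i <;> fin_cases k
  exacts [((const 5 2).mul t).add s, a.neg, b, z0, ((c.mul b).add cD).add z1c, c, conn23 hF hF',
    (((const 5 3).mul b).add z1).neg, t.add s, a, (const 5 2).mul b, z0]

/-- Differentiation along the frame raises the order by one. -/
theorem fderiv_frame (hF : IsAdmissible U F) (hF' : IsAdmissible U' F')
    (h : JetPair U U' F F' 5 f f') (k : Fin 4) :
    JetPair U U' F F' 6 (fun j => fderiv ℝ f j (frame F k j))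
      (fun j => fderiv ℝ f' j (frame F' k j)) := by
  have a : JetPair U U' F F' 6 _ _ := (cA hF hF').mono (by simp)
  have b : JetPair U U' F F' 6 _ _ := (cB hF hF').mono (by simp)
  have c : JetPair U U' F F' 6 _ _ := (cC hF hF').mono (by simp)
  have hp := h.pd 3 (by simp)
  have hD : JetPair U U' F F' 6 _ _ := (h.opD hF hF').mono (by simp)
  have h4 := h.opE4 hF hF' (by simp)
  have key {F : J4 → ℝ} (f : J4 → ℝ) (j : J4) :
      fderiv ℝ f j (frame F k j) =
        ![CartanPDE.pd 2 f j + CartanPDE.cB F j * CartanPDE.pd 3 f j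
          + CartanPDE.cA F j * CartanPDE.opD f j - CartanPDE.cC F j * CartanPDE.opE4 F f j,
          CartanPDE.pd 3 f j, CartanPDE.opD f j, CartanPDE.opE4 F f j] k := by
    have p : fderiv ℝ f j vp = CartanPDE.pd 3 f j := rfl
    have z : fderiv ℝ f j (Pi.single 2 1) = CartanPDE.pd 2 f j := rfl
    fin_cases k <;> simp [frame, fderiv_vD, fderiv_vDelta, p, z, CartanPDE.opE4] <;> ring
  refine JetPair.congr ?_ (fun j _ => key (F := F) f j) fun j _ => key (F := F') f' j
  fin_cases k
  exacts [(((h.pd 2 (by simp)).add (b.mul hp)).add (a.mul hD)).sub (c.mul h4), hp, hD, h4]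

/-- The components of the exterior derivatives of the adapted coframe. -/
theorem extD_omega_frame (hF : IsAdmissible U F) (hF' : IsAdmissible U' F') (i k l : Fin 4) :
    JetPair U U' F F' 5 (fun j => extD (omega F i) j (frame F k j) (frame F l j))
      (fun j => extD (omega F' i) j (frame F' k j) (frame F' l j)) := by
  have w (i k : Fin 4) : JetPair U U' F F' 5 (fun j => omega F i j (frame F k j))
      (fun j => omega F' i j (frame F' k j)) :=
    (const 5 (if i = k then 1 else 0)).congr (fun j hj => hF.omega_frame hj i k)
      fun j hj => hF'.omega_frame hj i k
  have p (i : Fin 3) (k : Fin 4) := conn_frame hF hF' i k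
  have ww (i m : Fin 4) := ((w i k).mul (w m l)).sub ((w i l).mul (w m k))
  have pw (i : Fin 3) (m : Fin 4) := ((p i k).mul (w m l)).sub ((p i l).mul (w m k))
  have A := baseA1 hF hF'
  have B := baseB1 hF hF'
  have B' := baseB2 hF hF'
  fin_cases i
  · refine ((pw 0 0).sub (ww 1 2)).congr (fun j hj => ?_) fun j hj => ?_
    · exact congrFun₂ (hF.torsionEquations hj).1 _ _
    · exact congrFun₂ (hF'.torsionEquations hj).1 _ _
  · refine ((((pw 0 1).sub (pw 2 1)).add (B.mul (ww 0 2))).sub (B'.mul (ww 0 3))).congr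
      (fun j hj => ?_) fun j hj => ?_
    · refine (congrFun₂ (hF.torsionEquations hj).2.1 _ _).trans ?_
      simp [wedge]
      try ring
    · refine (congrFun₂ (hF'.torsionEquations hj).2.1 _ _).trans ?_
      simp [wedge]
      try ring
  · refine (((pw 1 0).add (pw 2 2)).add (ww 1 3)).congr (fun j hj => ?_) fun j hj => ?_
    · exact congrFun₂ (hF.torsionEquations hj).2.2.1 _ _
    · exact congrFun₂ (hF'.torsionEquations hj).2.2.1 _ _
  · refine (((((const 5 2).mul (pw 2 3)).sub (pw 0 3)).sub (pw 1 2)).sub (A.mul (ww 0 1))).congr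
      (fun j hj => ?_) fun j hj => ?_
    · refine (congrFun₂ (hF.torsionEquations hj).2.2.2 _ _).trans ?_
      simp [wedge]
      try ring
    · refine (congrFun₂ (hF'.torsionEquations hj).2.2.2 _ _).trans ?_
      simp [wedge]
      try ring

/-- The components of the exterior derivatives of the connection forms. -/
theorem extD_conn_frame (hF : IsAdmissible U F) (hF' : IsAdmissible U' F') (i : Fin 3)
    (k l : Fin 4) :
    JetPair U U' F F' 6 (fun j => extD (conn F i) j (frame F k j) (frame F l j))
      (fun j => extD (conn F' i) j (frame F' k j) (frame F' l j)) := by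
  have p (k : Fin 4) := conn_frame hF hF' i k
  have p' (k : Fin 4) := (p k).mono (show 5 ≤ 6 by simp)
  have e (m : Fin 4) := (extD_omega_frame hF hF' m k l).mono (show 5 ≤ 6 by simp)
  have t (m : Fin 4) := ((((p m).fderiv_frame hF hF' k).mul (const 6 (if m = l then 1 else 0))).sub
    (((p m).fderiv_frame hF hF' l).mul (const 6 (if m = k then 1 else 0)))).add ((p' m).mul (e m))
  have key {U : Set J4} {F : J4 → ℝ} (h : IsAdmissible U F) (j : J4) (hj : j ∈ U) :
      extD (conn F i) j (frame F k j) (frame F l j) = ∑ m,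
        ((fderiv ℝ (fun j => conn F i j (frame F m j)) j (frame F k j) * (if m = l then 1 else 0)
          - fderiv ℝ (fun j => conn F i j (frame F m j)) j (frame F l j) * (if m = k then 1 else 0))
          + conn F i j (frame F m j) * extD (omega F m) j (frame F k j) (frame F l j)) := by
    have d (m : Fin 4) : HasFDerivAt (fun j => conn F i j (frame F m j)) _ j :=
      (differentiableAt_of_smooth h.isOpen ((h.smooth_conn i).clm_apply (h.smooth_frame m))
        hj).hasFDerivAt
    have o (m : Fin 4) : HasExtD (omega F m) (extD (omega F m) j) j :=
      hasExtD_self (differentiableAt_of_smooth h.isOpen (h.smooth_omega m) hj)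
    have eq : conn F i =ᶠ[nhds j] fun x => conn F i x (frame F 0 x) • omega F 0 x
        + conn F i x (frame F 1 x) • omega F 1 x + conn F i x (frame F 2 x) • omega F 2 x
        + conn F i x (frame F 3 x) • omega F 3 x := by
      refine Filter.eventuallyEq_of_mem (h.isOpen.mem_nhds hj) fun x hx => ?_
      ext v
      conv_lhs => rw [h.eq_sum_frame hx v]
      simp [mul_comm]
    refine (congrFun₂ ((((((o 0).smul (d 0)).add ((o 1).smul (d 1))).add ((o 2).smul (d 2))).add
      ((o 3).smul (d 3))).congr_form eq).eq (frame F k j) (frame F l j)).trans ?_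
    simp only [Fin.sum_univ_four, wedge, Pi.add_apply, Pi.smul_apply, smul_eq_mul,
      h.omega_frame hj]
  exact ((((t 0).add (t 1)).add (t 2)).add (t 3)).congr
    (fun j hj => (key hF j hj).trans (Fin.sum_univ_four _))
    fun j hj => (key hF' j hj).trans (Fin.sum_univ_four _)

/-- The components of the curvature forms. -/
theorem curvComp (hF : IsAdmissible U F) (hF' : IsAdmissible U' F') (i : Fin 3) (k l : Fin 4) :
    JetPair U U' F F' 6 (fun j => curvComp (omega F) (conn F) (frame F) j i k l)
      (fun j => curvComp (omega F') (conn F') (frame F') j i k l) := by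
  have w (i k : Fin 4) : JetPair U U' F F' 6 (fun j => omega F i j (frame F k j))
      (fun j => omega F' i j (frame F' k j)) :=
    (const 6 (if i = k then 1 else 0)).congr (fun j hj => hF.omega_frame hj i k)
      fun j hj => hF'.omega_frame hj i k
  have p (i : Fin 3) (k : Fin 4) := (conn_frame hF hF' i k).mono (show 5 ≤ 6 by simp)
  have d (i : Fin 3) := extD_conn_frame hF hF' i k l
  fin_cases i
  · exact (d 0).sub (((p 1 k).mul (w 1 l)).sub ((p 1 l).mul (w 1 k)))
  · exact (d 1).sub (((p 1 k).mul ((p 0 l).sub (p 2 l))).sub ((p 1 l).mul ((p 0 k).sub (p 2 k))))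
  · exact d 2

end JetPair

/-- The curvature invariants depend only on the 6-jet of `F`. -/
theorem IsAdmissible.baseCurv_eq {U U' : Set J4} {F F' : J4 → ℝ} (hF : IsAdmissible U F)
    (hF' : IsAdmissible U' F') {j j' : J4} (hj : j ∈ U) (hj' : j' ∈ U')
    (h : ∀ k ≤ 6, iteratedFDeriv ℝ k F j = iteratedFDeriv ℝ k F' j') :
    baseCurv F j = baseCurv F' j' := by
  have e5 {f f' : J4 → ℝ} (p : JetPair U U' F F' 5 f f') : f j = f' j' :=
    (p.jetsAgree hF hF' hj hj' (by simp) h).eq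
  have e6 {f f' : J4 → ℝ} (p : JetPair U U' F F' 6 f f') : f j = f' j' :=
    (p.jetsAgree hF hF' hj hj' le_rfl h).eq
  have c : curvComp (omega F) (conn F) (frame F) j
      = curvComp (omega F') (conn F') (frame F') j' := by
    funext i k l
    exact e6 (JetPair.curvComp hF hF' i k l)
  rw [baseCurv, baseCurv, e5 (JetPair.baseA1 hF hF'), e5 (JetPair.baseB1 hF hF'),
    e5 (JetPair.baseB2 hF hF'), c]

/-! ### From point equivalences to isomorphisms of the bundles -/

section MatAct

variable {E E' : Type} [NormedAddCommGroup E] [NormedSpace ℝ E] [NormedAddCommGroup E']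
  [NormedSpace ℝ E']

theorem matAct_one (α : Fin 4 → (E →L[ℝ] ℝ)) : matAct 1 α = α := by
  funext i
  simp [matAct, Matrix.one_apply]

theorem matAct_mul (A B : Matrix (Fin 4) (Fin 4) ℝ) (α : Fin 4 → (E →L[ℝ] ℝ)) :
    matAct (A * B) α = matAct A (matAct B α) := by
  funext i
  simp only [matAct, Matrix.mul_apply, Finset.sum_smul, Finset.smul_sum, mul_smul]
  exact Finset.sum_comm

theorem matAct_comp (A : Matrix (Fin 4) (Fin 4) ℝ) (α : Fin 4 → (E →L[ℝ] ℝ)) (L : E' →L[ℝ] E)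
    (i : Fin 4) : (matAct A α i).comp L = matAct A (fun k => (α k).comp L) i := by
  ext v
  simp [matAct]

end MatAct

theorem IsParaCRMatrix.mul {A B : Matrix (Fin 4) (Fin 4) ℝ} (hA : IsParaCRMatrix A)
    (hB : IsParaCRMatrix B) : IsParaCRMatrix (A * B) := by
  obtain ⟨a, a01, a02, a03, a12, a13, a21, a31⟩ := hA
  obtain ⟨b, b01, b02, b03, b12, b13, b21, b31⟩ := hB
  refine ⟨by rw [Matrix.det_mul]; exact mul_ne_zero a b, ?_, ?_, ?_, ?_, ?_, ?_, ?_⟩ <;>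
    simp [Matrix.mul_apply, Fin.sum_univ_four, *]

theorem hMul_assoc {a b c : Fin 3 → ℝ} (ha : a ∈ params) (hb : b ∈ params) (hc : c ∈ params) :
    hMul (hMul a b) c = hMul a (hMul b c) :=
  hMat_injOn (hMul_mem (hMul_mem ha hb) hc) (hMul_mem ha (hMul_mem hb hc)) (by
    rw [hMat_hMul (hMul_mem ha hb) hc, hMat_hMul ha hb, hMat_hMul ha (hMul_mem hb hc),
      hMat_hMul hb hc, mul_assoc])

theorem hMul_hInv_hMul {a b : Fin 3 → ℝ} (ha : a ∈ params) (hb : b ∈ params) :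
    hMul (hMul a (hInv b)) b = a := by
  refine hMat_injOn (hMul_mem (hMul_mem ha (hInv_mem hb)) hb) ha ?_
  rw [hMat_hMul (hMul_mem ha (hInv_mem hb)) hb, hMat_hMul ha (hInv_mem hb), mul_assoc,
    hMat_hInv hb, mul_one]

theorem hMul_hMul_hInv {a b : Fin 3 → ℝ} (ha : a ∈ params) (hb : b ∈ params) :
    hMul (hMul a b) (hInv b) = a := by
  refine hMat_injOn (hMul_mem (hMul_mem ha hb) (hInv_mem hb)) ha ?_
  rw [hMat_hMul (hMul_mem ha hb) (hInv_mem hb), hMat_hMul ha hb, mul_assoc,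
    mul_eq_one_comm.1 (hMat_hInv hb), mul_one]

/-- The product in `H₃` of smooth functions is smooth. -/
theorem smooth_hMul {E : Type} [NormedAddCommGroup E] [NormedSpace ℝ E] {W : Set E}
    {a b : E → Fin 3 → ℝ} (ha : ContDiffOn ℝ ∞ a W) (hb : ContDiffOn ℝ ∞ b W)
    (hap : ∀ x ∈ W, a x ∈ params) : ContDiffOn ℝ ∞ (fun x => hMul (a x) (b x)) W := by
  have a' := contDiffOn_pi.1 ha
  have b' := contDiffOn_pi.1 hb
  rw [contDiffOn_pi]
  intro i
  fin_cases i
  · exact (a' 0).mul (b' 0)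
  · exact (a' 1).mul (b' 1)
  · exact ((a' 2).mul (b' 1)).add (((a' 1).div (a' 0) fun x hx => (hap x hx).1).mul (b' 2))

theorem smooth_hInv {E : Type} [NormedAddCommGroup E] [NormedSpace ℝ E] {W : Set E}
    {a : E → Fin 3 → ℝ} (ha : ContDiffOn ℝ ∞ a W) (hap : ∀ x ∈ W, a x ∈ params) :
    ContDiffOn ℝ ∞ (fun x => hInv (a x)) W := by
  have a' := contDiffOn_pi.1 ha
  rw [contDiffOn_pi]
  intro i
  fin_cases i
  · exact (a' 0).inv fun x hx => (hap x hx).1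
  · exact (a' 1).inv fun x hx => (hap x hx).2
  · exact (((a' 0).mul (a' 2)).div ((a' 1).pow 2) fun x hx => pow_ne_zero 2 (hap x hx).2).neg

theorem smooth_formPullback {E E' : Type} [NormedAddCommGroup E] [NormedSpace ℝ E]
    [NormedAddCommGroup E'] [NormedSpace ℝ E'] {W : Set E} {W' : Set E'} {φ : E → E'}
    {α : OneForm E'} (hW : IsOpen W) (hφ : ContDiffOn ℝ ∞ φ W) (hm : Set.MapsTo φ W W')
    (hα : ContDiffOn ℝ ∞ α W') : ContDiffOn ℝ ∞ (formPullback φ α) W :=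
  (hα.comp hφ hm).clm_comp (hφ.fderiv_of_isOpen hW (m := ∞) (by simp))

/-- A map covering `φ` pulls the lift of a coframe `α` back to the lift of `φ* α`, up to the element
of `H₃` that is the fibre coordinate of its value. -/
theorem formPullback_lift {ψ : P7 → P7} {φ : J4 → J4} {q : P7} (hψ : DifferentiableAt ℝ ψ q)
    (hφ : DifferentiableAt ℝ φ q.1) (e : (fun x => (ψ x).1) =ᶠ[nhds q] fun x => φ x.1)
    (α : Fin 4 → OneForm J4) (i : Fin 4) :
    formPullback ψ (lift α i) q = (matAct (hMat (ψ q).2)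
      (fun k => formPullback φ (α k) q.1) i).comp (ContinuousLinearMap.fst ℝ J4 (Fin 3 → ℝ)) := by
  have h1 : HasFDerivAt (fun x => (ψ x).1)
      ((ContinuousLinearMap.fst ℝ J4 (Fin 3 → ℝ)).comp (fderiv ℝ ψ q)) q :=
    hψ.hasFDerivAt.fst
  have h2 : HasFDerivAt (fun x : P7 => φ x.1)
      ((fderiv ℝ φ q.1).comp (ContinuousLinearMap.fst ℝ J4 (Fin 3 → ℝ))) q :=
    hφ.hasFDerivAt.comp q hasFDerivAt_fst
  have h3 := h1.unique (h2.congr_of_eventuallyEq e)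
  have h4 : (ψ q).1 = φ q.1 := e.eq_of_nhds
  rw [formPullback, lift, matAct_comp, matAct_comp]
  congr 1
  funext k
  rw [ContinuousLinearMap.comp_assoc, h3, h4]
  rfl

theorem StructureEquations.pullback {W W' : Set P7} {ψ : P7 → P7} {θ θ' : Fin 4 → OneForm P7}
    {Ω' : Fin 3 → OneForm P7} {I' : P7 → Curvature} (hW : IsOpen W) (hW' : IsOpen W')
    (hψ : ContDiffOn ℝ ∞ ψ W) (hm : Set.MapsTo ψ W W') (hθ' : ∀ i, ContDiffOn ℝ ∞ (θ' i) W')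
    (hΩ' : ∀ i, ContDiffOn ℝ ∞ (Ω' i) W') (h : StructureEquations W' θ' Ω' I')
    (e : ∀ q ∈ W, ∀ i, formPullback ψ (θ' i) q = θ i q) :
    StructureEquations W θ (fun i => formPullback ψ (Ω' i)) (fun q => I' (ψ q)) := by
  rw [structureEquations_iff] at h ⊢
  intro q hq
  have c : ContDiffAt ℝ 2 ψ q :=
    (hψ.contDiffAt (hW.mem_nhds hq)).of_le (WithTop.coe_le_coe.2 le_top)
  have ev (i : Fin 4) : θ i =ᶠ[nhds q] formPullback ψ (θ' i) :=
    Filter.eventuallyEq_of_mem (hW.mem_nhds hq) fun x hx => (e x hx i).symm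
  obtain ⟨hT, hC⟩ := h (ψ q) (hm hq)
  exact ⟨(hT.pullback c fun i => differentiableAt_of_smooth hW' (hθ' i) (hm hq)).congr_form ev,
    (hC.pullback c fun i => differentiableAt_of_smooth hW' (hΩ' i) (hm hq)).congr_form ev⟩

/-- The frame dual to the initial coframe. -/
def frame0 (F : J4 → ℝ) : Fin 4 → J4 → J4 :=
  ![fun _ => Pi.single 2 1, fun _ => vp, vD, vDelta F]

theorem omega0_frame0 (F : J4 → ℝ) (j : J4) (i k : Fin 4) :
    omega0 F i j (frame0 F k j) = if i = k then 1 else 0 := by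
  fin_cases i <;> fin_cases k <;> simp [omega0, frame0, dcoord, vp, vD, vDelta]

theorem smooth_frame0 {U : Set J4} {F : J4 → ℝ} (hF : ContDiffOn ℝ ∞ F U) (k : Fin 4) :
    ContDiffOn ℝ ∞ (frame0 F k) U := by
  fin_cases k
  · exact contDiffOn_const
  · exact contDiffOn_const
  · exact contDiffOn_const.add ((contDiff_apply ℝ ℝ (3 : Fin 4)).contDiffOn.smul contDiffOn_const)
  · exact contDiffOn_const.add (hF.smul contDiffOn_const)

theorem matAct_omega0_frame0 (F : J4 → ℝ) (j : J4) (A : Matrix (Fin 4) (Fin 4) ℝ) (i k : Fin 4) :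
    matAct A (fun l => omega0 F l j) i (frame0 F k j) = A i k := by
  simp [matAct, omega0_frame0]

/-- A point equivalence transforms the adapted coframes into each other up to a smooth function
with values in `H₃`. -/
theorem IsAdmissible.exists_hMat_of_paraCR {U U' S : Set J4} {F F' : J4 → ℝ}
    (hF : IsAdmissible U F) (hF' : IsAdmissible U' F') {Ω' : Fin 3 → OneForm P7}
    {I' : P7 → Curvature} (hC' : IsCartanCoframe (bundle U') (lift (omega F')) Ω' I') {φ : J4 → J4}
    (hS : IsOpen S) (hSU : S ⊆ U) (hφ : ContDiffOn ℝ ∞ φ S) (hm : Set.MapsTo φ S U')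
    (h : ∀ j ∈ S, ∃ g, IsParaCRMatrix g ∧
      ∀ i, (omega0 F' i (φ j)).comp (fderiv ℝ φ j) = matAct g (fun k => omega0 F k j) i) :
    ∃ κ : J4 → Fin 3 → ℝ, ContDiffOn ℝ ∞ κ S ∧ ∀ j ∈ S, κ j ∈ params ∧
      ∀ i, formPullback φ (omega F' i) j = matAct (hMat (κ j)) (fun k => omega F k j) i := by
  obtain ⟨g', -, hg'⟩ := hF'.exists_modify_eq_omega
  set ρ : Fin 4 → OneForm J4 := fun i => formPullback φ (omega F' i) with hρ
  have ρs (i : Fin 4) : ContDiffOn ℝ ∞ (ρ i) S :=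
    smooth_formPullback hS hφ hm (hF'.smooth_omega i)
  -- The matrix of `φ* ω'` with respect to the initial coframe is smooth, as opposed to the matrices
  -- given pointwise by the equivalence.
  set G : J4 → Matrix (Fin 4) (Fin 4) ℝ := fun j => Matrix.of fun i k => ρ i j (frame0 F k j)
    with hG
  have Gs (i k : Fin 4) : ContDiffOn ℝ ∞ (fun j => G j i k) S :=
    (ρs i).clm_apply ((smooth_frame0 hF.smooth k).mono hSU)
  have Ge : ∀ j ∈ S, IsParaCRMatrix (G j) ∧ ∀ i, modify G (omega0 F) i j = ρ i j := by
    intro j hj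
    obtain ⟨g, hg, e⟩ := h j hj
    have e1 (i : Fin 4) : ρ i j = matAct (g' (φ j) * g) (fun k => omega0 F k j) i := by
      rw [matAct_mul, hρ]
      simp only [formPullback, ← (hg' _ (hm hj)).2, modify, matAct_comp, e]
    have e2 : G j = g' (φ j) * g := by
      ext i k
      simp only [hG, Matrix.of_apply, e1, matAct_omega0_frame0]
    exact ⟨e2 ▸ (hg' _ (hm hj)).1.mul hg, fun i => by rw [e1, modify, e2]⟩
  -- The pullback of the Cartan coframe by `φ × id` completes the lift of `φ* ω'`.
  have hψ : ContDiffOn ℝ ∞ (Prod.map φ id : P7 → P7) (bundle S) :=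
    (hφ.comp contDiff_fst.contDiffOn fun _ hq => hq.1).prodMk contDiff_snd.contDiffOn
  have hψm : Set.MapsTo (Prod.map φ id : P7 → P7) (bundle S) (bundle U') :=
    fun q hq => ⟨hm hq.1, hq.2⟩
  obtain ⟨κ, κs, hκ⟩ := hF.mem_H3 hS hSU Gs (fun j hj => (Ge j hj).1)
    (hC'.structureEquations.pullback (θ := lift (modify G (omega0 F))) (isOpen_bundle hS)
      (isOpen_bundle hF'.isOpen) hψ hψm hC'.smooth_theta hC'.smooth_Omega fun q hq i => by
        rw [formPullback_lift (φ := φ) (differentiableAt_of_smooth (isOpen_bundle hS) hψ hq)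
          (differentiableAt_of_smooth hS hφ hq.1) (Filter.Eventually.of_forall fun _ => rfl),
          lift, matAct_comp]
        simp only [(Ge q.1 hq.1).2]
        rfl)
  exact ⟨κ, κs, fun j hj => ⟨(hκ j hj).1, fun i => ((Ge j hj).2 i).symm.trans ((hκ j hj).2 i)⟩⟩

section BundleIso

variable (φ : OpenPartialHomeomorph J4 J4) (κ : J4 → Fin 3 → ℝ)

/-- The map `(j, u) ↦ (φ j, u κ(j)⁻¹)`. -/
def bundleMap (q : P7) : P7 := (φ q.1, hMul q.2 (hInv (κ q.1)))

/-- The map `(j, u) ↦ (φ⁻¹ j, u κ(φ⁻¹ j))`. -/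
def bundleMapInv (q : P7) : P7 := (φ.symm q.1, hMul q.2 (κ (φ.symm q.1)))

variable {φ κ}

theorem smooth_bundleMap (hφ : ContDiffOn ℝ ∞ φ φ.source) (hκ : ContDiffOn ℝ ∞ κ φ.source)
    (hp : ∀ j ∈ φ.source, κ j ∈ params) :
    ContDiffOn ℝ ∞ (bundleMap φ κ) (bundle φ.source) :=
  (hφ.comp contDiff_fst.contDiffOn fun _ hq => hq.1).prodMk
    (smooth_hMul contDiff_snd.contDiffOn
      ((smooth_hInv hκ hp).comp contDiff_fst.contDiffOn fun _ hq => hq.1) fun _ hq => hq.2)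

theorem smooth_bundleMapInv (hφ : ContDiffOn ℝ ∞ φ.symm φ.target)
    (hκ : ContDiffOn ℝ ∞ κ φ.source) :
    ContDiffOn ℝ ∞ (bundleMapInv φ κ) (bundle φ.target) := by
  have h : ContDiffOn ℝ ∞ (fun q : P7 => φ.symm q.1) (bundle φ.target) :=
    hφ.comp contDiff_fst.contDiffOn fun _ hq => hq.1
  exact h.prodMk (smooth_hMul contDiff_snd.contDiffOn
    (hκ.comp h fun q hq => φ.map_target hq.1) fun _ hq => hq.2)

/-- The isomorphism of principal bundles `(j, u) ↦ (φ j, u κ(j)⁻¹)` over the source and the target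
of `φ`. -/
def bundleIso (hφ : IsSmoothBoth φ) (hκ : ContDiffOn ℝ ∞ κ φ.source)
    (hp : ∀ j ∈ φ.source, κ j ∈ params) : OpenPartialHomeomorph P7 P7 where
  toFun := bundleMap φ κ
  invFun := bundleMapInv φ κ
  source := bundle φ.source
  target := bundle φ.target
  map_source' q hq := ⟨φ.map_source hq.1, hMul_mem hq.2 (hInv_mem (hp _ hq.1))⟩
  map_target' q hq := ⟨φ.map_target hq.1, hMul_mem hq.2 (hp _ (φ.map_target hq.1))⟩
  left_inv' q hq := by
    simp only [bundleMap, bundleMapInv, φ.left_inv hq.1, hMul_hInv_hMul hq.2 (hp _ hq.1)]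
  right_inv' q hq := by
    simp only [bundleMap, bundleMapInv, φ.right_inv hq.1,
      hMul_hMul_hInv hq.2 (hp _ (φ.map_target hq.1))]
  open_source := isOpen_bundle φ.open_source
  open_target := isOpen_bundle φ.open_target
  continuousOn_toFun := (smooth_bundleMap hφ.1 hκ hp).continuousOn
  continuousOn_invFun := (smooth_bundleMapInv hφ.2 hκ).continuousOn

end BundleIso

/-- A point equivalence lifts to an isomorphism of the bundles with their coframes. -/
theorem PointEquivalentAt.coframeIsomorphicAt {U U' : Set J4} {F F' : J4 → ℝ}
    (hF : IsAdmissible U F) (hF' : IsAdmissible U' F') {Ω Ω' : Fin 3 → OneForm P7}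
    {I I' : P7 → Curvature} (hC : IsCartanCoframe (bundle U) (lift (omega F)) Ω I)
    (hC' : IsCartanCoframe (bundle U') (lift (omega F')) Ω' I') {j₀ j₀' : J4}
    (h : PointEquivalentAt U F j₀ U' F' j₀') :
    CoframeIsomorphicAt U (lift (omega F)) Ω j₀ U' (lift (omega F')) Ω' j₀' := by
  obtain ⟨-, φ, -, hφ, h0, h0', hs, ht, -, hg⟩ := h
  obtain ⟨κ, hκ, hκe⟩ := hF.exists_hMat_of_paraCR hF' hC' φ.open_source hs hφ.1
    (fun j hj => ht (φ.map_source hj)) hg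
  have hp : ∀ j ∈ φ.source, κ j ∈ params := fun j hj => (hκe j hj).1
  have hb := smooth_bundleMap hφ.1 hκ hp
  have ob := isOpen_bundle φ.open_source
  have pull : ∀ q ∈ bundle φ.source, ∀ i,
      formPullback (bundleMap φ κ) (lift (omega F') i) q = lift (omega F) i q := by
    intro q hq i
    rw [formPullback_lift (φ := φ) (differentiableAt_of_smooth ob hb hq)
      (differentiableAt_of_smooth φ.open_source hφ.1 hq.1)
      (Filter.Eventually.of_forall fun _ => rfl), lift, ← matAct_comp, show (fun k => formPullback φ (omega F' k) q.1)
        = matAct (hMat (κ q.1)) (fun k => omega F k q.1) from funext (hκe _ hq.1).2,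
      ← matAct_mul]
    congr 2
    change hMat (hMul q.2 (hInv (κ q.1))) * hMat (κ q.1) = hMat q.2
    rw [hMat_hMul hq.2 (hInv_mem (hp _ hq.1)), mul_assoc, hMat_hInv (hp _ hq.1), mul_one]
  have seq : StructureEquations (bundle φ.source) (lift (omega F))
      (fun i => formPullback (bundleMap φ κ) (Ω' i)) (fun q => I' (bundleMap φ κ q)) :=
    hC'.structureEquations.pullback ob (isOpen_bundle hF'.isOpen) hb
      (fun q hq => ⟨ht (φ.map_source hq.1), hMul_mem hq.2 (hInv_mem (hp _ hq.1))⟩)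
      hC'.smooth_theta hC'.smooth_Omega pull
  have hsub : bundle φ.source ⊆ bundle U := fun q hq => ⟨hs hq.1, hq.2⟩
  refine ⟨φ, bundleIso hφ hκ hp, hφ, ⟨hb, smooth_bundleMapInv hφ.2 hκ⟩, h0, h0', hs, ht, rfl, rfl,
    fun q _ => rfl, fun q hq a ha => ?_, fun q hq μ => pull q hq μ, fun q hq i => ?_⟩
  · exact Prod.ext rfl (hMul_assoc ha hq.2 (hInv_mem (hp _ hq.1)))
  · exact (hF.cartanCoframe_unique ob hsub (fun q hq => hC.structureEquations q (hsub hq)) seq q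
      hq).1 i

/-! ### From isomorphisms of the bundles to point equivalences -/

theorem isParaCRMatrix_hMat {u : Fin 3 → ℝ} (hu : u ∈ params) : IsParaCRMatrix (hMat u) := by
  refine ⟨fun h => ?_, ?_, ?_, ?_, ?_, ?_, ?_, ?_⟩
  · have := congrArg Matrix.det (hMat_hInv hu)
    simp [h] at this
  all_goals simp [hMat]

/-- The initial coframe in terms of the adapted one. -/
theorem IsAdmissible.exists_matAct_omega_eq_omega0 {U : Set J4} {F : J4 → ℝ}
    (h : IsAdmissible U F) {j : J4} (hj : j ∈ U) :
    ∃ g, IsParaCRMatrix g ∧ ∀ i, matAct g (fun k => omega F k j) i = omega0 F i j := by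
  have h2 := h.Fpp_ne_zero j hj
  refine ⟨!![1, 0, 0, 0; cB F j, 1, 0, 0; cA F j + cC F j * dp 1 F j / dp 2 F j, 0, 1,
    -(dp 1 F j / dp 2 F j); -(cC F j / dp 2 F j), 0, 0, (dp 2 F j)⁻¹], ⟨?_, ?_⟩, fun i => ?_⟩
  · simp [Matrix.det_succ_row_zero, Fin.sum_univ_succ, h2]
  · simp
  · have e1 : omega F 1 j = omega0 F 1 j - cB F j • omega0 F 0 j := rfl
    have e2 : omega F 2 j = omega0 F 2 j + dp 1 F j • omega0 F 3 j - cA F j • omega0 F 0 j := rfl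
    have e3 : omega F 3 j = dp 2 F j • omega0 F 3 j + cC F j • omega0 F 0 j := rfl
    ext v
    fin_cases i
    · simp [matAct, Fin.sum_univ_four, omega]
    all_goals
      simp [matAct, Fin.sum_univ_four, e1, e2, e3, show omega F 0 j = omega0 F 0 j from rfl]
    all_goals
      field_simp
      try ring

/-- The projection `(x, y, z, p) ↦ (x, y, z)` as a linear map. -/
def toBaseL : J4 →L[ℝ] J3 :=
  ContinuousLinearMap.pi ![dcoord 0, dcoord 1, dcoord 2]

theorem toBaseL_apply (j : J4) : toBaseL j = toBase j := by
  ext i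
  fin_cases i <;> rfl

/-- The section `(x, y, z) ↦ (x, y, z, p)` of the projection, for a given value of `p`. -/
def extend (p : ℝ) (b : J3) : J4 := ![b 0, b 1, b 2, p]

theorem contDiff_extend (p : ℝ) : ContDiff ℝ ∞ (extend p) := by
  rw [contDiff_pi]
  intro i
  fin_cases i
  exacts [contDiff_apply ℝ ℝ 0, contDiff_apply ℝ ℝ 1, contDiff_apply ℝ ℝ 2, contDiff_const]

theorem toBase_extend (p : ℝ) (b : J3) : toBase (extend p b) = b := by
  ext i
  fin_cases i <;> rfl

theorem dist_extend_le {j₀ : J4} {r : ℝ} {b : J3} (hr : 0 < r) (h : dist b (toBase j₀) < r) :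
    dist (extend (j₀ 3) b) j₀ < r := by
  rw [dist_pi_lt_iff hr] at h ⊢
  intro i
  fin_cases i
  · exact h 0
  · exact h 1
  · exact h 2
  · simpa [extend] using hr

/-- A map on a ball whose derivative annihilates `∂_p` factors through the projection. -/
theorem eq_extend_of_fderiv_vp {G : Type} [NormedAddCommGroup G] [NormedSpace ℝ G] {f : J4 → G}
    {j₀ j : J4} {r : ℝ} (hf : DifferentiableOn ℝ f (Metric.ball j₀ r))
    (hv : ∀ x ∈ Metric.ball j₀ r, fderiv ℝ f x vp = 0) (hj : j ∈ Metric.ball j₀ r) :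
    f j = f (extend (j₀ 3) (toBase j)) := by
  have hr : 0 < r := Metric.pos_of_mem_ball hj
  set c : ℝ → J4 := fun t => j + t • vp with hc
  have hcd (t : ℝ) : HasDerivAt c vp t := by
    have := ((hasDerivAt_id t).smul_const vp).const_add j
    rwa [one_smul] at this
  have hco : Continuous c := continuous_iff_continuousAt.2 fun t => (hcd t).continuousAt
  set I := c ⁻¹' Metric.ball j₀ r with hI
  have Io : IsOpen I := Metric.isOpen_ball.preimage hco
  have Ic : IsPreconnected I := by
    have : Convex ℝ I := by
      intro s hs t ht a b ha hb hab
      have e : c (a • s + b • t) = a • c s + b • c t := by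
        simp only [hc, smul_add, smul_eq_mul, add_smul, mul_smul]
        have : j = a • j + b • j := by rw [← add_smul, hab, one_smul]
        conv_lhs => rw [this]
        abel
      change c (a • s + b • t) ∈ Metric.ball j₀ r
      rw [e]
      exact convex_ball j₀ r hs ht ha hb hab
    exact this.isPreconnected
  have hd (t : ℝ) (ht : t ∈ I) : HasDerivAt (f ∘ c) 0 t := by
    have := ((hf.differentiableAt (Metric.isOpen_ball.mem_nhds ht)).hasFDerivAt).comp_hasDerivAt t
      (hcd t)
    rwa [hv _ ht] at this
  have e1 : c 0 = j := by simp [hc]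
  have e2 : c (j₀ 3 - j 3) = extend (j₀ 3) (toBase j) := by
    ext i
    fin_cases i <;> simp [hc, vp, extend, toBase]
  have := Io.is_const_of_deriv_eq_zero Ic (fun t ht => 
    (hd t ht).differentiableAt.differentiableWithinAt) (fun t ht => (hd t ht).deriv)
    (x := 0) (y := j₀ 3 - j 3) (by rwa [hI, Set.mem_preimage, e1])
    (by
      rw [hI, Set.mem_preimage, e2]
      refine dist_extend_le hr ?_
      rw [Metric.mem_ball, dist_pi_lt_iff hr] at hj
      rw [dist_pi_lt_iff hr]
      intro i
      fin_cases i
      exacts [hj 0, hj 1, hj 2])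
  simpa [e1, e2] using this

theorem fderiv_surjective_of_isSmoothBoth {E : Type} [NormedAddCommGroup E] [NormedSpace ℝ E]
    {φ : OpenPartialHomeomorph E E} (hφ : IsSmoothBoth φ) {x : E} (hx : x ∈ φ.source) :
    Function.Surjective (fderiv ℝ φ x) := by
  intro w
  have h1 := (differentiableAt_of_smooth φ.open_source hφ.1 hx).hasFDerivAt
  have h2 := (differentiableAt_of_smooth φ.open_target hφ.2 (φ.map_source hx)).hasFDerivAt
  rw [← φ.left_inv hx] at h1
  have h3 := h1.comp (φ x) h2
  have e : φ ∘ φ.symm =ᶠ[nhds (φ x)] id :=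
    Filter.eventuallyEq_of_mem (φ.open_target.mem_nhds (φ.map_source hx)) fun y hy =>
      φ.right_inv hy
  have h4 := h3.unique ((hasFDerivAt_id _).congr_of_eventuallyEq e)
  refine ⟨fderiv ℝ φ.symm (φ x) w, ?_⟩
  have := congrArg (fun L => L w) h4
  simpa [φ.left_inv hx] using this

/-- A local diffeomorphism of `(x, y, z, p)`-space which infinitesimally preserves the fibres of
the projection to `(x, y, z)` covers, near each point, a local diffeomorphism of
`(x, y, z)`-space. -/
theorem exists_base_diffeo {φ : OpenPartialHomeomorph J4 J4} (hφ : IsSmoothBoth φ) {j₀ : J4}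
    (h0 : j₀ ∈ φ.source) (hv : ∀ j ∈ φ.source, toBase (fderiv ℝ φ j vp) = 0) :
    ∃ (f : OpenPartialHomeomorph J3 J3) (S : Set J4), IsSmoothBoth f ∧ IsOpen S ∧ j₀ ∈ S ∧
      ∀ j ∈ φ.source ∩ S, toBase j ∈ f.source ∧ toBase (φ j) = f (toBase j) := by
  obtain ⟨r, hr, hB⟩ := Metric.isOpen_iff.1 φ.open_source j₀ h0
  set p := j₀ 3
  set A : J4 → J3 := fun j => toBaseL (φ j) with hA
  set f₁ : J3 → J3 := fun b => A (extend p b) with hf₁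
  have As : ContDiffOn ℝ ∞ A φ.source := toBaseL.contDiff.comp_contDiffOn hφ.1
  have dφ {j : J4} (hj : j ∈ φ.source) := (differentiableAt_of_smooth φ.open_source hφ.1 hj)
  have Ad {j : J4} (hj : j ∈ φ.source) : HasFDerivAt A (toBaseL.comp (fderiv ℝ φ j)) j :=
    toBaseL.hasFDerivAt.comp j (dφ hj).hasFDerivAt
  have Ae : ∀ j ∈ Metric.ball j₀ r, A j = f₁ (toBaseL j) := by
    intro j hj
    rw [toBaseL_apply]
    exact eq_extend_of_fderiv_vp (fun x hx => (Ad (hB hx)).differentiableAt.differentiableWithinAt)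
      (fun x hx => by
        rw [(Ad (hB hx)).fderiv, ContinuousLinearMap.comp_apply, toBaseL_apply, hv x (hB hx)]) hj
  have ext_mem : ∀ b ∈ Metric.ball (toBase j₀) r, extend p b ∈ Metric.ball j₀ r :=
    fun b hb => dist_extend_le hr hb
  have f₁s : ContDiffOn ℝ ∞ f₁ (Metric.ball (toBase j₀) r) :=
    As.comp (contDiff_extend p).contDiffOn fun b hb => hB (ext_mem b hb)
  -- The derivative of `f₁` is onto, because `d(toBase ∘ φ) = df₁ ∘ d(toBase)` is.
  have equiv : ∀ b ∈ Metric.ball (toBase j₀) r, ∃ L : J3 ≃L[ℝ] J3,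
      HasFDerivAt f₁ (L : J3 →L[ℝ] J3) b := by
    intro b hb
    have hx := ext_mem b hb
    have d := (differentiableAt_of_smooth Metric.isOpen_ball f₁s hb).hasFDerivAt
    have c : HasFDerivAt (fun j => f₁ (toBaseL j)) ((fderiv ℝ f₁ b).comp toBaseL) (extend p b) := by
      refine HasFDerivAt.comp (g := f₁) (extend p b) ?_ toBaseL.hasFDerivAt
      rwa [toBaseL_apply, toBase_extend]
    have e := (Ad (hB hx)).unique (c.congr_of_eventuallyEq
      (Filter.eventuallyEq_of_mem (Metric.isOpen_ball.mem_nhds hx) Ae))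
    have hs : Function.Surjective (fderiv ℝ f₁ b : J3 →ₗ[ℝ] J3) := by
      intro w
      obtain ⟨v, hv⟩ := fderiv_surjective_of_isSmoothBoth hφ (hB hx) (extend 0 w)
      refine ⟨toBaseL v, ?_⟩
      have := congrArg (fun L => L v) e
      simp only [ContinuousLinearMap.comp_apply, hv, toBaseL_apply, toBase_extend] at this
      simpa [toBaseL_apply] using this.symm
    refine ⟨(LinearEquiv.ofBijective (fderiv ℝ f₁ b : J3 →ₗ[ℝ] J3)
      ⟨LinearMap.injective_iff_surjective.2 hs, hs⟩).toContinuousLinearEquiv, ?_⟩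
    exact d
  have hb₀ : toBase j₀ ∈ Metric.ball (toBase j₀) r := Metric.mem_ball_self hr
  obtain ⟨L, hL⟩ := equiv _ hb₀
  have c₀ := f₁s.contDiffAt (Metric.isOpen_ball.mem_nhds hb₀)
  set f₀ := c₀.toOpenPartialHomeomorph f₁ hL (by simp)
  set f := f₀.restrOpen (Metric.ball (toBase j₀) r) Metric.isOpen_ball
  have tc : Continuous toBase := by
    rw [show toBase = toBaseL from funext fun j => (toBaseL_apply j).symm]
    exact toBaseL.continuous
  refine ⟨f, Metric.ball j₀ r ∩ toBase ⁻¹' f.source, ⟨f₁s.mono fun b hb => hb.2, fun a ha => ?_⟩,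
    Metric.isOpen_ball.inter (f.open_source.preimage tc), ⟨Metric.mem_ball_self hr,
      c₀.mem_toOpenPartialHomeomorph_source hL (by simp), hb₀⟩, fun j hj => ⟨hj.2.2, ?_⟩⟩
  · have hs : f.symm a ∈ f.source := f.map_target ha
    obtain ⟨L', hL'⟩ := equiv _ hs.2
    exact (f.contDiffAt_symm ha hL'
      (f₁s.contDiffAt (Metric.isOpen_ball.mem_nhds hs.2))).contDiffWithinAt
  · rw [← toBaseL_apply (φ j)]
    exact (Ae j hj.2.1).trans (by rw [toBaseL_apply]; rfl)

/-- An isomorphism of the bundles with their coframes covers a point equivalence. -/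
theorem CoframeIsomorphicAt.pointEquivalentAt {U U' : Set J4} {F F' : J4 → ℝ}
    (hF : IsAdmissible U F) (hF' : IsAdmissible U' F') {Ω Ω' : Fin 3 → OneForm P7} {j₀ j₀' : J4}
    (h : CoframeIsomorphicAt U (lift (omega F)) Ω j₀ U' (lift (omega F')) Ω' j₀') :
    PointEquivalentAt U F j₀ U' F' j₀' := by
  obtain ⟨φ, Φ, hφ, hΦ, h0, h0', hs, ht, hΦs, hΦt, hcov, -, hθ, -⟩ := h
  have g : ∀ j ∈ φ.source, ∃ g, IsParaCRMatrix g ∧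
      ∀ i, (omega0 F' i (φ j)).comp (fderiv ℝ φ j) = matAct g (fun k => omega0 F k j) i := by
    intro j hj
    have hq : ((j, ![1, 1, 0]) : P7) ∈ Φ.source := hΦs ▸ ⟨hj, by simp, by simp⟩
    set q : P7 := (j, ![1, 1, 0])
    have hu : (Φ q).2 ∈ params := (hΦt ▸ Φ.map_source hq : Φ q ∈ bundle φ.target).2
    have key : matAct (hMat (Φ q).2) (fun k => formPullback φ (omega F' k) j)
        = fun k => omega F k j := by
      funext i
      have e := hθ q hq i
      change formPullback Φ (lift (omega F') i) q = _ at e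
      rw [formPullback_lift (φ := φ) (differentiableAt_of_smooth Φ.open_source hΦ.1 hq)
        (differentiableAt_of_smooth φ.open_source hφ.1 hj)
        (Filter.eventuallyEq_of_mem (Φ.open_source.mem_nhds hq) hcov), lift, ← matAct_comp,
        hMat_one, matAct_one] at e
      ext v
      exact congrArg (fun L => L (v, 0)) e
    have key' : (fun k => formPullback φ (omega F' k) j)
        = matAct (hMat (hInv (Φ q).2)) (fun k => omega F k j) := by
      rw [← key, ← matAct_mul, hMat_hInv hu, matAct_one]
    obtain ⟨g₁, hg₁, e₁⟩ := hF'.exists_matAct_omega_eq_omega0 (ht (φ.map_source hj))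
    obtain ⟨g₂, -, hg₂⟩ := hF.exists_modify_eq_omega
    refine ⟨g₁ * hMat (hInv (Φ q).2) * g₂ j,
      (hg₁.mul (isParaCRMatrix_hMat (hInv_mem hu))).mul (hg₂ j (hs hj)).1, fun i => ?_⟩
    have e₂ : matAct (g₂ j) (fun k => omega0 F k j) = fun k => omega F k j :=
      funext (hg₂ j (hs hj)).2
    rw [matAct_mul, matAct_mul, e₂, ← key', ← e₁, matAct_comp]
    rfl
  -- `φ* ω'₀¹`, `φ* ω'₀³`, `φ* ω'₀⁴` are combinations of `ω₀¹`, `ω₀³`, `ω₀⁴`, which vanish on `∂_p`.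
  obtain ⟨f, S, hf, hS, h0S, hfS⟩ := exists_base_diffeo hφ h0 fun j hj => by
    obtain ⟨g, ⟨-, g01, g02, g03, g12, g13, g21, g31⟩, e⟩ := g j hj
    have c (i : Fin 4) : omega0 F' i (φ j) (fderiv ℝ φ j vp) = g i 1 := by
      rw [← matAct_omega0_frame0 F j g i 1, ← e]
      rfl
    have c0 := c 0
    have c2 := c 2
    have c3 := c 3
    simp only [omega0, dcoord, Matrix.cons_val, sub_apply, smul_apply,
      ContinuousLinearMap.proj_apply, smul_eq_mul, g01, g21, g31] at c0 c2 c3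
    rw [c2, c3] at c0
    ext i
    fin_cases i
    · exact c2
    · exact c3
    · change fderiv ℝ φ j vp 2 = 0
      simpa using c0
  refine ⟨f, φ.restrOpen S hS, hf, ⟨hφ.1.mono fun j hj => hj.1, hφ.2.mono fun j hj => hj.1⟩,
    ⟨h0, h0S⟩, h0', fun j hj => hs hj.1, fun j hj => ht hj.1, hfS, fun j hj => g j hj.1⟩

end CartanPDE

end

open CartanPDE in
theorem mainTheorem3 :
    -- existence and uniqueness of the bundle and of the coframe
    (∀ (U : Set J4) (F : J4 → ℝ), IsAdmissible U F →
      (∃ (Ω : Fin 3 → OneForm P7) (I : P7 → Curvature),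
        IsCartanCoframe (bundle U) (lift (omega F)) Ω I ∧
        (∀ (Ω' : Fin 3 → OneForm P7) (I' : P7 → Curvature),
          IsCartanCoframe (bundle U) (lift (omega F)) Ω' I' →
            ∀ q ∈ bundle U, (∀ i, Ω' i q = Ω i q) ∧ I' q = I q) ∧
        (∀ q ∈ bundle U,
          (I q).A1 = -(1 / 54) * (1 / q.2 0 ^ 3) * (monge F q.1 / dp 2 F q.1 ^ 3) ∧
          (I q).C1 = 1 / 3 * (1 / (q.2 0 ^ 2 * q.2 1)) * (invK F q.1 / dp 2 F q.1 ^ 5))) ∧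
      (∃ g : J4 → Matrix (Fin 4) (Fin 4) ℝ, (∀ i k, ContDiffOn ℝ ∞ (fun j => g j i k) U) ∧
        ∀ j ∈ U, IsParaCRMatrix (g j) ∧ ∀ i, modify g (omega0 F) i j = omega F i j) ∧
      (∀ (V : Set J4) (g : J4 → Matrix (Fin 4) (Fin 4) ℝ), IsOpen V → V ⊆ U →
        (∀ i k, ContDiffOn ℝ ∞ (fun j => g j i k) V) → (∀ j ∈ V, IsParaCRMatrix (g j)) →
        (∃ (Ω : Fin 3 → OneForm P7) (I : P7 → Curvature),
          IsCartanCoframe (bundle V) (lift (modify g (omega0 F))) Ω I) →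
        ∀ j ∈ V, ∃ h ∈ H3, ∀ i,
          modify g (omega0 F) i j = matAct (h : Matrix (Fin 4) (Fin 4) ℝ) (fun k => omega F k j) i)) ∧
    -- the curvature invariants depend only on the derivatives of `F` of order at most six
    (∀ (U U' : Set J4) (F F' : J4 → ℝ) (Ω Ω' : Fin 3 → OneForm P7) (I I' : P7 → Curvature),
      IsAdmissible U F → IsAdmissible U' F' →
      IsCartanCoframe (bundle U) (lift (omega F)) Ω I →
      IsCartanCoframe (bundle U') (lift (omega F')) Ω' I' →
      ∀ j ∈ U, ∀ j' ∈ U', (∀ k ≤ 6, iteratedFDeriv ℝ k F j = iteratedFDeriv ℝ k F' j') →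
        ∀ u ∈ params, I (j, u) = I' (j', u)) ∧
    -- the coframe solves the equivalence problem
    (∀ (U U' : Set J4) (F F' : J4 → ℝ) (Ω Ω' : Fin 3 → OneForm P7) (I I' : P7 → Curvature),
      IsAdmissible U F → IsAdmissible U' F' →
      IsCartanCoframe (bundle U) (lift (omega F)) Ω I →
      IsCartanCoframe (bundle U') (lift (omega F')) Ω' I' →
      ∀ j₀ ∈ U, ∀ j₀' ∈ U',
        (PointEquivalentAt U F j₀ U' F' j₀' ↔
          CoframeIsomorphicAt U (lift (omega F)) Ω j₀ U' (lift (omega F')) Ω' j₀')) := by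
  refine ⟨fun U F h => ⟨?_, h.exists_modify_eq_omega, ?_⟩, ?_, ?_⟩
  · refine ⟨_, _, h.isCartanCoframe, fun Ω' I' h' q hq => ?_, fun q hq => ?_⟩
    · exact h.cartanCoframe_unique (isOpen_bundle h.isOpen) subset_rfl
        h.isCartanCoframe.structureEquations h'.structureEquations q hq
    · exact h.liftCurv_baseCurv hq
  · rintro V g hV hVU hg hG ⟨Ω, I, hC⟩ j hj
    exact h.exists_mem_H3 hV hVU hg hG hC hj
  · intro U U' F F' Ω Ω' I I' hF hF' hC hC' j hj j' hj' hjet u hu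
    have e {U : Set J4} {F : J4 → ℝ} {Ω : Fin 3 → OneForm P7} {I : P7 → Curvature} {j : J4}
        (hF : IsAdmissible U F) (hC : IsCartanCoframe (bundle U) (lift (omega F)) Ω I)
        (hj : j ∈ U) : I (j, u) = liftCurv (baseCurv F j) u :=
      (hF.cartanCoframe_unique (isOpen_bundle hF.isOpen) subset_rfl
        hF.isCartanCoframe.structureEquations hC.structureEquations (j, u) ⟨hj, hu⟩).2
    rw [e hF hC hj, e hF' hC' hj', hF.baseCurv_eq hF' hj hj' hjet]
  · intro U U' F F' Ω Ω' I I' hF hF' hC hC' j₀ _ j₀' _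
    exact ⟨fun h => h.coframeIsomorphicAt hF hF' hC hC', fun h => h.pointEquivalentAt hF hF'⟩
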